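/- **Theorem 3.1 (semi-homogenization with linear growth).** Let $m,d\ge 1$ be integers, let $Y=\,]0,1[^d$, let $\Omega\subset\mathbb R^d$ be a bounded open set, and let $\mathbb M^{m\times d}$ be the space of real $m\times d$ matrices with the Euclidean norm $|\cdot|$. Let $f:\mathbb R^d\times\mathbb M^{m\times d}\to[0,+\infty]$ be Borel measurable and such that $f(\cdot,\xi)$ is $Y$-periodic for every $\xi$ (that is, $1$-periodic in each coordinate direction), and such that for some $c>0$ we have $f(x,\xi)\le c(1+|\xi|)$ for all $(x,\xi)$. For $u\in W^{1,\infty}(\Omega;\mathbb R^m)$ and $r\in[0,+\infty]$ put $$G_r(u)=\inf\Big\{\liminf_{\varepsilon\to0}\int_\Omega f\big(\tfrac x\varepsilon,\nabla u_\varepsilon(x)\big)\,dx\Big\},\qquad H_r(u)=\inf\Big\{\limsup_{\varepsilon\to0}\int_\Omega f\big(\tfrac x\varepsilon,\nabla u_\varepsilon(x)\big)\,dx\Big\}\ \ (r<+\infty),$$ both infima being over all families $(u_\varepsilon)_{\varepsilon>0}\subset W^{1,\infty}(\Omega;\mathbb R^m)$ such that $\sup_{\varepsilon>0}\|\nabla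 u_\varepsilon\|_\infty\le r$ and $u_\varepsilon\stackrel{*}{\rightharpoonup}u$ in $W^{1,\infty}(\Omega;\mathbb R^m)$ as $\varepsilon\to0^+$ (that is, $u_\varepsilon\stackrel{*}{\rightharpoonup}u$ and $\nabla u_\varepsilon\stackrel{*}{\rightharpoonup}\nabla u$ in $L^\infty(\Omega)$), with $\inf\emptyset=+\infty$. For a bounded open set $D$ let $W^{1,\infty}_0(D;\mathbb R^m)$ be the set of $\varphi\in W^{1,\infty}(D;\mathbb R^m)$ that are continuous up to $\partial D$ with $\varphi=0$ on $\partial D$. For $r\in[0,+\infty]$ and $\xi\in\mathbb M^{m\times d}$ put $$\mathcal H_rf(\xi)=\inf_{n\ge1}\frac1{n^d}\inf\Big\{\int_{nY}f(x,\xi+\nabla\phi(x))\,dx:\ \phi\in W^{1,\infty}_0(nY;\mathbb R^m),\ \|\nabla\phi\|_\infty\le r\Big\},\qquad \mathcal Hf=\mathcal H_\infty f.$$ Let $\mathrm{Aff}(\Omega;\mathbb R^m)$ be the set of continuous $u\in W^{1,\infty}(\Omega;\mathbb R^m)$ for which there are finitely many disjoint open sets $D_i\subset\Omega$ with $|\partial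 D_i|=0$ and $|\Omega\setminus\bigcup_iD_i|=0$, and matrices $\xi_i\in\mathbb M^{m\times d}$, such that $\nabla u=\xi_i$ a.e. in $D_i$ for each $i$. Then: 1. for every $u\in W^{1,\infty}(\Omega;\mathbb R^m)$ and every $r\in[0,+\infty]$, $\displaystyle G_r(u)\ge\int_\Omega\mathcal Hf(\nabla u(x))\,dx$; 2. for every $u\in\mathrm{Aff}(\Omega;\mathbb R^m)$ and every $r\in[0,+\infty[$, $\displaystyle H_{r+\|\nabla u\|_\infty}(u)\le\int_\Omega\mathcal H_rf(\nabla u(x))\,dx$; 3. $\mathcal Hf$ is quasiconvex, that is, it is finite, Borel measurable, and for every $\xi\in\mathbb M^{m\times d}$ $$\mathcal Hf(\xi)=\inf\Big\{\int_Y\mathcal Hf(\xi+\nabla\phi(x))\,dx:\ \phi\in W^{1,\infty}_0(Y;\mathbb R^m)\Big\}.$$ -/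

import Mathlib

open MeasureTheory Filter Topology
open scoped ENNReal NNReal ContDiff

noncomputable section

namespace SemiHom

/-- `ℝ^d` with its Euclidean norm. -/
abbrev Vec (d : ℕ) : Type := EuclideanSpace ℝ (Fin d)

/-- The space of real `m × d` matrices with the Euclidean (Frobenius) norm; the entry of `ξ` in
row `i` and column `j` is `ξ (i, j)`. -/
abbrev Mat (m d : ℕ) : Type := EuclideanSpace ℝ (Fin m × Fin d)

/-- The open cube `]0,n[^d`. The unit cell `Y` is `cube d 1`. -/
def cube (d n : ℕ) : Set (Vec d) := {x | ∀ j, 0 < x j ∧ x j < n}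

/-- `g` is the distributional gradient of `u` in the open set `Ω`: for every `φ ∈ C_c^∞(Ω)`,
`∫_Ω u_i ∂_j φ = - ∫_Ω g_{ij} φ`. -/
def HasWeakGradient {m d : ℕ} (Ω : Set (Vec d)) (u : Vec d → Vec m) (g : Vec d → Mat m d) : Prop :=
  ∀ φ : Vec d → ℝ, ContDiff ℝ ∞ φ → HasCompactSupport φ → tsupport φ ⊆ Ω →
    ∀ (i : Fin m) (j : Fin d),
      ∫ x in Ω, u x i * fderiv ℝ φ x (EuclideanSpace.single j 1) = -∫ x in Ω, g x (i, j) * φ x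

/-- An element of the Sobolev space `W^{1,∞}(Ω; ℝ^m)`, given by an essentially bounded
representative `toFun` and a representative `grad` of its essentially bounded weak gradient.
Values outside `Ω` play no role. -/
structure W1inf {d : ℕ} (Ω : Set (Vec d)) (m : ℕ) where
  toFun : Vec d → Vec m
  grad : Vec d → Mat m d
  memLp_toFun : MemLp toFun ⊤ (volume.restrict Ω)
  memLp_grad : MemLp grad ⊤ (volume.restrict Ω)
  hasWeakGradient : HasWeakGradient Ω toFun grad

namespace W1inf

variable {m d : ℕ} {Ω : Set (Vec d)}

/-- `‖∇u‖_∞`, the essential supremum over `Ω` of the norm of the gradient. -/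
def gradNorm (u : W1inf Ω m) : ℝ≥0∞ := eLpNorm u.grad ⊤ (volume.restrict Ω)

/-- `u ∈ W^{1,∞}_0(Ω; ℝ^m)`, i.e. `u = 0` on `∂Ω`: the function `u` has a representative that is
continuous up to the boundary and vanishes there. -/
def IsZeroOnBoundary (u : W1inf Ω m) : Prop :=
  ∃ v : Vec d → Vec m, ContinuousOn v (closure Ω) ∧ (∀ x ∈ frontier Ω, v x = 0) ∧
    u.toFun =ᵐ[volume.restrict Ω] v

/-- `u ∈ Aff(Ω; ℝ^m)`: continuous, with gradient constant on each of finitely many disjoint open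
sets with negligible boundaries that cover `Ω` up to a null set. -/
def IsPiecewiseAffine (u : W1inf Ω m) : Prop :=
  (∃ v : Vec d → Vec m, ContinuousOn v Ω ∧ u.toFun =ᵐ[volume.restrict Ω] v) ∧
  ∃ (k : ℕ) (D : Fin k → Set (Vec d)) (ξ : Fin k → Mat m d),
    (∀ i, IsOpen (D i) ∧ D i ⊆ Ω ∧ volume (frontier (D i)) = 0) ∧
    Pairwise (fun i j => Disjoint (D i) (D j)) ∧
    volume (Ω \ ⋃ i, D i) = 0 ∧
    ∀ i, ∀ᵐ x ∂(volume.restrict (D i)), u.grad x = ξ i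

/-- Weak* convergence `v_ε ⇀ u` in `W^{1,∞}(Ω; ℝ^m)` as `ε → 0⁺`: both the functions and their
gradients converge weakly* in `L^∞(Ω)`, i.e. when tested against `L¹(Ω)`. -/
def WeakStarTendsto (v : ℝ → W1inf Ω m) (u : W1inf Ω m) : Prop :=
  ∀ h : Vec d → ℝ, Integrable h (volume.restrict Ω) →
    (∀ i : Fin m, Tendsto (fun ε => ∫ x in Ω, (v ε).toFun x i * h x) (𝓝[>] 0)
      (𝓝 (∫ x in Ω, u.toFun x i * h x))) ∧
    (∀ (i : Fin m) (j : Fin d), Tendsto (fun ε => ∫ x in Ω, (v ε).grad x (i, j) * h x) (𝓝[>] 0)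
      (𝓝 (∫ x in Ω, u.grad x (i, j) * h x)))

end W1inf

variable {m d : ℕ}

/-- `∫_Ω f(x/ε, ∇v(x)) dx`. -/
def energy (f : Vec d → Mat m d → ℝ≥0∞) {Ω : Set (Vec d)} (ε : ℝ) (v : W1inf Ω m) : ℝ≥0∞ :=
  ∫⁻ x in Ω, f (ε⁻¹ • x) (v.grad x)

/-- `G_r(u)`: the infimum of `liminf_{ε → 0} ∫_Ω f(x/ε, ∇v_ε)` over the families `(v_ε)_{ε > 0}`
converging weakly* to `u` in `W^{1,∞}` with `sup_{ε > 0} ‖∇v_ε‖_∞ ≤ r`. -/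
def G (f : Vec d → Mat m d → ℝ≥0∞) {Ω : Set (Vec d)} (r : ℝ≥0∞) (u : W1inf Ω m) : ℝ≥0∞ :=
  ⨅ (v : ℝ → W1inf Ω m) (_ : W1inf.WeakStarTendsto v u) (_ : ∀ ε > 0, (v ε).gradNorm ≤ r),
    liminf (fun ε => energy f ε (v ε)) (𝓝[>] 0)

/-- `H_r(u)`: the same with `limsup`. -/
def H (f : Vec d → Mat m d → ℝ≥0∞) {Ω : Set (Vec d)} (r : ℝ≥0∞) (u : W1inf Ω m) : ℝ≥0∞ :=
  ⨅ (v : ℝ → W1inf Ω m) (_ : W1inf.WeakStarTendsto v u) (_ : ∀ ε > 0, (v ε).gradNorm ≤ r),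
    limsup (fun ε => energy f ε (v ε)) (𝓝[>] 0)

/-- `𝓗_r f(ξ)`, the cell formula with the gradients of the competitors bounded by `r`. -/
def homogBdd (r : ℝ≥0∞) (f : Vec d → Mat m d → ℝ≥0∞) (ξ : Mat m d) : ℝ≥0∞ :=
  ⨅ (n : ℕ) (_ : 1 ≤ n), ((n : ℝ≥0∞) ^ d)⁻¹ *
    ⨅ (φ : W1inf (cube d n) m) (_ : φ.IsZeroOnBoundary) (_ : φ.gradNorm ≤ r),
      ∫⁻ x in cube d n, f x (ξ + φ.grad x)

/-- `𝓗 f(ξ)`, the cell formula. -/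
def homog (f : Vec d → Mat m d → ℝ≥0∞) (ξ : Mat m d) : ℝ≥0∞ :=
  ⨅ (n : ℕ) (_ : 1 ≤ n), ((n : ℝ≥0∞) ^ d)⁻¹ *
    ⨅ (φ : W1inf (cube d n) m) (_ : φ.IsZeroOnBoundary),
      ∫⁻ x in cube d n, f x (ξ + φ.grad x)

/-- Quasiconvexity of `g : 𝕄^{m×d} → [0,+∞[` (finiteness is part of the notion). -/
def IsQuasiconvex (g : Mat m d → ℝ≥0∞) : Prop :=
  (∀ ξ, g ξ ≠ ⊤) ∧ Measurable g ∧
    ∀ ξ, g ξ = ⨅ (φ : W1inf (cube d 1) m) (_ : φ.IsZeroOnBoundary),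
      ∫⁻ x in cube d 1, g (ξ + φ.grad x)

end SemiHom

end

noncomputable section

namespace SemiHom

variable {m d : ℕ}

/-! Linear growth makes `f` bounded along any family with bounded gradients. Hence changing a
function on a set of small volume, while keeping its gradient bounded, changes the energy little. No
continuity or convexity of `f` in the matrix variable is needed.

Two constructions carry the theorem. The first is `volume_mul_homog_le`: a Lipschitz function
vanishing off a box of side `ρ` can be blown up by `ε⁻¹` and shifted by an integer vector into a
cube `]0,n[^d` with `εn ≤ ρ + 2ε`. By periodicity it becomes a competitor in the cell formula, so
its energy around `ξ` at scale `ε` is at least `ρ^d 𝓗f(ξ)`, up to the volume of the added layer. The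
second is `exists_tiling`: a set of finite volume is filled with `ε`-copies of a near-optimal cell
function, and only the cells that meet the complement are lost. Affine boundary data are produced by
`exists_cutoff`: if a function has size at most `s`, cutting it off within distance `s` of the
boundary adds at most 1 to its Lipschitz constant.

Upper bound: tile each region where `∇u` is constant. The perturbations are of size `O(ε)` with
bounded gradients, so they tend weakly* to zero.

Quasiconvexity: given `w` vanishing on the boundary of the unit cube, cover almost all of the cube
by finitely many disjoint balls on which `w` is nearly affine. On each ball replace `w` by its
affine part plus a tiling (`exists_ball_replacement`). The first construction, applied to the
result, bounds `𝓗f(ξ)` by the integral of `𝓗f(ξ + ∇w)`. Measurability comes from upper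
semicontinuity.

Lower bound: by Banach–Steinhaus a weakly* convergent sequence has bounded gradients, so it is
locally equi-Lipschitz and converges locally uniformly. At a point `x` where the limit is
differentiable, the sequence is close to an affine map on small boxes; a cutoff and the first
construction bound `𝓗f(∇u(x))` by the mean energy on the box (`eventually_homog_le_average`). These
means integrate to at most the total energy by Tonelli, and Fatou's lemma, used once for the
sequence and once for the shrinking boxes, concludes. -/

/-! ### Boxes, cubes and the scaling change of variables -/

/-- The open cube with lower corner `a` and side `s`. -/
def box (a : Vec d) (s : ℝ) : Set (Vec d) := {x | ∀ j, a j < x j ∧ x j < a j + s}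

lemma cube_eq_box (n : ℕ) : cube d n = box 0 n := by
  simp [cube, box]

lemma box_eq_preimage (a : Vec d) (s : ℝ) :
    box a s = WithLp.ofLp ⁻¹' (Set.univ.pi fun j => Set.Ioo (a j) (a j + s)) := by
  ext x; simp [box]

lemma isOpen_box (a : Vec d) (s : ℝ) : IsOpen (box a s) := by
  rw [box_eq_preimage]
  exact (isOpen_set_pi Set.finite_univ fun _ _ => isOpen_Ioo).preimage
    (PiLp.continuous_ofLp 2 _)

lemma measurableSet_box (a : Vec d) (s : ℝ) : MeasurableSet (box a s) :=
  (isOpen_box a s).measurableSet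

lemma convex_box (a : Vec d) (s : ℝ) : Convex ℝ (box a s) := by
  intro x hx y hy p q hp hq hpq j
  obtain rfl : q = 1 - p := by linarith
  have h1 := hx j
  have h2 := hy j
  simp only [PiLp.add_apply, PiLp.smul_apply, smul_eq_mul]
  constructor
  · rcases hp.eq_or_lt with rfl | hp
    · simpa using h2.1
    · nlinarith
  · rcases hp.eq_or_lt with rfl | hp
    · simpa using h2.2
    · nlinarith

lemma volume_box (a : Vec d) (s : ℝ) : volume (box a s) = ENNReal.ofReal s ^ d := by
  have := (EuclideanSpace.volume_preserving_symm_measurableEquiv_toLp (Fin d)).measure_preimage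
    (s := Set.univ.pi fun j => Set.Ioo (a j) (a j + s))
    (MeasurableSet.univ_pi fun j => measurableSet_Ioo).nullMeasurableSet
  rw [box_eq_preimage]
  refine this.trans ?_
  rw [volume_pi_pi]
  simp

lemma volume_cube (n : ℕ) : volume (cube d n) = (n : ℝ≥0∞) ^ d := by
  rw [cube_eq_box, volume_box, ENNReal.ofReal_natCast]

lemma isOpen_cube (n : ℕ) : IsOpen (cube d n) := by
  rw [cube_eq_box]; exact isOpen_box _ _

lemma convex_cube (n : ℕ) : Convex ℝ (cube d n) := by
  rw [cube_eq_box]; exact convex_box _ _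

/-- The factor `d` is a crude replacement for `√d`, sufficient everywhere below. The lemma also
serves for values in `ℝ^m`. -/
lemma norm_sub_le_of_mem_box {a x : Vec d} {s : ℝ} (hs : 0 ≤ s) (hx : ∀ j, |x j - a j| ≤ s) :
    ‖x - a‖ ≤ d * s := by
  have h : ‖x - a‖ ≤ √(∑ _j : Fin d, s ^ 2) := by
    rw [EuclideanSpace.norm_eq]
    refine Real.sqrt_le_sqrt (Finset.sum_le_sum fun j _ => ?_)
    have := hx j
    simp only [PiLp.sub_apply, Real.norm_eq_abs]
    gcongr
  refine h.trans ?_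
  rw [Real.sqrt_le_left (by positivity)]
  simp only [Finset.sum_const, Finset.card_univ, Fintype.card_fin, nsmul_eq_mul, mul_pow]
  gcongr
  have : (d : ℝ) ≤ (d : ℝ) ^ 2 := by
    exact_mod_cast Nat.le_self_pow two_ne_zero d
  exact this

lemma box_subset_closedBall (a : Vec d) {s : ℝ} (hs : 0 ≤ s) :
    box a s ⊆ Metric.closedBall a (d * s) := by
  intro x hx
  rw [Metric.mem_closedBall, dist_eq_norm]
  refine norm_sub_le_of_mem_box hs fun j => ?_
  have := hx j
  rw [abs_le]
  constructor <;> linarith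

lemma isBounded_box (a : Vec d) {s : ℝ} (hs : 0 ≤ s) : Bornology.IsBounded (box a s) :=
  Metric.isBounded_closedBall.subset (box_subset_closedBall a hs)

lemma isBounded_cube (n : ℕ) : Bornology.IsBounded (cube d n) := by
  rw [cube_eq_box]; exact isBounded_box _ (by positivity)

lemma abs_coord_sub_le (x y : Vec d) (j : Fin d) : |x j - y j| ≤ dist x y := by
  have := PiLp.norm_apply_le (x - y) j
  rw [dist_eq_norm]
  simpa using this

lemma closedBall_subset_box {a x : Vec d} {s t : ℝ}
    (hx : ∀ j, a j + t < x j ∧ x j < a j + s - t) : Metric.closedBall x t ⊆ box a s := by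
  intro y hy j
  have h := (abs_coord_sub_le y x j).trans hy
  have := hx j
  rw [abs_le] at h
  constructor <;> linarith

/-- Change of variables `y = ε⁻¹ x - b`. -/
lemma setLIntegral_comp_scale {ε : ℝ} (hε : 0 < ε) (b : Vec d) {S : Set (Vec d)}
    (F : Vec d → ℝ≥0∞) :
    ∫⁻ x in {x | ε⁻¹ • x - b ∈ S}, F (ε⁻¹ • x - b) =
      ENNReal.ofReal ε ^ d * ∫⁻ y in S, F y := by
  -- Because `e` is a measurable equivalence, neither `F` nor `S` has to be measurable.
  let e : Vec d ≃ᵐ Vec d := ((Homeomorph.smulOfNeZero ε⁻¹ (inv_ne_zero hε.ne')).trans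
    (Homeomorph.subRight b)).toMeasurableEquiv
  have he : ∀ x, e x = ε⁻¹ • x - b := fun x => rfl
  have hmap : Measure.map e volume = ENNReal.ofReal ε ^ d • (volume : Measure (Vec d)) := by
    have h1 : (e : Vec d → Vec d) = (fun x => x - b) ∘ (fun x => ε⁻¹ • x) := rfl
    rw [h1, ← Measure.map_map (by fun_prop) (by fun_prop),
      Measure.map_addHaar_smul _ (inv_ne_zero hε.ne'), Measure.map_smul,
      (measurePreserving_sub_right volume b).map_eq]
    congr 1
    rw [finrank_euclideanSpace, Fintype.card_fin, inv_pow, inv_inv, abs_of_pos (by positivity),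
      ENNReal.ofReal_pow hε.le]
  have h2 : ∫⁻ x in e ⁻¹' S, F (e x) = ∫⁻ y in S, F y ∂(Measure.map e volume) := by
    rw [e.restrict_map, lintegral_map_equiv]
  calc _ = ∫⁻ x in e ⁻¹' S, F (e x) := rfl
    _ = _ := by rw [h2, hmap, Measure.restrict_smul, lintegral_smul_measure, smul_eq_mul]

lemma volume_scale {ε : ℝ} (hε : 0 < ε) (b : Vec d) (S : Set (Vec d)) :
    volume {x | ε⁻¹ • x - b ∈ S} = ENNReal.ofReal ε ^ d * volume S := by
  simpa using setLIntegral_comp_scale hε b (S := S) (fun _ => 1)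

/-! ### Gradients as matrices, affine maps -/

/-- Linear maps `ℝ^d → ℝ^m` as matrices. -/
def matEquiv : (Vec d →L[ℝ] Vec m) ≃L[ℝ] Mat m d :=
  LinearEquiv.toContinuousLinearEquiv
    { toFun := fun A => WithLp.toLp 2 fun p => A (EuclideanSpace.single p.2 1) p.1
      map_add' := fun A B => by ext p; simp
      map_smul' := fun c A => by ext p; simp
      invFun := fun ξ => LinearMap.toContinuousLinearMap
        { toFun := fun x => WithLp.toLp 2 fun i => ∑ j, ξ (i, j) * x j
          map_add' := fun x y => by ext i; simp [mul_add, Finset.sum_add_distrib]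
          map_smul' := fun c x => by
            ext i; simp [Finset.mul_sum, mul_left_comm] }
      left_inv := fun A => by
        ext x i
        have hx : x = ∑ j, x j • EuclideanSpace.single j (1 : ℝ) := by
          ext k; simp [Pi.single_apply]
        conv_rhs => rw [hx]
        simp [map_sum, mul_comm]
      right_inv := fun ξ => by
        ext p
        simp }

/-- The matrix of the derivative of `w` at `x`. -/
def grad (w : Vec d → Vec m) (x : Vec d) : Mat m d := matEquiv (fderiv ℝ w x)

lemma grad_apply (w : Vec d → Vec m) (x : Vec d) (i : Fin m) (j : Fin d) :
    grad w x (i, j) = fderiv ℝ w x (EuclideanSpace.single j 1) i := rfl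

lemma grad_eq_of_hasFDerivAt {w : Vec d → Vec m} {A : Vec d →L[ℝ] Vec m} {x : Vec d}
    (h : HasFDerivAt w A x) : grad w x = matEquiv A := by rw [grad, h.fderiv]

lemma grad_congr {w w' : Vec d → Vec m} {x : Vec d} (h : w =ᶠ[𝓝 x] w') : grad w x = grad w' x := by
  rw [grad, grad, h.fderiv_eq]

lemma grad_congr_of_eqOn {w w' : Vec d → Vec m} {U : Set (Vec d)} (hU : IsOpen U)
    (h : Set.EqOn w w' U) {x : Vec d} (hx : x ∈ U) : grad w x = grad w' x :=
  grad_congr (h.eventuallyEq_of_mem (hU.mem_nhds hx))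

lemma grad_add {w w' : Vec d → Vec m} {x : Vec d} (h : DifferentiableAt ℝ w x)
    (h' : DifferentiableAt ℝ w' x) : grad (fun y => w y + w' y) x = grad w x + grad w' x := by
  rw [grad_eq_of_hasFDerivAt (h.hasFDerivAt.fun_add h'.hasFDerivAt), map_add, grad, grad]

lemma grad_const (c : Vec m) (x : Vec d) : grad (fun _ => c) x = 0 := by
  rw [grad_eq_of_hasFDerivAt (hasFDerivAt_const c x), map_zero]

lemma grad_eq_zero_of_eqOn {w : Vec d → Vec m} {U : Set (Vec d)} (hU : IsOpen U)
    (h : ∀ y ∈ U, w y = 0) {x : Vec d} (hx : x ∈ U) : grad w x = 0 := by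
  rw [grad_congr_of_eqOn hU (w' := fun _ => 0) h hx, grad_const]

lemma measurable_grad (w : Vec d → Vec m) : Measurable (grad w) :=
  matEquiv.continuous.measurable.comp (measurable_fderiv ℝ w)

/-- A bound for the Frobenius norm in terms of the operator norm. -/
def frobConst (m d : ℕ) : ℝ := ‖((matEquiv : (Vec d →L[ℝ] Vec m) ≃L[ℝ] Mat m d) :
  (Vec d →L[ℝ] Vec m) →L[ℝ] Mat m d)‖

lemma frobConst_nonneg : 0 ≤ frobConst m d := by unfold frobConst; positivity

lemma norm_matEquiv_le (A : Vec d →L[ℝ] Vec m) : ‖matEquiv A‖ ≤ frobConst m d * ‖A‖ :=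
  ContinuousLinearMap.le_opNorm ((matEquiv : (Vec d →L[ℝ] Vec m) ≃L[ℝ] Mat m d) :
    (Vec d →L[ℝ] Vec m) →L[ℝ] Mat m d) A

lemma norm_grad_le {w : Vec d → Vec m} {K : ℝ≥0} (hw : LipschitzWith K w) (x : Vec d) :
    ‖grad w x‖ ≤ frobConst m d * K :=
  (norm_matEquiv_le _).trans
    (mul_le_mul_of_nonneg_left (norm_fderiv_le_of_lipschitz ℝ hw) frobConst_nonneg)

/-- The affine map with gradient `ξ` taking the value `c` at `a`. -/
def aff (ξ : Mat m d) (a : Vec d) (c : Vec m) (x : Vec d) : Vec m := c + matEquiv.symm ξ (x - a)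

lemma hasFDerivAt_aff (ξ : Mat m d) (a : Vec d) (c : Vec m) (x : Vec d) :
    HasFDerivAt (aff ξ a c) (matEquiv.symm ξ) x := by
  exact (((matEquiv.symm ξ).hasFDerivAt (x := x - a)).comp x
    ((hasFDerivAt_id x).sub_const a)).const_add c

lemma grad_aff (ξ : Mat m d) (a : Vec d) (c : Vec m) (x : Vec d) : grad (aff ξ a c) x = ξ := by
  rw [grad_eq_of_hasFDerivAt (hasFDerivAt_aff ξ a c x)]; simp

lemma lipschitzWith_aff (ξ : Mat m d) (a : Vec d) (c : Vec m) :
    LipschitzWith ‖matEquiv.symm ξ‖₊ (aff ξ a c) := by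
  refine LipschitzWith.of_dist_le_mul fun x y => ?_
  rw [dist_eq_norm, dist_eq_norm]
  have : aff ξ a c x - aff ξ a c y = matEquiv.symm ξ (x - y) := by
    simp only [aff, map_sub]; abel
  rw [this]
  exact ContinuousLinearMap.le_opNorm _ _


/-! ### Lipschitz functions as elements of W^{1,∞}; calculus of weak gradients -/

lemma memLp_coord {ι : Type*} [Fintype ι] {α : Type*} [MeasurableSpace α] {μ : Measure α}
    {p : ℝ≥0∞} {u : α → EuclideanSpace ℝ ι} (hu : MemLp u p μ) (i : ι) :
    MemLp (fun x => u x i) p μ :=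
  (EuclideanSpace.proj i : EuclideanSpace ℝ ι →L[ℝ] ℝ).comp_memLp' hu

lemma lipschitzWith_coord {ι α : Type*} [Fintype ι] [PseudoMetricSpace α] {K : ℝ≥0}
    {w : α → EuclideanSpace ℝ ι} (hw : LipschitzWith K w) (i : ι) :
    LipschitzWith K (fun x => w x i) := by
  refine LipschitzWith.of_dist_le_mul fun x y => le_trans ?_ (hw.dist_le_mul x y)
  rw [Real.dist_eq, dist_eq_norm]
  exact PiLp.norm_apply_le (w x - w y) i

/-- Rademacher's theorem: the two sides agree wherever `w` is differentiable. Line derivatives are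
the form in which integration by parts is applied. -/
lemma lineDeriv_coord_ae_eq_grad {w : Vec d → Vec m} {K : ℝ≥0} (hw : LipschitzWith K w)
    (i : Fin m) (j : Fin d) :
    (fun x => lineDeriv ℝ (fun y => w y i) x (EuclideanSpace.single j 1)) =ᵐ[volume]
      fun x => grad w x (i, j) := by
  filter_upwards [hw.ae_differentiableAt (μ := volume)] with x hx
  have h : HasFDerivAt (fun y => w y i)
      ((EuclideanSpace.proj i : Vec m →L[ℝ] ℝ).comp (fderiv ℝ w x)) x :=
    (EuclideanSpace.proj i : Vec m →L[ℝ] ℝ).hasFDerivAt.comp x hx.hasFDerivAt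
  rw [(h.hasLineDerivAt _).lineDeriv, grad_apply]
  rfl

/-- Integration by parts for a Lipschitz function against a test function. -/
lemma integral_grad_mul {w : Vec d → Vec m} {K : ℝ≥0} (hw : LipschitzWith K w) {φ : Vec d → ℝ}
    (hφ : ContDiff ℝ ∞ φ) (hc : HasCompactSupport φ) (i : Fin m) (j : Fin d) :
    ∫ x, grad w x (i, j) * φ x = -∫ x, w x i * fderiv ℝ φ x (EuclideanSpace.single j 1) := by
  obtain ⟨D, hD⟩ : ∃ D, LipschitzWith D φ :=
    ContDiff.lipschitzWith_of_hasCompactSupport hc hφ (by simp)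
  have h := (lipschitzWith_coord hw i).integral_lineDeriv_mul_eq (μ := volume) hD hc
    (EuclideanSpace.single j 1)
  rw [integral_congr_ae (g := fun x => grad w x (i, j) * φ x)] at h
  · rw [h, ← integral_neg]
    congr 1 with x
    rw [((hφ.differentiable (by simp)).differentiableAt).lineDeriv_eq_fderiv, map_neg]
    ring
  · filter_upwards [lineDeriv_coord_ae_eq_grad hw i j] with x hx
    rw [hx]

/-- The test function and its derivative vanish off a subset of `Ω`, so both integrals may be taken
over the whole space. -/
lemma hasWeakGradient_of_lipschitz {w : Vec d → Vec m} {K : ℝ≥0} (hw : LipschitzWith K w)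
    (Ω : Set (Vec d)) : HasWeakGradient Ω w (grad w) := by
  intro φ hφ hc hs i j
  rw [setIntegral_eq_integral_of_forall_compl_eq_zero,
    setIntegral_eq_integral_of_forall_compl_eq_zero, integral_grad_mul hw hφ hc, neg_neg]
  · intro x hx
    rw [image_eq_zero_of_notMem_tsupport fun h => hx (hs h), mul_zero]
  · intro x hx
    rw [fderiv_of_notMem_tsupport ℝ fun h => hx (hs h)]
    simp

lemma memLp_top_of_lipschitz {w : Vec d → Vec m} {K : ℝ≥0} (hw : LipschitzWith K w)
    {Ω : Set (Vec d)} (hΩ : MeasurableSet Ω) (hb : Bornology.IsBounded Ω) :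
    MemLp w ⊤ (volume.restrict Ω) := by
  obtain ⟨R, hR⟩ := (hw.isBounded_image hb).exists_norm_le
  refine memLp_top_of_bound hw.continuous.aestronglyMeasurable R ?_
  filter_upwards [ae_restrict_mem hΩ] with x hx using hR _ (Set.mem_image_of_mem w hx)

lemma memLp_top_grad {w : Vec d → Vec m} {K : ℝ≥0} (hw : LipschitzWith K w)
    (μ : Measure (Vec d)) : MemLp (grad w) ⊤ μ :=
  memLp_top_of_bound (measurable_grad w).aestronglyMeasurable _
    (Eventually.of_forall fun x => norm_grad_le hw x)

/-- A Lipschitz function as an element of `W^{1,∞}`. -/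
def W1inf.ofLipschitz {w : Vec d → Vec m} {K : ℝ≥0} (hw : LipschitzWith K w)
    {Ω : Set (Vec d)} (hΩ : MeasurableSet Ω) (hb : Bornology.IsBounded Ω) : W1inf Ω m where
  toFun := w
  grad := SemiHom.grad w
  memLp_toFun := memLp_top_of_lipschitz hw hΩ hb
  memLp_grad := memLp_top_grad hw _
  hasWeakGradient := hasWeakGradient_of_lipschitz hw Ω

lemma HasWeakGradient.congr_left {Ω : Set (Vec d)} {u v : Vec d → Vec m} {g : Vec d → Mat m d}
    (h : HasWeakGradient Ω u g) (huv : u =ᵐ[volume.restrict Ω] v) : HasWeakGradient Ω v g := by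
  intro φ hφ hc hs i j
  rw [← h φ hφ hc hs i j]
  refine integral_congr_ae ?_
  filter_upwards [huv] with x hx
  rw [hx]

lemma _root_.MeasureTheory.Integrable.memLp_top_mul {α : Type*} [MeasurableSpace α]
    {μ : Measure α} {h g : α → ℝ} (hh : Integrable h μ) (hg : MemLp g ⊤ μ) :
    Integrable (fun x => g x * h x) μ :=
  hh.mul_of_top_right hg

/-- Sum of weak gradients. -/
lemma HasWeakGradient.add {Ω : Set (Vec d)} {u v : Vec d → Vec m} {g k : Vec d → Mat m d}
    (h : HasWeakGradient Ω u g) (h' : HasWeakGradient Ω v k)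
    (hu : MemLp u ⊤ (volume.restrict Ω)) (hv : MemLp v ⊤ (volume.restrict Ω))
    (hg : MemLp g ⊤ (volume.restrict Ω)) (hk : MemLp k ⊤ (volume.restrict Ω)) :
    HasWeakGradient Ω (u + v) (g + k) := by
  intro φ hφ hc hs i j
  have h1 : Integrable φ (volume.restrict Ω) :=
    (hφ.continuous.integrable_of_hasCompactSupport hc).restrict
  have h2 : Integrable (fun x => fderiv ℝ φ x (EuclideanSpace.single j 1)) (volume.restrict Ω) := by
    refine (Continuous.integrable_of_hasCompactSupport ?_ ?_).restrict
    · exact (hφ.continuous_fderiv (by simp)).clm_apply continuous_const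
    · exact (hc.fderiv ℝ).comp_left
        (g := fun A : Vec d →L[ℝ] ℝ => A (EuclideanSpace.single j 1)) rfl
  simp only [Pi.add_apply, PiLp.add_apply, add_mul]
  rw [integral_add (h2.memLp_top_mul (memLp_coord hu i))
      (h2.memLp_top_mul (memLp_coord hv i)),
    integral_add (h1.memLp_top_mul (memLp_coord hg _)) (h1.memLp_top_mul (memLp_coord hk _)),
    h φ hφ hc hs, h' φ hφ hc hs]
  ring

lemma HasWeakGradient.mono {Ω D : Set (Vec d)} {u : Vec d → Vec m} {g : Vec d → Mat m d}
    (h : HasWeakGradient Ω u g) (hD : D ⊆ Ω) : HasWeakGradient D u g := by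
  intro φ hφ hc hs i j
  have := h φ hφ hc (hs.trans hD) i j
  rw [setIntegral_eq_integral_of_forall_compl_eq_zero,
    setIntegral_eq_integral_of_forall_compl_eq_zero] at this
  rw [setIntegral_eq_integral_of_forall_compl_eq_zero,
    setIntegral_eq_integral_of_forall_compl_eq_zero]
  · exact this
  · intro x hx
    rw [image_eq_zero_of_notMem_tsupport fun h => hx (hs h), mul_zero]
  · intro x hx
    rw [fderiv_of_notMem_tsupport ℝ fun h => hx (hs h)]
    simp
  · intro x hx
    rw [image_eq_zero_of_notMem_tsupport fun h => hx (hD (hs h)), mul_zero]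
  · intro x hx
    rw [fderiv_of_notMem_tsupport ℝ fun h => hx (hD (hs h))]
    simp

/-- Restriction to a smaller set. -/
def W1inf.restrict {Ω D : Set (Vec d)} (u : W1inf Ω m) (hD : D ⊆ Ω) : W1inf D m where
  toFun := u.toFun
  grad := u.grad
  memLp_toFun := u.memLp_toFun.mono_measure (Measure.restrict_mono hD le_rfl)
  memLp_grad := u.memLp_grad.mono_measure (Measure.restrict_mono hD le_rfl)
  hasWeakGradient := u.hasWeakGradient.mono hD

/-- Uniqueness of the weak gradient. -/
lemma HasWeakGradient.ae_eq {D : Set (Vec d)} (hD : IsOpen D) {u : Vec d → Vec m}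
    {g k : Vec d → Mat m d} (h : HasWeakGradient D u g) (h' : HasWeakGradient D u k)
    (hg : MemLp g ⊤ (volume.restrict D)) (hk : MemLp k ⊤ (volume.restrict D)) :
    g =ᵐ[volume.restrict D] k := by
  have key : ∀ p : Fin m × Fin d, ∀ᵐ x ∂(volume.restrict D), g x p - k x p = 0 := by
    rintro ⟨i, j⟩
    rw [ae_restrict_iff' hD.measurableSet]
    refine hD.ae_eq_zero_of_integral_contDiff_smul_eq_zero ?_ fun φ hφ hc hs => ?_
    · refine locallyIntegrableOn_of_locallyIntegrable_restrict ?_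
      exact ((memLp_coord hg (i, j)).sub (memLp_coord hk (i, j))).locallyIntegrable le_top
    · have h1 : Integrable φ (volume.restrict D) :=
        (hφ.continuous.integrable_of_hasCompactSupport hc).restrict
      rw [← setIntegral_eq_integral_of_forall_compl_eq_zero (s := D)]
      · have e : ∀ x, φ x • (g x (i, j) - k x (i, j)) = g x (i, j) * φ x - k x (i, j) * φ x := by
          intro x; rw [smul_eq_mul]; ring
        simp only [e]
        rw [integral_sub (h1.memLp_top_mul (memLp_coord hg _))
          (h1.memLp_top_mul (memLp_coord hk _))]
        have e1 := h φ hφ hc hs i j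
        have e2 := h' φ hφ hc hs i j
        linarith
      · intro x hx
        rw [image_eq_zero_of_notMem_tsupport fun h => hx (hs h), zero_smul]
  filter_upwards [ae_all_iff.2 key] with x hx
  ext p
  linarith [hx p]

/-! ### Lipschitz representatives by mollification -/

lemma norm_le_of_forall_single (A : Vec d →L[ℝ] ℝ) {C : ℝ} (hC : 0 ≤ C)
    (h : ∀ j, |A (EuclideanSpace.single j 1)| ≤ C) : ‖A‖ ≤ d * C := by
  refine A.opNorm_le_bound (by positivity) fun x => ?_
  have hx : x = ∑ j, x j • EuclideanSpace.single j (1 : ℝ) := by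
    ext k; simp [Pi.single_apply]
  calc ‖A x‖ = ‖∑ j, x j * A (EuclideanSpace.single j 1)‖ := by
        conv_lhs => rw [hx]
        simp [map_sum]
    _ ≤ ∑ j, ‖x j * A (EuclideanSpace.single j 1)‖ := norm_sum_le _ _
    _ ≤ ∑ _j : Fin d, ‖x‖ * C := by
        refine Finset.sum_le_sum fun j _ => ?_
        rw [norm_mul]
        exact mul_le_mul (PiLp.norm_apply_le x j) (h j) (norm_nonneg _) (norm_nonneg _)
    _ = d * C * ‖x‖ := by simp; ring

/-- The mollification of a function with bounded weak gradient has the expected derivative. -/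
lemma abs_mollify_deriv_le {D : Set (Vec d)} (hD : IsOpen D) {v g : Vec d → ℝ} {C : ℝ}
    (hv : LocallyIntegrable (D.indicator v) volume)
    (hgC : ∀ᵐ x ∂(volume.restrict D), |g x| ≤ C) (e : Vec d)
    (hw : ∀ φ : Vec d → ℝ, ContDiff ℝ ∞ φ → HasCompactSupport φ → tsupport φ ⊆ D →
      ∫ x in D, v x * fderiv ℝ φ x e = -∫ x in D, g x * φ x)
    (η : ContDiffBump (0 : Vec d)) {z : Vec d} (hz : Metric.closedBall z η.rOut ⊆ D) :
    |convolution (fderiv ℝ (η.normed volume)) (D.indicator v)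
      ((ContinuousLinearMap.lsmul ℝ ℝ).precompL (Vec d)) volume z e| ≤ C := by
  set ρ := η.normed (volume : Measure (Vec d)) with hρ
  have hρs : ContDiff ℝ ∞ ρ := η.contDiff_normed
  have hρc : HasCompactSupport ρ := η.hasCompactSupport_normed
  -- The reflected mollifier centred at `z` is a legitimate test function in `D`. Testing with it
  -- shows the derivative of the mollification at `z` to be an average of `g` with weight `τ`.
  set τ : Vec d → ℝ := fun t => ρ (z - t) with hτ
  have hτs : ContDiff ℝ ∞ τ := hρs.comp (contDiff_const.sub contDiff_id)
  have hτt : tsupport τ ⊆ Metric.closedBall z η.rOut := by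
    refine closure_minimal (fun t ht => ?_) Metric.isClosed_closedBall
    have : z - t ∈ Function.support ρ := ht
    rw [hρ, η.support_normed_eq, mem_ball_zero_iff] at this
    rw [Metric.mem_closedBall, dist_comm, dist_eq_norm]
    exact this.le
  have hτc : HasCompactSupport τ :=
    (isCompact_closedBall z η.rOut).of_isClosed_subset (isClosed_tsupport _) hτt
  have hτd : ∀ t, fderiv ℝ τ t e = -fderiv ℝ ρ (z - t) e := by
    intro t
    have h1 : HasFDerivAt τ ((fderiv ℝ ρ (z - t)).comp (-(ContinuousLinearMap.id ℝ (Vec d)))) t :=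
      ((hρs.differentiable (by simp)) (z - t)).hasFDerivAt.comp t ((hasFDerivAt_id t).const_sub z)
    rw [h1.fderiv]; simp
  have hex := (hρc.fderiv ℝ).convolutionExists_left
    ((ContinuousLinearMap.lsmul ℝ ℝ).precompL (Vec d)) (hρs.continuous_fderiv (by simp)) hv z
  have h1 : convolution (fderiv ℝ ρ) (D.indicator v)
      ((ContinuousLinearMap.lsmul ℝ ℝ).precompL (Vec d)) volume z e
      = ∫ t in D, g t * τ t := by
    rw [convolution_def, ContinuousLinearMap.integral_apply hex]
    rw [← integral_sub_left_eq_self (μ := volume) _ z, ← neg_neg (∫ t in D, g t * τ t),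
      ← hw τ hτs hτc (hτt.trans hz), ← integral_indicator hD.measurableSet, ← integral_neg]
    congr 1 with t
    simp only [sub_sub_cancel, ContinuousLinearMap.precompL_apply,
      ContinuousLinearMap.lsmul_apply, smul_eq_mul]
    by_cases ht : t ∈ D
    · simp only [Set.indicator_of_mem ht, hτd]; ring
    · simp [Set.indicator_of_notMem ht]
  have hτ1 : ∫ t, τ t = 1 := by
    rw [hτ, integral_sub_left_eq_self (μ := volume) ρ z, hρ, η.integral_normed]
  have hτn : ∀ t, 0 ≤ τ t := fun t => η.nonneg_normed _
  rw [h1]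
  have hτi : Integrable τ := hτs.continuous.integrable_of_hasCompactSupport hτc
  calc |∫ t in D, g t * τ t| ≤ ∫ t in D, C * τ t := by
        rw [← Real.norm_eq_abs]
        refine norm_integral_le_of_norm_le (hτi.restrict.const_mul C) ?_
        filter_upwards [hgC] with t ht
        rw [norm_mul, Real.norm_eq_abs, Real.norm_eq_abs, abs_of_nonneg (hτn t)]
        exact mul_le_mul_of_nonneg_right ht (hτn t)
    _ = C := by
        rw [setIntegral_eq_integral_of_forall_compl_eq_zero, integral_const_mul, hτ1, mul_one]
        intro t ht
        rw [image_eq_zero_of_notMem_tsupport fun h => ht (hz (hτt h)), mul_zero]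

/-- A function with bounded weak gradient on a convex open set is Lipschitz on a set of full
measure. -/
lemma exists_lipschitz_set {D : Set (Vec d)} (hD : IsOpen D) (hDc : Convex ℝ D)
    {v : Vec d → ℝ} {g : Fin d → Vec d → ℝ} {C : ℝ} (hC : 0 ≤ C)
    (hv : MemLp v ⊤ (volume.restrict D)) (hgC : ∀ j, ∀ᵐ x ∂(volume.restrict D), |g j x| ≤ C)
    (hw : ∀ φ : Vec d → ℝ, ContDiff ℝ ∞ φ → HasCompactSupport φ → tsupport φ ⊆ D → ∀ j,
      ∫ x in D, v x * fderiv ℝ φ x (EuclideanSpace.single j 1) = -∫ x in D, g j x * φ x) :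
    ∃ S : Set (Vec d), (∀ᵐ x ∂(volume.restrict D), x ∈ S) ∧ S ⊆ D ∧
      ∀ x ∈ S, ∀ y ∈ S, |v x - v y| ≤ d * C * ‖x - y‖ := by
  have hV : LocallyIntegrable (D.indicator v) volume :=
    ((memLp_indicator_iff_restrict hD.measurableSet).2 hv).locallyIntegrable le_top
  -- The outer radius is always twice the inner one; a bounded ratio is what a.e. convergence of the
  -- mollifications requires.
  let η : ℕ → ContDiffBump (0 : Vec d) := fun k =>
    ⟨1 / ((k : ℝ) + 1), 2 * (1 / ((k : ℝ) + 1)), by positivity, by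
      have : (0 : ℝ) < 1 / ((k : ℝ) + 1) := by positivity
      linarith⟩
  have hη : Tendsto (fun k => (η k).rOut) atTop (𝓝 0) := by
    have := (tendsto_one_div_add_atTop_nhds_zero_nat (𝕜 := ℝ)).const_mul 2
    rwa [mul_zero] at this
  set W : ℕ → Vec d → ℝ := fun k => convolution ((η k).normed volume) (D.indicator v)
    (ContinuousLinearMap.lsmul ℝ ℝ) volume with hWdef
  have hlim := ContDiffBump.ae_convolution_tendsto_right_of_locallyIntegrable (φ := η)
    (l := atTop) (K := 2) hη (Eventually.of_forall fun k => le_rfl) hV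
  refine ⟨{x | Tendsto (fun k => W k x) atTop (𝓝 (D.indicator v x))} ∩ D, ?_,
    Set.inter_subset_right, ?_⟩
  · filter_upwards [ae_restrict_of_ae hlim, ae_restrict_mem hD.measurableSet] with x hx hxD
      using ⟨hx, hxD⟩
  rintro x ⟨hx, hxD⟩ y ⟨hy, hyD⟩
  rw [Set.mem_ofPred_eq, Set.indicator_of_mem hxD] at hx
  rw [Set.mem_ofPred_eq, Set.indicator_of_mem hyD] at hy
  -- Convexity places the segment in `D`, and compactness a closed neighbourhood of it.
  -- Mollifications of small radius therefore satisfy the derivative bound along the whole segment,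
  -- and the resulting mean value inequality passes to the limit.
  have hseg : segment ℝ x y ⊆ D := hDc.segment_subset hxD hyD
  have hcomp : IsCompact (segment ℝ x y) := by
    rw [segment_eq_image_lineMap]
    exact isCompact_Icc.image AffineMap.lineMap_continuous
  obtain ⟨δ, hδ, hδD⟩ := hcomp.exists_cthickening_subset_open hD hseg
  refine le_of_tendsto (hx.sub hy).abs ?_
  filter_upwards [hη.eventually (gt_mem_nhds hδ)] with k hk
  have hder : ∀ z ∈ segment ℝ x y, ∃ A : Vec d →L[ℝ] ℝ, HasFDerivAt (W k) A z ∧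
      ‖A‖ ≤ d * C := by
    intro z hz
    refine ⟨_, (η k).hasCompactSupport_normed.hasFDerivAt_convolution_left
      (ContinuousLinearMap.lsmul ℝ ℝ) (η k).contDiff_normed hV z, ?_⟩
    refine norm_le_of_forall_single _ hC fun j => ?_
    refine abs_mollify_deriv_le hD hV (hgC j) _ (fun φ h1 h2 h3 => hw φ h1 h2 h3 j) (η k) ?_
    refine (Metric.closedBall_subset_closedBall hk.le).trans
      ((Metric.closedBall_subset_cthickening hz δ).trans hδD)
  choose! A hA hA' using hder
  have := (convex_segment (𝕜 := ℝ) x y).norm_image_sub_le_of_norm_hasFDerivWithin_le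
    (fun z hz => (hA z hz).hasFDerivWithinAt) hA' (right_mem_segment ℝ x y)
    (left_mem_segment ℝ x y)
  exact this

/-- On a convex open set, elements of `W^{1,∞}` have Lipschitz representatives, with a Lipschitz
constant depending only on a bound for the gradient. -/
theorem exists_lipschitz_representative (m d : ℕ) (C : ℝ≥0) : ∃ K : ℝ≥0, ∀ D : Set (Vec d),
    IsOpen D → Convex ℝ D → ∀ u : W1inf D m,
    (∀ᵐ x ∂(volume.restrict D), ‖u.grad x‖ ≤ C) →
    ∃ w : Vec d → Vec m, LipschitzWith K w ∧ u.toFun =ᵐ[volume.restrict D] w ∧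
      u.grad =ᵐ[volume.restrict D] grad w := by
  -- Each coordinate has constant `d * C`, assembling `m` coordinates costs a factor `m`, and
  -- extension to the whole space costs the remaining factor. Nothing depends on `D`, so the same
  -- constant serves all balls.
  refine ⟨lipschitzExtensionConstant (Vec m) * (m * (d * C)), fun D hD hDc u hu => ?_⟩
  have key : ∀ i : Fin m, ∃ S : Set (Vec d), (∀ᵐ x ∂(volume.restrict D), x ∈ S) ∧ S ⊆ D ∧
      ∀ x ∈ S, ∀ y ∈ S, |u.toFun x i - u.toFun y i| ≤ d * C * ‖x - y‖ := by
    intro i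
    refine exists_lipschitz_set hD hDc (v := fun x => u.toFun x i)
      (g := fun j x => u.grad x (i, j)) C.2 (memLp_coord u.memLp_toFun i) ?_ ?_
    · intro j
      filter_upwards [hu] with x hx
      exact (PiLp.norm_apply_le (u.grad x) (i, j)).trans hx
    · intro φ h1 h2 h3 j
      exact u.hasWeakGradient φ h1 h2 h3 i j
  choose S hS hSD hSl using key
  have hlip : LipschitzOnWith (m * (d * C)) u.toFun (D ∩ ⋂ i, S i) := by
    refine LipschitzOnWith.of_dist_le_mul fun x hx y hy => ?_
    rw [dist_eq_norm, dist_eq_norm]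
    have h1 : ∀ i, |u.toFun x i - u.toFun y i| ≤ d * C * ‖x - y‖ := fun i =>
      hSl i x (Set.mem_iInter.1 hx.2 i) y (Set.mem_iInter.1 hy.2 i)
    have := norm_sub_le_of_mem_box (a := u.toFun y) (x := u.toFun x) (by positivity) h1
    refine this.trans (le_of_eq ?_)
    push_cast; ring
  obtain ⟨w, hw, hwe⟩ := hlip.extend_finite_dimension
  have hae : u.toFun =ᵐ[volume.restrict D] w := by
    filter_upwards [ae_all_iff.2 hS, ae_restrict_mem hD.measurableSet] with x hx hxD
    exact hwe ⟨hxD, Set.mem_iInter.2 hx⟩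
  refine ⟨w, hw, hae, ?_⟩
  exact (u.hasWeakGradient.congr_left hae).ae_eq hD (hasWeakGradient_of_lipschitz hw D)
    u.memLp_grad (memLp_top_grad hw _)

/-! ### Zero boundary values and extension by zero -/

/-- A segment from a point of `D` to a point outside meets the frontier, since otherwise `D` and the
complement of its closure would disconnect it. As `w` vanishes at the crossing point, only the part
of the segment before it counts. -/
lemma lipschitzWith_indicator {w : Vec d → Vec m} {K : ℝ≥0} (hw : LipschitzWith K w)
    {D : Set (Vec d)} (hD : IsOpen D) (h0 : ∀ x ∈ frontier D, w x = 0) :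
    LipschitzWith K (D.indicator w) := by
  have key : ∀ x ∈ D, ∀ y ∉ D, dist (w x) 0 ≤ K * dist x y := by
    intro x hx y hy
    obtain ⟨z, hz, hzf⟩ : ∃ z ∈ segment ℝ x y, z ∈ frontier D := by
      by_contra! hcon
      have hpre := (convex_segment (𝕜 := ℝ) x y).isPreconnected D (closure D)ᶜ hD
        isClosed_closure.isOpen_compl
        (fun z hz => by
          by_cases hzD : z ∈ D
          · exact Or.inl hzD
          · refine Or.inr fun hzc => hcon z hz ?_
            rw [hD.frontier_eq]
            exact ⟨hzc, hzD⟩)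
        ⟨x, left_mem_segment ℝ x y, hx⟩
        ⟨y, right_mem_segment ℝ x y, fun hyc => hcon y (right_mem_segment ℝ x y) (by
          rw [hD.frontier_eq]
          exact ⟨hyc, hy⟩)⟩
      obtain ⟨z, -, hz1, hz2⟩ := hpre
      exact hz2 (subset_closure hz1)
    rw [← h0 z hzf]
    refine (hw.dist_le_mul x z).trans ?_
    gcongr
    have := dist_add_dist_of_mem_segment hz
    have h2 : 0 ≤ dist z y := dist_nonneg
    linarith
  refine LipschitzWith.of_dist_le_mul fun x y => ?_
  by_cases hx : x ∈ D <;> by_cases hy : y ∈ D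
  · simpa [hx, hy] using hw.dist_le_mul x y
  · simpa [hx, hy] using key x hx y hy
  · rw [dist_comm, dist_comm x y]
    simpa [hx, hy] using key y hy x hx
  · simp only [Set.indicator_of_notMem hx, Set.indicator_of_notMem hy, dist_self]
    positivity

lemma W1inf.ae_norm_grad_le {Ω : Set (Vec d)} (u : W1inf Ω m) :
    ∀ᵐ x ∂(volume.restrict Ω), ‖u.grad x‖ₑ ≤ u.gradNorm := by
  rw [gradNorm, eLpNorm_exponent_top]
  exact ae_le_eLpNormEssSup

lemma W1inf.exists_ae_norm_grad_le {Ω : Set (Vec d)} (u : W1inf Ω m) :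
    ∃ C : ℝ≥0, ∀ᵐ x ∂(volume.restrict Ω), ‖u.grad x‖ ≤ C := by
  refine ⟨u.gradNorm.toNNReal, ?_⟩
  filter_upwards [u.ae_norm_grad_le] with x hx
  have : u.gradNorm ≠ ⊤ := u.memLp_grad.2.ne
  rw [← ENNReal.coe_toNNReal this] at hx
  exact_mod_cast hx

/-- Elements of `W^{1,∞}_0(D)`, `D` convex, extended by zero are Lipschitz on `ℝ^d`. -/
theorem W1inf.IsZeroOnBoundary.exists_extension {D : Set (Vec d)} (hD : IsOpen D)
    (hDc : Convex ℝ D) {u : W1inf D m} (hu : u.IsZeroOnBoundary) :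
    ∃ (K : ℝ≥0) (w : Vec d → Vec m), LipschitzWith K w ∧ (∀ x ∉ D, w x = 0) ∧
      u.grad =ᵐ[volume.restrict D] SemiHom.grad w := by
  obtain ⟨C, hC⟩ := u.exists_ae_norm_grad_le
  obtain ⟨K, hK⟩ := exists_lipschitz_representative m d C
  obtain ⟨w, hw, huw, hgw⟩ := hK D hD hDc u hC
  obtain ⟨v, hv, hv0, huv⟩ := hu
  -- The boundary values belong to `v`, the Lipschitz bound to `w`. Continuity turns a.e. equality
  -- on `D` into equality on the closure, so `w` inherits the zero boundary values.
  have h1 : Set.EqOn v w D := Measure.eqOn_open_of_ae_eq (huv.symm.trans huw) hD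
    (hv.mono subset_closure) hw.continuous.continuousOn
  have h2 : Set.EqOn v w (closure D) := h1.of_subset_closure hv hw.continuous.continuousOn
    subset_closure le_rfl
  refine ⟨K, D.indicator w, lipschitzWith_indicator hw hD fun x hx => ?_,
    fun x hx => Set.indicator_of_notMem hx _, ?_⟩
  · rw [← h2 (frontier_subset_closure hx), hv0 x hx]
  · filter_upwards [hgw, ae_restrict_mem hD.measurableSet] with x hx hxD
    rw [hx]
    exact grad_congr_of_eqOn hD (fun y hy => (Set.indicator_of_mem hy w).symm) hxD

lemma W1inf.isZeroOnBoundary_ofLipschitz {w : Vec d → Vec m} {K : ℝ≥0} (hw : LipschitzWith K w)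
    {Ω : Set (Vec d)} (hΩ : IsOpen Ω) (hb : Bornology.IsBounded Ω) (h0 : ∀ x ∉ Ω, w x = 0) :
    (W1inf.ofLipschitz hw hΩ.measurableSet hb).IsZeroOnBoundary := by
  refine ⟨w, hw.continuous.continuousOn, fun x hx => h0 x ?_, ae_eq_refl _⟩
  rw [hΩ.frontier_eq] at hx
  exact hx.2

/-! ### Lipschitz competitors in the cell formulas -/

lemma homog_le {f : Vec d → Mat m d → ℝ≥0∞} (ξ : Mat m d) {n : ℕ} (hn : 1 ≤ n)
    {w : Vec d → Vec m} {K : ℝ≥0} (hw : LipschitzWith K w) (h0 : ∀ x ∉ cube d n, w x = 0) :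
    homog f ξ ≤ ((n : ℝ≥0∞) ^ d)⁻¹ * ∫⁻ x in cube d n, f x (ξ + grad w x) := by
  refine iInf₂_le_of_le n hn ?_
  gcongr
  exact iInf₂_le_of_le (W1inf.ofLipschitz hw (isOpen_cube n).measurableSet (isBounded_cube n))
    (W1inf.isZeroOnBoundary_ofLipschitz hw (isOpen_cube n) (isBounded_cube n) h0) le_rfl

/-- Allows the lemmas on the constrained formula to serve for the unconstrained one as well. -/
lemma homog_eq_homogBdd_top (f : Vec d → Mat m d → ℝ≥0∞) (ξ : Mat m d) :
    homog f ξ = homogBdd ⊤ f ξ := by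
  simp [homog, homogBdd]

/-- Near-optimal cell functions come already extended by zero to Lipschitz functions on the whole
space, ready to be rescaled, translated and summed. -/
lemma exists_of_homogBdd_lt {f : Vec d → Mat m d → ℝ≥0∞} {ξ : Mat m d} {r a : ℝ≥0∞}
    (h : homogBdd r f ξ < a) : ∃ n : ℕ, 1 ≤ n ∧ ∃ (K : ℝ≥0) (w : Vec d → Vec m),
      LipschitzWith K w ∧ (∀ x ∉ cube d n, w x = 0) ∧
      (∀ᵐ x ∂(volume.restrict (cube d n)), ‖grad w x‖ₑ ≤ r) ∧
      ((n : ℝ≥0∞) ^ d)⁻¹ * ∫⁻ x in cube d n, f x (ξ + grad w x) < a := by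
  rw [homogBdd] at h
  obtain ⟨n, h⟩ := iInf_lt_iff.1 h
  obtain ⟨hn, h⟩ := iInf_lt_iff.1 h
  have hn0 : ((n : ℝ≥0∞) ^ d)⁻¹ ≠ 0 :=
    ENNReal.inv_ne_zero.2 (ENNReal.pow_ne_top (ENNReal.natCast_ne_top n))
  have hnt : ((n : ℝ≥0∞) ^ d)⁻¹ ≠ ⊤ :=
    ENNReal.inv_ne_top.2 (pow_ne_zero _ (by exact_mod_cast (by omega : n ≠ 0)))
  rw [ENNReal.mul_iInf_of_ne hn0 hnt] at h
  obtain ⟨φ, h⟩ := iInf_lt_iff.1 h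
  rw [ENNReal.mul_iInf_of_ne hn0 hnt] at h
  obtain ⟨h0, h⟩ := iInf_lt_iff.1 h
  rw [ENNReal.mul_iInf_of_ne hn0 hnt] at h
  obtain ⟨hr, h⟩ := iInf_lt_iff.1 h
  obtain ⟨K, w, hw, hw0, hg⟩ := h0.exists_extension (isOpen_cube n) (convex_cube n)
  refine ⟨n, hn, K, w, hw, hw0, ?_, ?_⟩
  · filter_upwards [hg, φ.ae_norm_grad_le] with x hx hx'
    rw [← hx]
    exact hx'.trans hr
  · rwa [lintegral_congr_ae (g := fun x => f x (ξ + φ.grad x))]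
    filter_upwards [hg] with x hx
    rw [hx]

/-! ### Rescaling, periodicity and the lower bound on a cube -/

lemma grad_scale {ε : ℝ} (hε : ε ≠ 0) (b : Vec d) (w : Vec d → Vec m) (x : Vec d) :
    grad (fun y => ε • w (ε⁻¹ • y - b)) x = grad w (ε⁻¹ • x - b) := by
  have h1 : fderiv ℝ (fun y => ε • w (ε⁻¹ • y - b)) x
      = ε • fderiv ℝ (fun y => w (ε⁻¹ • y - b)) x :=
    congrFun (fderiv_const_smul_field (f := fun y => w (ε⁻¹ • y - b)) ε) x
  have h2 : fderiv ℝ (fun y => w (ε⁻¹ • y - b)) x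
      = ε⁻¹ • fderiv ℝ (fun y => w (y - b)) (ε⁻¹ • x) :=
    fderiv_comp_smul (f := fun y => w (y - b)) (x := x) ε⁻¹
  rw [grad, grad, h1, h2, fderiv_comp_sub, smul_smul, mul_inv_cancel₀ hε, one_smul]

lemma lipschitzWith_scale {ε : ℝ} (hε : ε ≠ 0) (b : Vec d) {w : Vec d → Vec m} {K : ℝ≥0}
    (hw : LipschitzWith K w) : LipschitzWith K (fun y => ε • w (ε⁻¹ • y - b)) := by
  refine LipschitzWith.of_dist_le_mul fun x y => ?_
  rw [dist_smul₀]
  calc ‖ε‖ * dist (w (ε⁻¹ • x - b)) (w (ε⁻¹ • y - b))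
      ≤ ‖ε‖ * (K * dist (ε⁻¹ • x - b) (ε⁻¹ • y - b)) := by gcongr; exact hw.dist_le_mul _ _
    _ = K * dist x y := by
      rw [dist_sub_right, dist_smul₀, norm_inv]
      have : ‖ε‖ ≠ 0 := norm_ne_zero_iff.2 hε
      field_simp

/-- Integer vectors. -/
def intVec (z : Fin d → ℤ) : Vec d := WithLp.toLp 2 fun j => (z j : ℝ)

@[simp] lemma intVec_apply (z : Fin d → ℤ) (j : Fin d) : intVec z j = z j := rfl

lemma periodic_intVec {f : Vec d → Mat m d → ℝ≥0∞}
    (hper : ∀ (ξ : Mat m d) (x : Vec d) (j : Fin d), f (x + EuclideanSpace.single j 1) ξ = f x ξ)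
    (ξ : Mat m d) (z : Fin d → ℤ) : Function.Periodic (fun x => f x ξ) (intVec z) := by
  have h1 : ∀ j, Function.Periodic (fun x => f x ξ) (z j • EuclideanSpace.single j (1 : ℝ)) :=
    fun j => Function.Periodic.zsmul (fun x => hper ξ x j) (z j)
  have h2 : intVec z = ∑ j, z j • EuclideanSpace.single j (1 : ℝ) := by
    ext k; simp [Pi.single_apply]
  rw [h2]
  refine Finset.sum_induction _ (Function.Periodic fun x => f x ξ) (fun a b ha hb => ha.add_period hb)
    ?_ fun j _ => h1 j
  intro x; simp

/-- Off the closure `w` vanishes near the point, and the frontier is negligible. -/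
lemma grad_ae_eq_zero {w : Vec d → Vec m} {D : Set (Vec d)} (hf : volume (frontier D) = 0)
    (h0 : ∀ x ∉ D, w x = 0) : ∀ᵐ x, x ∉ D → grad w x = 0 := by
  filter_upwards [compl_mem_ae_iff.2 hf] with x hx hxD
  refine grad_eq_zero_of_eqOn (U := (closure D)ᶜ) isClosed_closure.isOpen_compl
    (fun y hy => h0 y fun h => hy (subset_closure h)) fun h => hx ?_
  exact ⟨h, fun hi => hxD (interior_subset hi)⟩

/-- Lower bound for the energy of functions with affine boundary data on a cube. -/
theorem volume_mul_homog_le {f : Vec d → Mat m d → ℝ≥0∞}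
    (hper : ∀ (ξ : Mat m d) (x : Vec d) (j : Fin d), f (x + EuclideanSpace.single j 1) ξ = f x ξ)
    {ξ : Mat m d} {A : ℝ≥0∞} (hA : ∀ x, f x ξ ≤ A) (a : Vec d) {ρ ε : ℝ} (hρ : 0 < ρ)
    (hε : 0 < ε) {w : Vec d → Vec m} {K : ℝ≥0} (hw : LipschitzWith K w)
    (h0 : ∀ x ∉ box a ρ, w x = 0) :
    ENNReal.ofReal ρ ^ d * homog f ξ ≤ (∫⁻ x in box a ρ, f (ε⁻¹ • x) (ξ + grad w x)) +
      A * (ENNReal.ofReal (ρ + 2 * ε) ^ d - ENNReal.ofReal ρ ^ d) := by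
  -- The extra unit absorbs the displacement, less than 1, caused by rounding the corner `ε⁻¹ a`
  -- down to an integer vector. Since also `n ≤ ρ / ε + 2`, the enlarged cube has side at most `ρ +
  -- 2ε`.
  set n : ℕ := ⌈ρ / ε⌉₊ + 1 with hn
  set z : Fin d → ℤ := fun j => ⌊ε⁻¹ * a j⌋ with hz
  set Φ : Vec d → Vec m := fun y => ε⁻¹ • w (ε⁻¹⁻¹ • y - (-(ε • intVec z))) with hΦ
  have hΦl : LipschitzWith K Φ := lipschitzWith_scale (inv_ne_zero hε.ne') _ hw
  have hnρ : ρ / ε + 1 ≤ n := by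
    have := Nat.le_ceil (ρ / ε)
    push_cast [hn]; linarith
  have hnρ' : (n : ℝ) ≤ ρ / ε + 2 := by
    have := Nat.ceil_lt_add_one (div_pos hρ hε).le
    push_cast [hn]; linarith
  set Q : Set (Vec d) := {x | ε⁻¹ • x - intVec z ∈ cube d n} with hQ
  have hsub : box a ρ ⊆ Q := by
    intro x hx j
    have h1 := hx j
    have h2 := Int.floor_le (ε⁻¹ * a j)
    have h3 := Int.lt_floor_add_one (ε⁻¹ * a j)
    have h4 : ε⁻¹ * a j < ε⁻¹ * x j := mul_lt_mul_of_pos_left h1.1 (inv_pos.2 hε)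
    have h5 : ε⁻¹ * x j < ε⁻¹ * (a j + ρ) := mul_lt_mul_of_pos_left h1.2 (inv_pos.2 hε)
    have h6 : ε⁻¹ * (a j + ρ) = ε⁻¹ * a j + ρ / ε := by rw [mul_add, div_eq_inv_mul]
    simp only [PiLp.sub_apply, PiLp.smul_apply, smul_eq_mul, intVec_apply, hz]
    constructor <;> linarith
  have hinv : ∀ x : Vec d, ε⁻¹⁻¹ • (ε⁻¹ • x - intVec z) - (-(ε • intVec z)) = x := by
    intro x
    rw [inv_inv, smul_sub, smul_smul, mul_inv_cancel₀ hε.ne', one_smul]; abel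
  have hΦ0 : ∀ y ∉ cube d n, Φ y = 0 := by
    intro y hy
    have : w (ε⁻¹⁻¹ • y - (-(ε • intVec z))) = 0 := by
      refine h0 _ fun hbox => hy ?_
      have := hsub hbox
      rw [hQ, Set.mem_ofPred_eq] at this
      convert this using 1
      rw [inv_inv, sub_neg_eq_add, smul_add, smul_smul, smul_smul, inv_mul_cancel₀ hε.ne', one_smul,
        one_smul, add_sub_cancel_right]
    simp only [hΦ, this, smul_zero]
  have hQm : MeasurableSet Q :=
    ((isOpen_cube n).preimage (by fun_prop : Continuous fun x : Vec d =>
      ε⁻¹ • x - intVec z)).measurableSet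
  have hQv : volume Q = ENNReal.ofReal (ε * n) ^ d := by
    rw [hQ, volume_scale hε, volume_cube, ENNReal.ofReal_mul hε.le, mul_pow,
      ENNReal.ofReal_natCast]
  have hscale : ENNReal.ofReal ε ^ d * ∫⁻ y in cube d n, f y (ξ + grad Φ y)
      = ∫⁻ x in Q, f (ε⁻¹ • x) (ξ + grad w x) := by
    rw [← setLIntegral_comp_scale hε (intVec z) (S := cube d n)]
    refine setLIntegral_congr_fun hQm fun x _ => ?_
    have e1 : grad Φ (ε⁻¹ • x - intVec z) = grad w x := by
      rw [hΦ, grad_scale (inv_ne_zero hε.ne'), hinv]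
    have e2 := (periodic_intVec hper (ξ + grad w x) z).sub_eq (ε⁻¹ • x)
    simp only [e1]
    exact e2
  -- On the added layer `∇w = 0` a.e., so the integrand is `f(·, ξ) ≤ A`.
  have hrest : ∫⁻ x in Q \ box a ρ, f (ε⁻¹ • x) (ξ + grad w x)
      ≤ A * (ENNReal.ofReal (ρ + 2 * ε) ^ d - ENNReal.ofReal ρ ^ d) := by
    calc ∫⁻ x in Q \ box a ρ, f (ε⁻¹ • x) (ξ + grad w x)
        ≤ ∫⁻ _x in Q \ box a ρ, A := by
          refine lintegral_mono_ae ?_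
          rw [ae_restrict_iff' (hQm.diff (measurableSet_box a ρ))]
          filter_upwards [grad_ae_eq_zero ((convex_box a ρ).addHaar_frontier volume) h0]
            with x hx hxQ
          rw [hx hxQ.2, add_zero]
          exact hA _
      _ = A * volume (Q \ box a ρ) := by rw [setLIntegral_const]
      _ ≤ _ := by
          gcongr
          rw [measure_sdiff hsub (measurableSet_box a ρ).nullMeasurableSet, hQv, volume_box]
          · gcongr
            calc ε * n ≤ ε * (ρ / ε + 2) := by gcongr
              _ = ρ + 2 * ε := by field_simp
          · rw [volume_box]; finiteness
  have hn0 : ((n : ℝ≥0∞) ^ d) ≠ 0 := pow_ne_zero _ (by simp [hn])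
  calc ENNReal.ofReal ρ ^ d * homog f ξ
      ≤ ENNReal.ofReal (ε * n) ^ d *
        (((n : ℝ≥0∞) ^ d)⁻¹ * ∫⁻ x in cube d n, f x (ξ + grad Φ x)) := by
        gcongr
        · calc ρ = ε * (ρ / ε) := by field_simp
            _ ≤ ε * n := by gcongr; linarith
        · exact homog_le ξ (by omega) hΦl hΦ0
    _ = ENNReal.ofReal ε ^ d * ∫⁻ x in cube d n, f x (ξ + grad Φ x) := by
        rw [ENNReal.ofReal_mul hε.le, mul_pow, ENNReal.ofReal_natCast, mul_assoc,
          ← mul_assoc ((n : ℝ≥0∞) ^ d), ENNReal.mul_inv_cancel hn0 (by finiteness), one_mul]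
    _ = (∫⁻ x in box a ρ, f (ε⁻¹ • x) (ξ + grad w x))
        + ∫⁻ x in Q \ box a ρ, f (ε⁻¹ • x) (ξ + grad w x) := by
        rw [hscale, ← lintegral_inter_add_sdiff _ Q (measurableSet_box a ρ),
          Set.inter_eq_right.2 hsub]
    _ ≤ _ := by gcongr

/-! ### Cutoff functions and boundary layers -/

/-- Truncation near the boundary of `D`. -/
lemma exists_cutoff {D : Set (Vec d)} (hD : Dᶜ.Nonempty) {v : Vec d → Vec m} {K : ℝ≥0}
    (hv : LipschitzWith K v) {M s : ℝ≥0} (hs : 0 < s) (hM : ∀ x ∈ D, ‖v x‖ ≤ M) :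
    ∃ p : Vec d → Vec m, LipschitzWith (K + M / s) p ∧ (∀ x ∉ D, p x = 0) ∧
      ∀ x ∉ Metric.cthickening s Dᶜ, p x = v x := by
  set θ : Vec d → ℝ := fun x => min 1 (Metric.infDist x Dᶜ / s) with hθ
  have hs' : (0 : ℝ) < s := hs
  have hθ0 : ∀ x, 0 ≤ θ x := fun x => le_min zero_le_one (div_nonneg Metric.infDist_nonneg hs'.le)
  have hθ1 : ∀ x, θ x ≤ 1 := fun x => min_le_left _ _
  have hθD : ∀ x ∉ D, θ x = 0 := by
    intro x hx
    have : Metric.infDist x Dᶜ = 0 := Metric.infDist_zero_of_mem hx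
    simp [hθ, this]
  have hθl : ∀ x y, |θ x - θ y| ≤ dist x y / s := by
    intro x y
    refine (abs_min_sub_min_le_max _ _ _ _).trans ?_
    rw [sub_self, abs_zero, ← sub_div, abs_div, abs_of_pos hs']
    refine max_le (by positivity) ?_
    gcongr
    have := (Metric.lipschitz_infDist_pt Dᶜ).dist_le_mul x y
    simpa [Real.dist_eq] using this
  -- The difference is split so that the increment of `θ` multiplies `v x` with `x ∈ D`; thus only
  -- the bound for `v` on `D` enters.
  have key : ∀ x ∈ D, ∀ y, ‖θ x • v x - θ y • v y‖ ≤ (K + M / s) * dist x y := by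
    intro x hx y
    have e : θ x • v x - θ y • v y = (θ x - θ y) • v x + θ y • (v x - v y) := by
      rw [sub_smul, smul_sub]; abel
    rw [e]
    refine (norm_add_le _ _).trans ?_
    rw [norm_smul, norm_smul, Real.norm_eq_abs, Real.norm_eq_abs, abs_of_nonneg (hθ0 y)]
    calc |θ x - θ y| * ‖v x‖ + θ y * ‖v x - v y‖
        ≤ dist x y / s * M + 1 * (K * dist x y) := by
          gcongr
          · exact hθl x y
          · exact hM x hx
          · exact hθ1 y
          · rw [← dist_eq_norm]; exact hv.dist_le_mul x y
      _ = (K + M / s) * dist x y := by ring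
  refine ⟨fun x => θ x • v x, LipschitzWith.of_dist_le_mul fun x y => ?_, fun x hx => ?_,
    fun x hx => ?_⟩
  · rw [dist_eq_norm]
    push_cast
    by_cases hx : x ∈ D
    · exact key x hx y
    by_cases hy : y ∈ D
    · rw [norm_sub_rev, dist_comm]; exact key y hy x
    · rw [hθD x hx, hθD y hy, zero_smul, zero_smul, sub_zero, norm_zero]
      positivity
  · simp only [hθD x hx, zero_smul]
  · have h1 : (s : ℝ) < Metric.infDist x Dᶜ := by
      by_contra! h
      refine hx ?_
      obtain ⟨y, hy⟩ := hD
      rw [Metric.mem_cthickening_iff, ENNReal.le_ofReal_iff_toReal_le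
        (Metric.infEDist_ne_top ⟨y, hy⟩) hs'.le]
      exact h
    have h2 : θ x = 1 := min_eq_left ((one_le_div hs').2 h1.le)
    simp only [h2, one_smul]

/-- The closed neighbourhoods of `Dᶜ` shrink to `Dᶜ` itself, which is null for the measure
restricted to `D`. No regularity of the boundary is involved. -/
lemma tendsto_volume_layer {D : Set (Vec d)} (hD : IsOpen D) (hv : volume D ≠ ⊤) :
    Tendsto (fun s => volume (D ∩ Metric.cthickening s Dᶜ)) (𝓝 0) (𝓝 0) := by
  have : IsFiniteMeasure (volume.restrict D) := ⟨by simpa using hv.lt_top⟩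
  have h := tendsto_measure_cthickening_of_isClosed (μ := volume.restrict D) (s := Dᶜ)
    ⟨1, one_pos, measure_ne_top _ _⟩ hD.isClosed_compl
  rw [Measure.restrict_apply hD.measurableSet.compl, Set.compl_inter_self, measure_empty] at h
  refine h.congr fun s => ?_
  rw [Measure.restrict_apply Metric.isClosed_cthickening.measurableSet, Set.inter_comm]

/-! ### Tiling by rescaled cells -/

/-- The cell `ε (n z + ]0,n[^d)`. -/
def cell (ε : ℝ) (n : ℕ) (z : Fin d → ℤ) : Set (Vec d) :=
  {x | ε⁻¹ • x - intVec (fun j => n * z j) ∈ cube d n}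

lemma isOpen_cell (ε : ℝ) (n : ℕ) (z : Fin d → ℤ) : IsOpen (cell ε n z) :=
  (isOpen_cube n).preimage (by fun_prop : Continuous fun x : Vec d =>
    ε⁻¹ • x - intVec fun j => n * z j)

lemma mem_cell_iff {ε : ℝ} {n : ℕ} {z : Fin d → ℤ} {x : Vec d} :
    x ∈ cell ε n z ↔ ∀ j, (n * z j : ℝ) < ε⁻¹ * x j ∧ ε⁻¹ * x j < n * (z j + 1) := by
  simp only [cell, cube, Set.mem_ofPred_eq, PiLp.sub_apply, PiLp.smul_apply, smul_eq_mul,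
    intVec_apply, Int.cast_mul, Int.cast_natCast]
  refine forall_congr' fun j => ?_
  constructor <;> rintro ⟨h1, h2⟩ <;> constructor <;> linarith

lemma pairwise_disjoint_cell (ε : ℝ) {n : ℕ} (hn : 1 ≤ n) :
    Pairwise (Function.onFun Disjoint (cell (d := d) ε n)) := by
  intro z z' hzz
  rw [Function.onFun, Set.disjoint_left]
  intro x hx hx'
  refine hzz (funext fun j => ?_)
  have h1 := mem_cell_iff.1 hx j
  have h2 := mem_cell_iff.1 hx' j
  have hn' : (0 : ℝ) < n := by exact_mod_cast hn
  have h3 : (z j : ℝ) < z' j + 1 := lt_of_mul_lt_mul_left (h1.1.trans h2.2) hn'.le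
  have h4 : (z' j : ℝ) < z j + 1 := lt_of_mul_lt_mul_left (h2.1.trans h1.2) hn'.le
  have h5 : z j < z' j + 1 := by exact_mod_cast h3
  have h6 : z' j < z j + 1 := by exact_mod_cast h4
  omega

lemma volume_hyperplane (j : Fin d) (c : ℝ) : volume {x : Vec d | x j = c} = 0 := by
  have h := (EuclideanSpace.volume_preserving_symm_measurableEquiv_toLp (Fin d)).measure_preimage
    (s := {y : Fin d → ℝ | y j = c})
    (measurableSet_eq_fun (by fun_prop) (by fun_prop)).nullMeasurableSet
  refine (h.trans ?_)
  rw [volume_pi]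
  exact Measure.pi_hyperplane (fun _ : Fin d => (volume : Measure ℝ)) j c

/-- A point in no cell lies on one of countably many hyperplanes. -/
lemma ae_exists_mem_cell {ε : ℝ} (hε : 0 < ε) {n : ℕ} (hn : 1 ≤ n) :
    ∀ᵐ x : Vec d, ∃ z, x ∈ cell ε n z := by
  have hn' : (0 : ℝ) < n := by exact_mod_cast hn
  have h1 : ∀ᵐ x : Vec d, ∀ (j : Fin d) (k : ℤ), x j ≠ ε * (n * k) := by
    rw [ae_all_iff]; intro j
    rw [ae_all_iff]; intro k
    exact measure_mono_null (fun x hx => by simpa using hx) (volume_hyperplane j (ε * (n * k)))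
  filter_upwards [h1] with x hx
  refine ⟨fun j => ⌊ε⁻¹ * x j / n⌋, mem_cell_iff.2 fun j => ⟨?_, ?_⟩⟩
  · refine lt_of_le_of_ne ?_ fun h => hx j _ (?_ : x j = ε * (n * (⌊ε⁻¹ * x j / n⌋ : ℤ)))
    · have := Int.floor_le (ε⁻¹ * x j / n)
      rw [le_div_iff₀ hn'] at this
      linarith
    · rw [h]; field_simp
  · have := Int.lt_floor_add_one (ε⁻¹ * x j / n)
    rw [div_lt_iff₀ hn'] at this
    linarith

lemma dist_le_of_mem_cell {ε : ℝ} (hε : 0 < ε) {n : ℕ} {z : Fin d → ℤ}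
    {x y : Vec d} (hx : x ∈ cell ε n z) (hy : y ∈ cell ε n z) : dist x y ≤ d * (ε * n) := by
  rw [dist_eq_norm]
  refine norm_sub_le_of_mem_box (by positivity) fun j => ?_
  have h1 := mem_cell_iff.1 hx j
  have h2 := mem_cell_iff.1 hy j
  have h3 : |ε⁻¹ * x j - ε⁻¹ * y j| ≤ n := by
    rw [abs_le]; constructor <;> linarith
  rw [← mul_sub, abs_mul, abs_of_pos (inv_pos.2 hε), inv_mul_le_iff₀ hε] at h3
  exact h3

lemma volume_cell {ε : ℝ} (hε : 0 < ε) (n : ℕ) (z : Fin d → ℤ) :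
    volume (cell ε n z) = ENNReal.ofReal ε ^ d * (n : ℝ≥0∞) ^ d := by
  rw [cell, volume_scale hε, volume_cube]

/-- Filling an open set with rescaled copies of a cell function. -/
theorem exists_tiling {n : ℕ} (hn : 1 ≤ n) {Φ : Vec d → Vec m} {K : ℝ≥0}
    (hΦ : LipschitzWith K Φ) (h0 : ∀ x ∉ cube d n, Φ x = 0) {M : ℝ} (hM : ∀ x, ‖Φ x‖ ≤ M)
    {C : ℝ≥0∞} (hC : ∀ᵐ x ∂(volume.restrict (cube d n)), ‖grad Φ x‖ₑ ≤ C)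
    {D : Set (Vec d)} (hD : MeasurableSet D) (hDv : volume D ≠ ⊤) {ε : ℝ} (hε : 0 < ε) :
    ∃ (K' : ℝ≥0) (ψ : Vec d → Vec m), LipschitzWith K' ψ ∧ (∀ x ∉ D, ψ x = 0) ∧
      (∀ x, ‖ψ x‖ ≤ ε * M) ∧ (∀ᵐ x, ‖grad ψ x‖ₑ ≤ C) ∧
      ∀ (f : Vec d → Mat m d → ℝ≥0∞) (ξ : Mat m d) (A : ℝ≥0∞),
        (∀ (ξ : Mat m d) (x : Vec d) (j : Fin d),
          f (x + EuclideanSpace.single j 1) ξ = f x ξ) →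
        (∀ x, f x ξ ≤ A) →
        ∫⁻ x in D, f (ε⁻¹ • x) (ξ + grad ψ x) ≤
          volume D * (((n : ℝ≥0∞) ^ d)⁻¹ * ∫⁻ x in cube d n, f x (ξ + grad Φ x)) +
          A * volume (D ∩ Metric.cthickening (d * (ε * n)) Dᶜ) := by
  classical
  -- Disjoint sets of equal positive volume inside a set of finite volume are finitely many.
  have hfin : {z : Fin d → ℤ | cell ε n z ⊆ D}.Finite := by
    have : IsFiniteMeasure (volume.restrict D) := ⟨by simpa using hDv.lt_top⟩
    refine (Measure.finite_const_le_meas_of_disjoint_iUnion (volume.restrict D)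
      (ε := ENNReal.ofReal ε ^ d * (n : ℝ≥0∞) ^ d) (As := cell ε n) ?_
      (fun z => (isOpen_cell ε n z).measurableSet) (pairwise_disjoint_cell ε hn)
      (measure_ne_top _ _)).subset fun z hz => ?_
    · have h1 : 0 < ENNReal.ofReal ε := by simpa using hε
      have h2 : (0 : ℝ≥0∞) < n := by exact_mod_cast hn
      positivity
    · rw [Set.mem_ofPred_eq] at hz ⊢
      rw [Measure.restrict_apply (isOpen_cell ε n z).measurableSet,
        Set.inter_eq_left.2 hz, volume_cell hε]
  set S : Finset (Fin d → ℤ) := hfin.toFinset with hS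
  have hmemS : ∀ {z}, z ∈ S ↔ cell ε n z ⊆ D := by intro z; simp [hS]
  set b : (Fin d → ℤ) → Vec d := fun z => intVec fun j => n * z j with hb
  set τ : (Fin d → ℤ) → Vec d → Vec m := fun z x => ε • Φ (ε⁻¹ • x - b z) with hτ
  have hτ0 : ∀ z, ∀ x ∉ cell ε n z, τ z x = 0 := by
    intro z x hx
    have : Φ (ε⁻¹ • x - b z) = 0 := h0 _ hx
    simp only [hτ, this, smul_zero]
  set ψ : Vec d → Vec m := fun x => ∑ z ∈ S, τ z x with hψ
  have hψin : ∀ z ∈ S, ∀ x ∈ cell ε n z, ψ x = τ z x := by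
    intro z hz x hx
    refine Finset.sum_eq_single_of_mem z hz fun z' _ hzz' => hτ0 z' x fun hx' => ?_
    exact Set.disjoint_left.1 (pairwise_disjoint_cell ε hn hzz') hx' hx
  have hψout : ∀ x, (∀ z ∈ S, x ∉ cell ε n z) → ψ x = 0 := fun x hx =>
    Finset.sum_eq_zero fun z hz => hτ0 z x (hx z hz)
  have hg1 : ∀ z ∈ S, ∀ x ∈ cell ε n z, grad ψ x = grad Φ (ε⁻¹ • x - b z) := by
    intro z hz x hx
    rw [grad_congr_of_eqOn (isOpen_cell ε n z) (hψin z hz) hx, hτ, grad_scale hε.ne']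
  have hg2 : ∀ z ∉ S, ∀ x ∈ cell ε n z, grad ψ x = 0 := by
    intro z hz x hx
    refine grad_eq_zero_of_eqOn (isOpen_cell ε n z) (fun y hy => hψout y fun z' hz' hy' => ?_) hx
    have hne : z' ≠ z := by rintro rfl; exact hz hz'
    exact Set.disjoint_left.1 (pairwise_disjoint_cell ε hn hne) hy' hy
  -- This Lipschitz constant grows with the number of cells and hence depends on `ε`; it is used
  -- only qualitatively. The uniform control is the a.e. bound by `C`.
  refine ⟨∑ _z ∈ S, K, ψ, ?_, ?_, ?_, ?_, ?_⟩
  · have : ∀ S' : Finset (Fin d → ℤ), LipschitzWith (∑ _z ∈ S', K) (fun x => ∑ z ∈ S', τ z x) := by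
      intro S'
      induction S' using Finset.induction_on with
      | empty => simp
      | insert z S' hz ih =>
        simp only [Finset.sum_insert hz]
        exact (lipschitzWith_scale hε.ne' _ hΦ).add ih
    exact this S
  · intro x hx
    exact hψout x fun z hz hxz => hx (hmemS.1 hz hxz)
  · intro x
    have hM0 : 0 ≤ M := (norm_nonneg _).trans (hM 0)
    by_cases hx : ∃ z ∈ S, x ∈ cell ε n z
    · obtain ⟨z, hz, hxz⟩ := hx
      rw [hψin z hz x hxz, hτ, norm_smul, Real.norm_eq_abs, abs_of_pos hε]
      gcongr
      exact hM _
    · push Not at hx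
      rw [hψout x hx, norm_zero]
      positivity
  · have hbad : ∀ᵐ x : Vec d, ∀ z, x ∈ cell ε n z → ‖grad Φ (ε⁻¹ • x - b z)‖ₑ ≤ C := by
      rw [ae_all_iff]; intro z
      have h1 : volume {y | y ∈ cube d n ∧ ¬ ‖grad Φ y‖ₑ ≤ C} = 0 := by
        rw [ae_restrict_iff' (isOpen_cube n).measurableSet, ae_iff] at hC
        simpa using hC
      have h2 := volume_scale hε (b z) {y | y ∈ cube d n ∧ ¬ ‖grad Φ y‖ₑ ≤ C}
      rw [h1, mul_zero] at h2
      rw [ae_iff]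
      refine measure_mono_null (fun x hx => ?_) h2
      simp only [Set.mem_ofPred_eq, not_forall] at hx ⊢
      exact ⟨hx.1, hx.2⟩
    filter_upwards [hbad, ae_exists_mem_cell hε hn] with x hx ⟨z, hz⟩
    by_cases hzS : z ∈ S
    · rw [hg1 z hzS x hz]; exact hx z hz
    · rw [hg2 z hzS x hz]; simp
  · intro f ξ A hper hA
    set U : Set (Vec d) := ⋃ z ∈ S, cell ε n z with hU
    have hUm : MeasurableSet U :=
      Finset.measurableSet_biUnion S fun z _ => (isOpen_cell ε n z).measurableSet
    have hUD : U ⊆ D := Set.iUnion₂_subset fun z hz => hmemS.1 hz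
    have hdisj : (S : Set (Fin d → ℤ)).PairwiseDisjoint (cell ε n) :=
      fun z _ z' _ hne => pairwise_disjoint_cell ε hn hne
    have hn0 : ((n : ℝ≥0∞) ^ d) ≠ 0 := pow_ne_zero _ (by exact_mod_cast (by omega : n ≠ 0))
    set I := ∫⁻ x in cube d n, f x (ξ + grad Φ x) with hI
    have hcell : ∀ z ∈ S, ∫⁻ x in cell ε n z, f (ε⁻¹ • x) (ξ + grad ψ x) =
        volume (cell ε n z) * (((n : ℝ≥0∞) ^ d)⁻¹ * I) := by
      intro z hz
      rw [volume_cell hε, mul_assoc, ← mul_assoc ((n : ℝ≥0∞) ^ d),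
        ENNReal.mul_inv_cancel hn0 (by finiteness), one_mul, hI,
        ← setLIntegral_comp_scale hε (b z)]
      refine setLIntegral_congr_fun (isOpen_cell ε n z).measurableSet fun x hx => ?_
      have e := (periodic_intVec hper (ξ + grad Φ (ε⁻¹ • x - b z)) fun j => n * z j).sub_eq
        (ε⁻¹ • x)
      simp only [hg1 z hz x hx]
      exact e.symm
    have hin : ∫⁻ x in U, f (ε⁻¹ • x) (ξ + grad ψ x) ≤ volume D * (((n : ℝ≥0∞) ^ d)⁻¹ * I) := by
      rw [hU, lintegral_biUnion_finset hdisj fun z _ => (isOpen_cell ε n z).measurableSet,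
        Finset.sum_congr rfl hcell, ← Finset.sum_mul]
      gcongr
      rw [← measure_biUnion_finset hdisj fun z _ => (isOpen_cell ε n z).measurableSet]
      exact measure_mono hUD
    have hout : ∫⁻ x in D \ U, f (ε⁻¹ • x) (ξ + grad ψ x) ≤
        A * volume (D ∩ Metric.cthickening (d * (ε * n)) Dᶜ) := by
      calc ∫⁻ x in D \ U, f (ε⁻¹ • x) (ξ + grad ψ x) ≤ ∫⁻ _x in D \ U, A := by
            refine lintegral_mono_ae ?_
            rw [ae_restrict_iff' (hD.diff hUm)]
            filter_upwards [ae_exists_mem_cell hε hn] with x ⟨z, hz⟩ hx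
            have hzS : z ∉ S := fun hzS => hx.2 (Set.mem_biUnion hzS hz)
            rw [hg2 z hzS x hz, add_zero]
            exact hA _
        _ = A * volume (D \ U) := by rw [setLIntegral_const]
        _ ≤ _ := by
            gcongr A * ?_
            -- An unused cell contains a point outside `D`, so its points lie within its diameter,
            -- at most `d * (ε * n)`, of `Dᶜ`.
            refine measure_mono_ae ?_
            filter_upwards [ae_exists_mem_cell hε hn] with x ⟨z, hz⟩ hx
            refine ⟨hx.1, ?_⟩
            by_contra hcon
            have hzS : z ∉ S := fun hzS => hx.2 (Set.mem_biUnion hzS hz)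
            refine hzS (hmemS.2 fun y hy => ?_)
            by_contra hyD
            exact hcon (Metric.mem_cthickening_of_dist_le x y _ _ hyD
              (dist_le_of_mem_cell hε hz hy))
    rw [← lintegral_inter_add_sdiff _ D hUm, Set.inter_eq_right.2 hUD]
    exact add_le_add hin hout

/-! ### Oscillating perturbations and the upper bound for piecewise affine functions -/

lemma le_of_forall_pos_le_add_mul {a b V : ℝ≥0∞} (hV : V ≠ ⊤)
    (h : ∀ δ : ℝ≥0, 0 < δ → a ≤ b + δ * V) : a ≤ b := by
  refine ENNReal.le_of_forall_pos_le_add fun η hη _ => ?_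
  lift V to ℝ≥0 using hV
  refine (h (η / (V + 1)) (by positivity)).trans ?_
  gcongr
  norm_cast
  rw [div_mul_eq_mul_div]
  refine div_le_of_le_mul₀ (by positivity) (by positivity) ?_
  gcongr
  exact le_self_add

/-- If `ψ_ε → 0` uniformly and the gradients stay bounded, the gradients converge to zero
weakly*. -/
lemma tendsto_integral_grad_mul {ψ : ℝ → Vec d → Vec m} {M R : ℝ}
    (hL : ∀ ε > 0, ∃ K : ℝ≥0, LipschitzWith K (ψ ε)) (hM : ∀ ε > 0, ∀ x, ‖ψ ε x‖ ≤ ε * M)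
    (hR : ∀ ε > 0, ∀ᵐ x, ‖grad (ψ ε) x‖ ≤ R) {h : Vec d → ℝ} (hh : Integrable h)
    (i : Fin m) (j : Fin d) :
    Tendsto (fun ε => ∫ x, grad (ψ ε) x (i, j) * h x) (𝓝[>] 0) (𝓝 0) := by
  have hR0 : 0 ≤ R := by
    obtain ⟨x, hx⟩ := (hR 1 one_pos).exists
    exact (norm_nonneg _).trans hx
  rw [Metric.tendsto_nhds]
  intro η hη
  -- Split `h` into a small `L¹` remainder and a test function `k`. The remainder is paired with the
  -- gradient bound `R`, and `R * (η / (2 * (R + 1))) < η`. On `k`, integration by parts leaves the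
  -- functions themselves, which are `O(ε)`.
  obtain ⟨k, hkc, hks, hk⟩ := (memLp_one_iff_integrable.2 hh).exist_eLpNorm_sub_le
    ENNReal.one_ne_top le_rfl (ε := η / (2 * (R + 1))) (by positivity)
  have hki : Integrable k := hks.continuous.integrable_of_hasCompactSupport hkc
  have hsub : Integrable (fun x => h x - k x) := hh.sub hki
  have hnorm : ∫ x, ‖h x - k x‖ ≤ η / (2 * (R + 1)) := by
    rw [integral_norm_eq_lintegral_enorm hsub.aestronglyMeasurable]
    refine ENNReal.toReal_le_of_le_ofReal (by positivity) ?_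
    rwa [eLpNorm_one_eq_lintegral_enorm] at hk
  set e : Vec d := EuclideanSpace.single j 1 with he
  have hdi : Integrable (fun x => fderiv ℝ k x e) := by
    refine Continuous.integrable_of_hasCompactSupport ?_ ?_
    · exact (hks.continuous_fderiv (by simp)).clm_apply continuous_const
    · exact (hkc.fderiv ℝ).comp_left (g := fun A : Vec d →L[ℝ] ℝ => A e) rfl
  set B := ∫ x, ‖fderiv ℝ k x e‖ with hB
  have hlim : Tendsto (fun ε : ℝ => R * (η / (2 * (R + 1))) + ε * M * B) (𝓝[>] 0)
      (𝓝 (R * (η / (2 * (R + 1))) + 0 * M * B)) := by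
    refine tendsto_nhdsWithin_of_tendsto_nhds (Continuous.tendsto ?_ 0)
    fun_prop
  have hlt : R * (η / (2 * (R + 1))) + 0 * M * B < η := by
    rw [zero_mul, zero_mul, add_zero, mul_div_assoc', div_lt_iff₀ (by positivity)]
    nlinarith
  filter_upwards [hlim.eventually (gt_mem_nhds hlt), self_mem_nhdsWithin] with ε hε hε0
  obtain ⟨K, hK⟩ := hL ε hε0
  have hgm : MemLp (fun x => grad (ψ ε) x (i, j)) ⊤ volume := memLp_coord (memLp_top_grad hK _) _
  have hsplit : ∫ x, grad (ψ ε) x (i, j) * h x =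
      (∫ x, grad (ψ ε) x (i, j) * (h x - k x)) + ∫ x, grad (ψ ε) x (i, j) * k x := by
    rw [← integral_add (hsub.memLp_top_mul hgm) (hki.memLp_top_mul hgm)]
    congr 1 with x
    ring
  rw [dist_zero_right, hsplit]
  refine lt_of_le_of_lt ((norm_add_le _ _).trans (add_le_add ?_ ?_)) hε
  · calc ‖∫ x, grad (ψ ε) x (i, j) * (h x - k x)‖ ≤ ∫ x, R * ‖h x - k x‖ := by
          refine norm_integral_le_of_norm_le (hsub.norm.const_mul R) ?_
          filter_upwards [hR ε hε0] with x hx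
          rw [norm_mul]
          gcongr
          exact (PiLp.norm_apply_le _ _).trans hx
      _ ≤ R * (η / (2 * (R + 1))) := by
          rw [integral_const_mul]; gcongr
  · rw [integral_grad_mul hK hks hkc, norm_neg]
    calc ‖∫ x, ψ ε x i * fderiv ℝ k x e‖ ≤ ∫ x, ε * M * ‖fderiv ℝ k x e‖ := by
          refine norm_integral_le_of_norm_le (hdi.norm.const_mul _) (Eventually.of_forall fun x => ?_)
          rw [norm_mul]
          gcongr
          exact (PiLp.norm_apply_le _ _).trans (hM ε hε0 x)
      _ = ε * M * B := by rw [integral_const_mul]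

/-- Adding a Lipschitz function to an element of `W^{1,∞}`. -/
def W1inf.addLipschitz {Ω : Set (Vec d)} (hΩ : MeasurableSet Ω) (hb : Bornology.IsBounded Ω)
    (u : W1inf Ω m) {w : Vec d → Vec m} {K : ℝ≥0} (hw : LipschitzWith K w) : W1inf Ω m where
  toFun := u.toFun + w
  grad := u.grad + SemiHom.grad w
  memLp_toFun := u.memLp_toFun.add (memLp_top_of_lipschitz hw hΩ hb)
  memLp_grad := u.memLp_grad.add (memLp_top_grad hw _)
  hasWeakGradient := u.hasWeakGradient.add (hasWeakGradient_of_lipschitz hw Ω) u.memLp_toFun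
    (memLp_top_of_lipschitz hw hΩ hb) u.memLp_grad (memLp_top_grad hw _)

/-- The values converge uniformly; for the gradients the preceding lemma is applied to `h` extended
by zero. No uniformity in the Lipschitz constants `K ε` is required, which suits the tilings. -/
lemma weakStarTendsto_addLipschitz {Ω : Set (Vec d)} (hΩ : MeasurableSet Ω)
    (hb : Bornology.IsBounded Ω) (u : W1inf Ω m) {ψ : ℝ → Vec d → Vec m} {M R : ℝ}
    {K : ℝ → ℝ≥0} (hL : ∀ ε, LipschitzWith (K ε) (ψ ε)) (hM : ∀ ε > 0, ∀ x, ‖ψ ε x‖ ≤ ε * M)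
    (hR : ∀ ε > 0, ∀ᵐ x, ‖grad (ψ ε) x‖ ≤ R) :
    W1inf.WeakStarTendsto (fun ε => u.addLipschitz hΩ hb (hL ε)) u := by
  intro h hh
  constructor
  · intro i
    have h1 : ∀ ε, ∫ x in Ω, (u.addLipschitz hΩ hb (hL ε)).toFun x i * h x =
        (∫ x in Ω, u.toFun x i * h x) + ∫ x in Ω, ψ ε x i * h x := by
      intro ε
      rw [← integral_add (hh.memLp_top_mul (memLp_coord u.memLp_toFun i))
        (hh.memLp_top_mul (memLp_coord (memLp_top_of_lipschitz (hL ε) hΩ hb) i))]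
      congr 1 with x
      simp only [W1inf.addLipschitz, Pi.add_apply, PiLp.add_apply]
      ring
    simp only [h1]
    have h2 : Tendsto (fun ε => ∫ x in Ω, ψ ε x i * h x) (𝓝[>] 0) (𝓝 0) := by
      have h3 : Tendsto (fun ε : ℝ => ε * M * ∫ x in Ω, ‖h x‖) (𝓝[>] 0)
          (𝓝 (0 * M * ∫ x in Ω, ‖h x‖)) := by
        refine tendsto_nhdsWithin_of_tendsto_nhds (Continuous.tendsto ?_ 0)
        fun_prop
      rw [zero_mul, zero_mul] at h3
      refine squeeze_zero_norm' ?_ h3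
      filter_upwards [self_mem_nhdsWithin] with ε hε
      rw [← integral_const_mul]
      refine norm_integral_le_of_norm_le (hh.norm.const_mul _) (Eventually.of_forall fun x => ?_)
      rw [norm_mul]
      gcongr
      exact (PiLp.norm_apply_le _ _).trans (hM ε hε x)
    simpa using h2.const_add (∫ x in Ω, u.toFun x i * h x)
  · intro i j
    have h1 : ∀ ε, ∫ x in Ω, (u.addLipschitz hΩ hb (hL ε)).grad x (i, j) * h x =
        (∫ x in Ω, u.grad x (i, j) * h x) + ∫ x, grad (ψ ε) x (i, j) * Ω.indicator h x := by
      intro ε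
      have e : ∫ x, grad (ψ ε) x (i, j) * Ω.indicator h x =
          ∫ x in Ω, grad (ψ ε) x (i, j) * h x := by
        rw [← integral_indicator hΩ]
        congr 1 with x
        by_cases hx : x ∈ Ω <;> simp [hx]
      rw [e, ← integral_add (hh.memLp_top_mul (memLp_coord u.memLp_grad _))
        (hh.memLp_top_mul (memLp_coord (memLp_top_grad (hL ε) _) _))]
      congr 1 with x
      simp only [W1inf.addLipschitz, Pi.add_apply, PiLp.add_apply]
      ring
    simp only [h1]
    simpa using (tendsto_integral_grad_mul (fun ε _ => ⟨K ε, hL ε⟩) hM hR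
      ((integrable_indicator_iff hΩ).2 hh) i j).const_add (∫ x in Ω, u.grad x (i, j) * h x)

/-- The zero function on the unit cell is admissible for every `r`. This is the source of finiteness
of the cell formulas. -/
lemma homogBdd_le {f : Vec d → Mat m d → ℝ≥0∞} (r : ℝ≥0∞) {ξ : Mat m d} {A : ℝ≥0∞}
    (hA : ∀ x, f x ξ ≤ A) : homogBdd r f ξ ≤ A := by
  have h0 : LipschitzWith 0 (fun _ : Vec d => (0 : Vec m)) := LipschitzWith.const 0
  refine iInf₂_le_of_le 1 le_rfl ?_
  rw [Nat.cast_one, one_pow, inv_one, one_mul]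
  refine iInf_le_of_le (W1inf.ofLipschitz h0 (isOpen_cube 1).measurableSet (isBounded_cube 1)) ?_
  refine iInf₂_le_of_le (W1inf.isZeroOnBoundary_ofLipschitz h0 (isOpen_cube 1) (isBounded_cube 1)
    fun _ _ => rfl) ?_ ?_
  · have : (W1inf.ofLipschitz h0 (isOpen_cube 1).measurableSet (isBounded_cube 1)).grad
        = fun _ => 0 := funext fun x => grad_const 0 x
    rw [W1inf.gradNorm, this, eLpNorm_zero']
    exact zero_le
  · calc ∫⁻ x in cube d 1, f x (ξ + grad (fun _ : Vec d => (0 : Vec m)) x)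
        ≤ ∫⁻ _x in cube d 1, A := by
          refine lintegral_mono fun x => ?_
          rw [grad_const, add_zero]
          exact hA x
      _ = A := by rw [setLIntegral_const, volume_cube]; simp

lemma exists_norm_le_of_eq_zero_off {w : Vec d → Vec m} {K : ℝ≥0} (hw : LipschitzWith K w)
    {D : Set (Vec d)} (hb : Bornology.IsBounded D) (h0 : ∀ x ∉ D, w x = 0) :
    ∃ M : ℝ, 0 ≤ M ∧ ∀ x, ‖w x‖ ≤ M := by
  obtain ⟨R, hR⟩ := (hw.isBounded_image hb).exists_norm_le
  refine ⟨max R 0, le_max_right _ _, fun x => ?_⟩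
  by_cases hx : x ∈ D
  · exact (hR _ (Set.mem_image_of_mem w hx)).trans (le_max_left _ _)
  · rw [h0 x hx, norm_zero]; exact le_max_right _ _

lemma lipschitzWith_sum {ι : Type*} (s : Finset ι) {w : ι → Vec d → Vec m} {K : ι → ℝ≥0}
    (hw : ∀ i ∈ s, LipschitzWith (K i) (w i)) :
    LipschitzWith (∑ i ∈ s, K i) (fun x => ∑ i ∈ s, w i x) := by
  classical
  induction s using Finset.induction_on with
  | empty => simp
  | insert i s hi ih =>
    simp only [Finset.sum_insert hi]
    exact (hw i (Finset.mem_insert_self i s)).add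
      (ih fun j hj => hw j (Finset.mem_insert_of_mem hj))

/-- A sum of functions supported in disjoint open sets. -/
lemma grad_sum_eq_of_disjoint {ι : Type*} [Fintype ι] {w : ι → Vec d → Vec m}
    {D : ι → Set (Vec d)} (hD : ∀ i, IsOpen (D i)) (hdisj : Pairwise fun i j => Disjoint (D i) (D j))
    (h0 : ∀ i, ∀ x ∉ D i, w i x = 0) (i : ι) {x : Vec d} (hx : x ∈ D i) :
    grad (fun y => ∑ j, w j y) x = grad (w i) x := by
  refine grad_congr_of_eqOn (hD i) (fun y hy => ?_) hx
  refine Finset.sum_eq_single_of_mem i (Finset.mem_univ i) fun j _ hij => h0 j y fun hyj => ?_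
  exact Set.disjoint_left.1 (hdisj hij) hyj hy

/-- Upper bound for piecewise affine functions. -/
theorem H_le_of_isPiecewiseAffine {Ω : Set (Vec d)} (hΩ : IsOpen Ω)
    (hΩb : Bornology.IsBounded Ω) {f : Vec d → Mat m d → ℝ≥0∞}
    (hper : ∀ (ξ : Mat m d) (x : Vec d) (j : Fin d), f (x + EuclideanSpace.single j 1) ξ = f x ξ)
    {A : Mat m d → ℝ≥0} (hA : ∀ x ξ, f x ξ ≤ A ξ)
    (u : W1inf Ω m) (hu : u.IsPiecewiseAffine) (r : ℝ≥0) :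
    H f (r + u.gradNorm) u ≤ ∫⁻ x in Ω, homogBdd r f (u.grad x) := by
  obtain ⟨-, k, D, ξ, hD, hdisj, hcov, hgrad⟩ := hu
  have hΩv : volume Ω ≠ ⊤ := hΩb.measure_lt_top.ne
  have hDv : ∀ i, volume (D i) ≠ ⊤ := fun i => ne_top_of_le_ne_top hΩv (measure_mono (hD i).2.1)
  have hUΩ : (⋃ i, D i) ⊆ Ω := Set.iUnion_subset fun i => (hD i).2.1
  have hae : Ω =ᵐ[volume] ⋃ i, D i :=
    ((ae_le_set.2 hcov).antisymm (LE.le.eventuallyLE hUΩ))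
  have hsplit : ∀ F : Vec d → ℝ≥0∞, ∫⁻ x in Ω, F x = ∑ i, ∫⁻ x in D i, F x := by
    intro F
    rw [Measure.restrict_congr_set hae, lintegral_iUnion (fun i => (hD i).1.measurableSet) hdisj,
      tsum_fintype]
  refine le_of_forall_pos_le_add_mul hΩv fun δ hδ => ?_
  have hlt : ∀ i, homogBdd r f (ξ i) < homogBdd r f (ξ i) + δ := fun i =>
    ENNReal.lt_add_right (ne_top_of_le_ne_top ENNReal.coe_ne_top
      (homogBdd_le r fun x => hA x (ξ i))) (by exact_mod_cast hδ.ne')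
  choose n hn KΦ Φ hΦ hΦ0 hΦr hΦe using fun i => exists_of_homogBdd_lt (hlt i)
  choose M hM0 hM using fun i => exists_norm_le_of_eq_zero_off (hΦ i) (isBounded_cube (n i)) (hΦ0 i)
  -- Families are indexed by all real `ε`; for `ε ≤ 0` the zero function is taken and no estimate is
  -- claimed.
  have htile : ∀ (i : Fin k) (ε : ℝ), ∃ (K' : ℝ≥0) (ψ : Vec d → Vec m), LipschitzWith K' ψ ∧
      (∀ x ∉ D i, ψ x = 0) ∧ (0 < ε →
      (∀ x, ‖ψ x‖ ≤ ε * M i) ∧ (∀ᵐ x, ‖grad ψ x‖ₑ ≤ r) ∧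
      ∫⁻ x in D i, f (ε⁻¹ • x) (ξ i + grad ψ x) ≤
        volume (D i) * (homogBdd r f (ξ i) + δ) +
          A (ξ i) * volume (D i ∩ Metric.cthickening (d * (ε * n i)) (D i)ᶜ)) := by
    intro i ε
    by_cases hε : 0 < ε
    · obtain ⟨K', ψ, h1, h2, h3, h4, h5⟩ := exists_tiling (hn i) (hΦ i) (hΦ0 i) (hM i) (hΦr i)
        (hD i).1.measurableSet (hDv i) hε
      refine ⟨K', ψ, h1, h2, fun _ => ⟨h3, h4, (h5 f (ξ i) (A (ξ i)) hper fun x => hA x _).trans ?_⟩⟩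
      gcongr
      exact (hΦe i).le
    · exact ⟨0, fun _ => 0, LipschitzWith.const 0, fun _ _ => rfl, fun h => absurd h hε⟩
  choose Kψ ψ hψ hψ0 hψε using htile
  set Ψ : ℝ → Vec d → Vec m := fun ε x => ∑ i, ψ i ε x with hΨ
  have hΨL : ∀ ε, LipschitzWith (∑ i, Kψ i ε) (Ψ ε) := fun ε =>
    lipschitzWith_sum Finset.univ fun i _ => hψ i ε
  have hΨg : ∀ (ε : ℝ) (i : Fin k), ∀ x ∈ D i, grad (Ψ ε) x = grad (ψ i ε) x := fun ε i x hx =>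
    grad_sum_eq_of_disjoint (fun i => (hD i).1) hdisj (fun i => hψ0 i ε) i hx
  have hws : W1inf.WeakStarTendsto (fun ε => u.addLipschitz hΩ.measurableSet hΩb (hΨL ε)) u := by
    -- For convergence the crude gradient bound `k * r`, from summing the pieces, is enough. The
    -- sharp bound `r` follows next from the disjointness of the supports.
    refine weakStarTendsto_addLipschitz _ _ u hΨL (M := ∑ i, M i) (R := ∑ _i : Fin k, (r : ℝ))
      (fun ε hε x => ?_) fun ε hε => ?_
    · rw [Finset.mul_sum]
      exact (norm_sum_le _ _).trans (Finset.sum_le_sum fun i _ => (hψε i ε hε).1 x)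
    · have h1 : ∀ᵐ x, ∀ i, DifferentiableAt ℝ (ψ i ε) x :=
        ae_all_iff.2 fun i => (hψ i ε).ae_differentiableAt
      have h2 : ∀ᵐ x, ∀ i, ‖grad (ψ i ε) x‖ₑ ≤ r := ae_all_iff.2 fun i => (hψε i ε hε).2.1
      filter_upwards [h1, h2] with x hx1 hx2
      have e : grad (Ψ ε) x = ∑ i, grad (ψ i ε) x := by
        rw [grad_eq_of_hasFDerivAt (HasFDerivAt.fun_sum fun i _ => (hx1 i).hasFDerivAt), map_sum]
        rfl
      rw [e]
      refine (norm_sum_le _ _).trans (Finset.sum_le_sum fun i _ => ?_)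
      exact_mod_cast hx2 i
  have hbd : ∀ ε > 0, (u.addLipschitz hΩ.measurableSet hΩb (hΨL ε)).gradNorm
      ≤ r + u.gradNorm := by
    intro ε hε
    have h1 : eLpNorm (grad (Ψ ε)) ⊤ (volume.restrict Ω) ≤ r := by
      rw [eLpNorm_exponent_top]
      refine essSup_le_of_ae_le _ ?_
      rw [Measure.restrict_congr_set hae]
      change ∀ᵐ x ∂(volume.restrict (⋃ i, D i)), ‖grad (Ψ ε) x‖ₑ ≤ r
      rw [ae_restrict_iUnion_iff]
      intro i
      filter_upwards [ae_restrict_mem (hD i).1.measurableSet,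
        ae_restrict_of_ae (hψε i ε hε).2.1] with x hx hx'
      rwa [hΨg ε i x hx]
    rw [add_comm (r : ℝ≥0∞)]
    exact (eLpNorm_add_le u.memLp_grad.1 (memLp_top_grad (hΨL ε) _).1 le_top).trans
      (add_le_add le_rfl h1)
  have hen : ∀ ε > 0, energy f ε (u.addLipschitz hΩ.measurableSet hΩb (hΨL ε)) ≤
      ∑ i, (volume (D i) * (homogBdd r f (ξ i) + δ) +
        A (ξ i) * volume (D i ∩ Metric.cthickening (d * (ε * n i)) (D i)ᶜ)) := by
    intro ε hε
    rw [energy, hsplit]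
    refine Finset.sum_le_sum fun i _ => le_trans (le_of_eq ?_) (hψε i ε hε).2.2
    refine lintegral_congr_ae ?_
    filter_upwards [hgrad i, ae_restrict_mem (hD i).1.measurableSet] with x hx hxD
    simp only [W1inf.addLipschitz, Pi.add_apply, hx, hΨg ε i x hxD]
  have hlim : Tendsto (fun ε : ℝ => ∑ i, (volume (D i) * (homogBdd r f (ξ i) + δ) +
        A (ξ i) * volume (D i ∩ Metric.cthickening (d * (ε * n i)) (D i)ᶜ))) (𝓝[>] 0)
      (𝓝 (∑ i, (volume (D i) * (homogBdd r f (ξ i) + δ) + A (ξ i) * 0))) := by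
    refine tendsto_finsetSum _ fun i _ => ?_
    refine tendsto_const_nhds.add (ENNReal.Tendsto.const_mul ?_ (Or.inr ENNReal.coe_ne_top))
    refine (tendsto_volume_layer (hD i).1 (hDv i)).comp ?_
    refine tendsto_nhdsWithin_of_tendsto_nhds ?_
    have : Continuous fun ε : ℝ => (d : ℝ) * (ε * n i) := by fun_prop
    simpa using this.tendsto 0
  calc H f (r + u.gradNorm) u
      ≤ limsup (fun ε => energy f ε (u.addLipschitz hΩ.measurableSet hΩb (hΨL ε))) (𝓝[>] 0) :=
        iInf_le_of_le _ (iInf₂_le_of_le hws hbd le_rfl)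
    _ ≤ ∑ i, (volume (D i) * (homogBdd r f (ξ i) + δ) + A (ξ i) * 0) := by
        rw [← hlim.limsup_eq]
        refine limsup_le_limsup ?_
        filter_upwards [self_mem_nhdsWithin] with ε hε using hen ε hε
    _ = (∫⁻ x in Ω, homogBdd r f (u.grad x)) + δ * volume Ω := by
        have e1 : δ * volume Ω = ∑ i, δ * volume (D i) := by
          have := hsplit fun _ => δ
          simpa using this
        rw [e1, hsplit, ← Finset.sum_add_distrib]
        refine Finset.sum_congr rfl fun i _ => ?_
        have e2 : ∫⁻ x in D i, homogBdd r f (u.grad x) = homogBdd r f (ξ i) * volume (D i) := by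
          rw [← setLIntegral_const]
          refine lintegral_congr_ae ?_
          filter_upwards [hgrad i] with x hx
          rw [hx]
        rw [e2]; ring

/-! ### Upper semicontinuity of the homogenized density -/

lemma homog_le_of_le {f : Vec d → Mat m d → ℝ≥0∞} {ξ : Mat m d} {A : ℝ≥0∞}
    (hA : ∀ x, f x ξ ≤ A) : homog f ξ ≤ A := by
  rw [homog_eq_homogBdd_top]; exact homogBdd_le ⊤ hA

/-- The estimate used after a cutoff: off the layer `L` the integrands are compared, inside it only
the growth bound `B` is used. -/
lemma lintegral_le_add_layer {D L : Set (Vec d)} (hD : MeasurableSet D) (hL : MeasurableSet L)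
    {F F' : Vec d → ℝ≥0∞} {B : ℝ≥0∞} (h1 : ∀ᵐ x, x ∈ D → x ∉ L → F x ≤ F' x)
    (h2 : ∀ᵐ x, x ∈ D → F x ≤ B) :
    ∫⁻ x in D, F x ≤ (∫⁻ x in D, F' x) + B * volume (D ∩ L) := by
  rw [← lintegral_inter_add_sdiff F D hL, add_comm]
  refine add_le_add ?_ ?_
  · refine le_trans ?_ (lintegral_mono_set (Set.sdiff_subset (s := D) (t := L)))
    refine lintegral_mono_ae ((ae_restrict_iff' (hD.diff hL)).2 ?_)
    filter_upwards [h1] with x hx hxD using hx hxD.1 hxD.2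
  · rw [← setLIntegral_const]
    refine lintegral_mono_ae ((ae_restrict_iff' (hD.inter hL)).2 ?_)
    filter_upwards [h2] with x hx hxD using hx hxD.1

/-- The cutoff is built from the distance to `Dᶜ`, which must therefore be nonempty; in dimension
zero it could be empty. -/
lemma compl_nonempty_of_isBounded (hd : 1 ≤ d) {D : Set (Vec d)} (hD : Bornology.IsBounded D) :
    Dᶜ.Nonempty := by
  have : Nonempty (Fin d) := ⟨⟨0, hd⟩⟩
  rw [Set.nonempty_compl]
  rintro rfl
  exact NormedSpace.unbounded_univ ℝ (Vec d) hD

/-- Linear growth bound. -/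
def growth (c : ℝ) (B : ℝ) : ℝ≥0 := Real.toNNReal (c * (1 + B))

lemma le_growth {f : Vec d → Mat m d → ℝ≥0∞} {c : ℝ} (hc : 0 < c)
    (hf : ∀ x ξ, f x ξ ≤ ENNReal.ofReal (c * (1 + ‖ξ‖))) {ξ : Mat m d} {B : ℝ} (hB : ‖ξ‖ ≤ B)
    (x : Vec d) : f x ξ ≤ growth c B := by
  refine (hf x ξ).trans ?_
  rw [ENNReal.ofReal, growth, ENNReal.coe_le_coe]
  gcongr

/-- A near-optimal competitor for `ξ` becomes one for a nearby `ζ` on adding the linear map of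
gradient `ξ - ζ`, cut off near the boundary of the cube. The total gradient is unchanged off a thin
layer, where linear growth controls the energy. In particular `homog f` is Borel even though it is
an infimum over an uncountable set. -/
theorem upperSemicontinuous_homog (hd : 1 ≤ d) {f : Vec d → Mat m d → ℝ≥0∞} {c : ℝ} (hc : 0 < c)
    (hf : ∀ x ξ, f x ξ ≤ ENNReal.ofReal (c * (1 + ‖ξ‖))) : UpperSemicontinuous (homog f) := by
  intro ξ a ha
  rw [homog_eq_homogBdd_top] at ha
  obtain ⟨n, hn, K, Φ, hΦ, hΦ0, -, hE⟩ := exists_of_homogBdd_lt ha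
  set Y := cube d n with hY
  have hYv : volume Y ≠ ⊤ := (isBounded_cube n).measure_lt_top.ne
  set B : ℝ := ‖ξ‖ + 1 + frobConst m d * (K + 1) with hB
  have hN : ((n : ℝ≥0∞) ^ d)⁻¹ ≠ ⊤ :=
    ENNReal.inv_ne_top.2 (pow_ne_zero _ (by exact_mod_cast (by omega : n ≠ 0)))
  -- The layer width is fixed before `ζ`, so that the Lipschitz constant of the cut-off linear map
  -- tends to zero as `ζ → ξ`.
  obtain ⟨s, hs, hsE⟩ : ∃ s : ℝ≥0, 0 < s ∧ ((n : ℝ≥0∞) ^ d)⁻¹ *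
      ((∫⁻ x in Y, f x (ξ + grad Φ x)) + growth c B * volume (Y ∩ Metric.cthickening s Yᶜ)) < a := by
    have h1 : Tendsto (fun s : ℝ => ((n : ℝ≥0∞) ^ d)⁻¹ * ((∫⁻ x in Y, f x (ξ + grad Φ x)) +
        growth c B * volume (Y ∩ Metric.cthickening s Yᶜ))) (𝓝[>] 0)
        (𝓝 (((n : ℝ≥0∞) ^ d)⁻¹ * ((∫⁻ x in Y, f x (ξ + grad Φ x)) + growth c B * 0))) := by
      refine ENNReal.Tendsto.const_mul (tendsto_const_nhds.add
        (ENNReal.Tendsto.const_mul ?_ (Or.inr ENNReal.coe_ne_top))) (Or.inr hN)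
      exact tendsto_nhdsWithin_of_tendsto_nhds (tendsto_volume_layer (isOpen_cube n) hYv)
    rw [mul_zero, add_zero] at h1
    obtain ⟨s, hs, hs0⟩ := ((h1.eventually (gt_mem_nhds hE)).and self_mem_nhdsWithin).exists
    exact ⟨⟨s, le_of_lt hs0⟩, hs0, hs⟩
  have hlim : Tendsto (fun ζ : Mat m d => ‖matEquiv.symm (ξ - ζ)‖₊ +
      (‖matEquiv.symm (ξ - ζ)‖₊ * (d * n)) / s) (𝓝 ξ) (𝓝 0) := by
    have : Continuous (fun ζ : Mat m d => ‖matEquiv.symm (ξ - ζ)‖₊ +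
      (‖matEquiv.symm (ξ - ζ)‖₊ * (d * n)) / s) := by
      have h : Continuous fun ζ : Mat m d => matEquiv.symm (ξ - ζ) :=
        matEquiv.symm.continuous.comp (by fun_prop)
      fun_prop
    simpa using this.tendsto ξ
  have hnear : ∀ᶠ ζ in 𝓝 ξ, ‖ζ‖ < ‖ξ‖ + 1 :=
    continuous_norm.continuousAt.eventually (gt_mem_nhds (by linarith))
  filter_upwards [hlim.eventually (gt_mem_nhds one_pos), hnear] with ζ hζ hζn
  set k := ‖matEquiv.symm (ξ - ζ)‖₊ with hk
  have hv := lipschitzWith_aff (ξ - ζ) (0 : Vec d) (0 : Vec m)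
  obtain ⟨p, hp, hp0, hpe⟩ := exists_cutoff (compl_nonempty_of_isBounded hd (isBounded_cube n)) hv
    (M := k * (d * n)) hs (fun x hx => by
      have h1 := hv.dist_le_mul x 0
      have h2 : aff (ξ - ζ) (0 : Vec d) (0 : Vec m) 0 = 0 := by simp [aff]
      rw [h2, dist_zero_right] at h1
      refine h1.trans ?_
      rw [NNReal.coe_mul]
      refine mul_le_mul_of_nonneg_left ?_ k.2
      rw [cube_eq_box] at hx
      exact box_subset_closedBall 0 (Nat.cast_nonneg n) hx)
  have hp1 : LipschitzWith 1 p := hp.weaken hζ.le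
  have hV : LipschitzWith (K + 1) (fun x => Φ x + p x) := hΦ.add hp1
  refine lt_of_le_of_lt ((homog_le ζ hn hV fun x hx => ?_).trans ?_) hsE
  · rw [hΦ0 x hx, hp0 x hx, add_zero]
  gcongr
  refine lintegral_le_add_layer (isOpen_cube n).measurableSet
    Metric.isClosed_cthickening.measurableSet ?_ ?_
  · filter_upwards [hΦ.ae_differentiableAt (μ := volume), hp1.ae_differentiableAt (μ := volume)]
      with x hx hx' _ hxL
    rw [grad_add hx hx', grad_congr_of_eqOn Metric.isClosed_cthickening.isOpen_compl
      (w := p) (fun y hy => hpe y hy) hxL, grad_aff]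
    refine le_of_eq ?_
    congr 1
    abel
  · refine Eventually.of_forall fun x _ => le_growth hc hf ?_ x
    refine (norm_add_le _ _).trans ?_
    have := norm_grad_le hV x
    push_cast at this
    linarith

/-! ### Local replacement on balls and quasiconvexity -/

/-- By homogeneity the shell occupies the fraction `1 - (1 - τ)^d` of the ball, so one `τ` serves
every centre and radius. -/
lemma exists_volume_ball_shell_le (d : ℕ) {δ : ℝ≥0} (hδ : 0 < δ) :
    ∃ τ : ℝ≥0, 0 < τ ∧ τ < 1 ∧ ∀ (x : Vec d) (ρ : ℝ), 0 < ρ →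
      volume (Metric.ball x ρ \ Metric.ball x ((1 - τ) * ρ)) ≤ δ * volume (Metric.ball x ρ) := by
  have hlim : Tendsto (fun τ : ℝ => 1 - (1 - τ) ^ d) (𝓝[>] 0) (𝓝 (1 - (1 - 0) ^ d)) := by
    refine tendsto_nhdsWithin_of_tendsto_nhds (Continuous.tendsto ?_ 0)
    fun_prop
  have hlt : (1 : ℝ) - (1 - 0) ^ d < δ := by simpa using hδ
  obtain ⟨τ, h1, h2⟩ := ((hlim.eventually (gt_mem_nhds hlt)).and
    (Ioo_mem_nhdsGT (zero_lt_one' ℝ))).exists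
  refine ⟨⟨τ, h2.1.le⟩, h2.1, h2.2, fun x ρ hρ => ?_⟩
  change volume (Metric.ball x ρ \ Metric.ball x ((1 - τ) * ρ)) ≤ δ * volume (Metric.ball x ρ)
  have h3 : 0 < 1 - τ := by linarith [h2.2]
  have hsub : Metric.ball x ((1 - τ) * ρ) ⊆ Metric.ball x ρ :=
    Metric.ball_subset_ball (by nlinarith [h2.1])
  have hin : volume (Metric.ball x ((1 - τ) * ρ)) =
      ENNReal.ofReal ((1 - τ) ^ d) * volume (Metric.ball x ρ) := by
    rw [Measure.addHaar_ball_mul_of_pos volume x h3, finrank_euclideanSpace, Fintype.card_fin,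
      Measure.addHaar_ball_center volume x ρ]
  have hfin : volume (Metric.ball x ρ) ≠ ⊤ := measure_ball_lt_top.ne
  rw [measure_sdiff hsub measurableSet_ball.nullMeasurableSet measure_ball_lt_top.ne, hin,
    tsub_le_iff_right, ← add_mul]
  refine le_mul_of_one_le_left zero_le ?_
  rw [← ENNReal.ofReal_coe_nnreal, ← ENNReal.ofReal_add (by positivity) (by positivity),
    ENNReal.one_le_ofReal]
  linarith

/-- On a ball where `w` is nearly affine, `w` may be modified so that its energy is close to that
of the homogenized density. -/
lemma exists_ball_replacement (hd : 1 ≤ d) {f : Vec d → Mat m d → ℝ≥0∞}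
    (hper : ∀ (ξ : Mat m d) (x : Vec d) (j : Fin d), f (x + EuclideanSpace.single j 1) ξ = f x ξ)
    {c : ℝ} (hc : 0 < c) (hf : ∀ x ξ, f x ξ ≤ ENNReal.ofReal (c * (1 + ‖ξ‖)))
    (ξ : Mat m d) {w : Vec d → Vec m} {K : ℝ≥0} (hw : LipschitzWith K w)
    {δ τ : ℝ≥0} (hδ : 0 < δ) (hτ0 : 0 < τ) (hτ1 : τ < 1)
    (hτ : ∀ (x : Vec d) (ρ : ℝ), 0 < ρ →
      volume (Metric.ball x ρ \ Metric.ball x ((1 - τ) * ρ)) ≤ δ * volume (Metric.ball x ρ))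
    {x₀ : Vec d} {ρ : ℝ} (hρ : 0 < ρ)
    (hx₀ : ∀ y ∈ Metric.closedBall x₀ ρ, ‖w y - aff (grad w x₀) x₀ (w x₀) y‖ ≤ τ * ρ) :
    ∀ᶠ ε in 𝓝[>] (0 : ℝ), ∃ (K' : ℝ≥0) (q : Vec d → Vec m), LipschitzWith K' q ∧
      (∀ y ∉ Metric.ball x₀ ρ, q y = 0) ∧
      ∫⁻ y in Metric.ball x₀ ρ, f (ε⁻¹ • y) (ξ + grad (fun z => w z + q z) y) ≤
        volume (Metric.ball x₀ ρ) * (homog f (ξ + grad w x₀) +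
          δ * (2 + growth c (‖ξ‖ + frobConst m d * (3 * K + 1)))) := by
  set ζ := grad w x₀ with hζ
  set l : Vec d → Vec m := aff ζ x₀ (w x₀) with hl
  set Bt := Metric.ball x₀ ρ with hBt
  set D := Metric.ball x₀ ((1 - τ) * ρ) with hD
  set G := growth c (‖ξ‖ + frobConst m d * (3 * K + 1)) with hG
  have hτ1' : (τ : ℝ) < 1 := hτ1
  have hDB : D ⊆ Bt := Metric.ball_subset_ball (by nlinarith [τ.2])
  have hlK : LipschitzWith K l := by
    refine (lipschitzWith_aff ζ x₀ (w x₀)).weaken ?_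
    rw [hζ, grad, ContinuousLinearEquiv.symm_apply_apply]
    exact norm_fderiv_le_of_lipschitz ℝ hw
  have hs : 0 < τ * Real.toNNReal ρ := by positivity
  -- Cut off `l - w`, so that `w + p` is affine on the inner ball `D` and equals `w` outside `Bt`.
  -- The layer width equals the bound `τ * ρ` for `l - w`, whence the Lipschitz constant `2K + 1` of
  -- `p`.
  obtain ⟨p, hp, hp0, hpe⟩ := exists_cutoff
    (compl_nonempty_of_isBounded hd (D := Bt) Metric.isBounded_ball) (hlK.sub hw)
    (M := τ * Real.toNNReal ρ) hs (fun y hy => by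
      have := hx₀ y (Metric.ball_subset_closedBall hy)
      rw [norm_sub_rev] at this
      simpa [Real.coe_toNNReal _ hρ.le] using this)
  rw [div_self hs.ne'] at hp
  have hin : ∀ y ∈ D, w y + p y = l y := by
    intro y hy
    rw [hpe y fun hyc => ?_]
    · simp
    · rw [Metric.mem_cthickening_iff, ENNReal.le_ofReal_iff_toReal_le
        (Metric.infEDist_ne_top (compl_nonempty_of_isBounded hd Metric.isBounded_ball))
        (by positivity)] at hyc
      have h1 : ρ - dist y x₀ ≤ Metric.infDist y Btᶜ := by
        refine (Metric.le_infDist (compl_nonempty_of_isBounded hd Metric.isBounded_ball)).2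
          fun z hz => ?_
        have h2 : ρ ≤ dist z x₀ := by simpa [hBt] using hz
        have h3 := dist_triangle_left z x₀ y
        linarith
      have h4 : dist y x₀ < (1 - τ) * ρ := hy
      have h5 : Metric.infDist y Btᶜ ≤ τ * ρ := by
        have := hyc
        push_cast [Real.coe_toNNReal _ hρ.le] at this
        exact this
      linarith
  have hlt : homogBdd ⊤ f (ξ + ζ) < homog f (ξ + ζ) + δ := by
    rw [← homog_eq_homogBdd_top]
    exact ENNReal.lt_add_right (ne_top_of_le_ne_top ENNReal.coe_ne_top
      (homog_le_of_le fun x => le_growth hc hf le_rfl x)) (by exact_mod_cast hδ.ne')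
  obtain ⟨n, hn, KΦ, Φ, hΦ, hΦ0, hΦr, hΦe⟩ := exists_of_homogBdd_lt hlt
  obtain ⟨M, hM0, hM⟩ := exists_norm_le_of_eq_zero_off hΦ (isBounded_cube n) hΦ0
  have hBpos : 0 < volume Bt := Metric.measure_ball_pos volume x₀ hρ
  have hBfin : volume Bt ≠ ⊤ := measure_ball_lt_top.ne
  have hlim : Tendsto (fun ε : ℝ => growth c ‖ξ + ζ‖ *
      volume (D ∩ Metric.cthickening (d * (ε * n)) Dᶜ)) (𝓝[>] 0) (𝓝 (growth c ‖ξ + ζ‖ * 0)) := by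
    refine ENNReal.Tendsto.const_mul ?_ (Or.inr ENNReal.coe_ne_top)
    refine (tendsto_volume_layer Metric.isOpen_ball measure_ball_lt_top.ne).comp ?_
    refine tendsto_nhdsWithin_of_tendsto_nhds ?_
    have : Continuous fun ε : ℝ => (d : ℝ) * (ε * n) := by fun_prop
    simpa using this.tendsto 0
  have hδB : (growth c ‖ξ + ζ‖ : ℝ≥0∞) * 0 < δ * volume Bt := by
    rw [mul_zero]
    exact ENNReal.mul_pos (by exact_mod_cast hδ.ne') hBpos.ne'
  filter_upwards [hlim.eventually (gt_mem_nhds hδB), self_mem_nhdsWithin] with ε hε hε0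
  obtain ⟨Kψ, ψ, hψ, hψ0, -, -, hψe⟩ := exists_tiling hn hΦ hΦ0 hM hΦr
    (D := D) measurableSet_ball measure_ball_lt_top.ne hε0
  refine ⟨_, fun y => p y + ψ y, hp.add hψ, fun y hy => ?_, ?_⟩
  · simp only [hp0 y hy, hψ0 y fun h => hy (hDB h), add_zero]
  have hwp : LipschitzWith (K + (K + K + 1)) (fun y => w y + p y) := hw.add hp
  have hg : ∀ᵐ y, grad (fun z => w z + (p z + ψ z)) y =
      grad (fun z => w z + p z) y + grad ψ y := by
    filter_upwards [hwp.ae_differentiableAt (μ := volume), hψ.ae_differentiableAt (μ := volume)]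
      with y h1 h2
    rw [← grad_add h1 h2]
    congr 1 with z : 1
    rw [add_assoc]
  have hI1 : ∫⁻ y in D, f (ε⁻¹ • y) (ξ + grad (fun z => w z + (p z + ψ z)) y) ≤
      volume Bt * (homog f (ξ + ζ) + δ) + δ * volume Bt := by
    have e : ∫⁻ y in D, f (ε⁻¹ • y) (ξ + grad (fun z => w z + (p z + ψ z)) y) =
        ∫⁻ y in D, f (ε⁻¹ • y) (ξ + ζ + grad ψ y) := by
      refine lintegral_congr_ae ((ae_restrict_iff' measurableSet_ball).2 ?_)
      filter_upwards [hg] with y hy hyD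
      rw [hy, grad_congr_of_eqOn Metric.isOpen_ball hin hyD, hl, grad_aff, add_assoc]
    rw [e]
    refine (hψe f (ξ + ζ) (growth c ‖ξ + ζ‖) hper fun x => le_growth hc hf le_rfl x).trans ?_
    exact add_le_add (mul_le_mul' (measure_mono hDB) hΦe.le) hε.le
  -- On the shell the tiling vanishes; what remains is `w + p`, of Lipschitz constant `3K + 1`, on a
  -- set of relative volume at most `δ`.
  have hI2 : ∫⁻ y in Bt \ D, f (ε⁻¹ • y) (ξ + grad (fun z => w z + (p z + ψ z)) y) ≤
      G * (δ * volume Bt) := by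
    calc _ ≤ ∫⁻ _y in Bt \ D, (G : ℝ≥0∞) := by
          refine lintegral_mono_ae ((ae_restrict_iff'
            (measurableSet_ball.diff measurableSet_ball)).2 ?_)
          filter_upwards [hg, grad_ae_eq_zero ((convex_ball x₀ _).addHaar_frontier volume) hψ0]
            with y hy hyψ hyD
          rw [hy, hyψ hyD.2, add_zero]
          refine le_growth hc hf ((norm_add_le _ _).trans ?_) _
          have := norm_grad_le hwp y
          push_cast at this
          have e : (K : ℝ) + (K + K + 1) = 3 * K + 1 := by ring
          rw [e] at this
          linarith
      _ = G * volume (Bt \ D) := by rw [setLIntegral_const]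
      _ ≤ _ := by gcongr; exact hτ x₀ ρ hρ
  rw [← lintegral_inter_add_sdiff _ Bt (measurableSet_ball : MeasurableSet D),
    Set.inter_eq_right.2 hDB]
  refine (add_le_add hI1 hI2).trans (le_of_eq ?_)
  ring

/-- A finite Vitali covering by disjoint balls of small prescribed radii. -/
lemma exists_finite_disjoint_balls {Y : Set (Vec d)} (hY : IsOpen Y) (hYv : volume Y ≠ ⊤)
    {P : Vec d → ℝ → Prop} (hP : ∀ᵐ x, x ∈ Y → ∀ᶠ r in 𝓝[>] 0, P x r) {δ : ℝ≥0∞} (hδ : δ ≠ 0) :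
    ∃ (ι : Type) (_ : Fintype ι) (c : ι → Vec d) (ρ : ι → ℝ),
      (∀ i, 0 < ρ i ∧ Metric.closedBall (c i) (ρ i) ⊆ Y ∧ P (c i) (ρ i)) ∧
      (Pairwise fun i j =>
        Disjoint (Metric.closedBall (c i) (ρ i)) (Metric.closedBall (c j) (ρ j))) ∧
      volume (Y \ ⋃ i, Metric.closedBall (c i) (ρ i)) ≤ δ := by
  rcases eq_or_ne (volume Y) 0 with hY0 | hY0
  · refine ⟨PEmpty, inferInstance, fun i => i.elim, fun i => i.elim, fun i => i.elim,
      fun i => i.elim, ?_⟩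
    exact (measure_mono Set.sdiff_subset).trans (hY0.le.trans zero_le)
  set s : Set (Vec d) := {x | x ∈ Y ∧ ∀ᶠ r in 𝓝[>] 0, P x r} with hs
  have hsY : volume (Y \ s) = 0 := by
    refine measure_mono_null (fun x hx => ?_) (ae_iff.1 hP)
    simp only [Set.mem_ofPred_eq, Classical.not_imp]
    exact ⟨hx.1, fun h => hx.2 ⟨hx.1, h⟩⟩
  -- Besicovitch covering of the good points by disjoint closed balls of admissible radii. The bound
  -- 1 on the radii is arbitrary.
  obtain ⟨t, r, htc, hts, htr, htv, htd⟩ := Besicovitch.exists_disjoint_closedBall_covering_ae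
    (volume : Measure (Vec d)) (fun x => {r | Metric.closedBall x r ⊆ Y ∧ P x r}) s
    (fun x hx η hη => by
      have h1 : ∀ᶠ r in 𝓝[>] (0 : ℝ), Metric.closedBall x r ⊆ Y := by
        obtain ⟨r₀, hr₀, hr⟩ := Metric.nhds_basis_closedBall.mem_iff.1 (hY.mem_nhds hx.1)
        filter_upwards [Ioo_mem_nhdsGT hr₀] with r hr'
        exact (Metric.closedBall_subset_closedBall hr'.2.le).trans hr
      obtain ⟨r, hr⟩ := ((h1.and hx.2).and (Ioo_mem_nhdsGT hη)).exists
      exact ⟨r, hr.1, hr.2⟩) (fun _ => 1) (fun _ _ => one_pos)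
  have hYU : volume Y ≤ volume (⋃ x ∈ t, Metric.closedBall x (r x)) := by
    refine measure_mono_ae ?_
    filter_upwards [compl_mem_ae_iff.2 hsY, compl_mem_ae_iff.2 htv] with x h1 h2 hx
    by_contra h3
    have h4 : x ∈ s := by
      by_contra h4
      exact h1 ⟨hx, h4⟩
    exact h2 ⟨h4, h3⟩
  rw [measure_biUnion htc htd fun x _ => Metric.isClosed_closedBall.measurableSet,
    ENNReal.tsum_eq_iSup_sum] at hYU
  -- The disjoint balls have total volume at least that of `Y`, so a finite subfamily already
  -- exceeds the volume of `Y` minus `δ`.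
  obtain ⟨F, hF⟩ := lt_iSup_iff.1 ((ENNReal.sub_lt_self hYv hY0 hδ).trans_le hYU)
  refine ⟨F.map (Function.Embedding.subtype _), inferInstance, fun i => i, fun i => r i, ?_, ?_, ?_⟩
  · rintro ⟨i, hi⟩
    obtain ⟨j, -, rfl⟩ := Finset.mem_map.1 hi
    have := htr j j.2
    exact ⟨this.2.1, this.1⟩
  · rintro ⟨i, hi⟩ ⟨j, hj⟩ hij
    obtain ⟨i, -, rfl⟩ := Finset.mem_map.1 hi
    obtain ⟨j, -, rfl⟩ := Finset.mem_map.1 hj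
    exact htd i.2 j.2 fun h => hij (Subtype.ext h)
  · have hUe : (⋃ i : F.map (Function.Embedding.subtype _), Metric.closedBall (i : Vec d) (r i)) =
        ⋃ (x : t) (_ : x ∈ F), Metric.closedBall (x : Vec d) (r x) := by
      ext y
      simp
    have hsub : (⋃ (x : t) (_ : x ∈ F), Metric.closedBall (x : Vec d) (r x)) ⊆ Y :=
      Set.iUnion₂_subset fun x _ => (htr x x.2).1.1
    have hsum : volume (⋃ (x : t) (_ : x ∈ F), Metric.closedBall (x : Vec d) (r x)) =
        ∑ x ∈ F, volume (Metric.closedBall (x : Vec d) (r x)) :=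
      measure_biUnion_finset
        (fun (x : t) _ (y : t) _ hxy => htd x.2 y.2 fun h => hxy (Subtype.ext h))
        fun x _ => Metric.isClosed_closedBall.measurableSet
    rw [hUe, measure_sdiff hsub
      (Finset.measurableSet_biUnion F fun x _ =>
        Metric.isClosed_closedBall.measurableSet).nullMeasurableSet
      (ne_top_of_le_ne_top hYv (measure_mono hsub)), hsum]
    rw [tsub_le_iff_left]
    exact tsub_le_iff_right.1 hF.le

lemma ball_ae_eq_closedBall (x : Vec d) {ρ : ℝ} (hρ : 0 < ρ) :
    (Metric.ball x ρ : Set (Vec d)) =ᵐ[volume] Metric.closedBall x ρ := by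
  refine (LE.le.eventuallyLE Metric.ball_subset_closedBall).antisymm (ae_le_set.2 ?_)
  rw [Metric.closedBall_sdiff_ball]
  exact Measure.addHaar_sphere_of_ne_zero volume x hρ.ne'

/-- Makes the error term of `volume_mul_homog_le` vanish as `ε → 0`. -/
lemma tendsto_volume_enlarged_cube (A : ℝ≥0) {ρ : ℝ} :
    Tendsto (fun ε : ℝ => A * (ENNReal.ofReal (ρ + 2 * ε) ^ d - ENNReal.ofReal ρ ^ d))
      (𝓝[>] 0) (𝓝 0) := by
  have h1 : Tendsto (fun ε : ℝ => ENNReal.ofReal (ρ + 2 * ε) ^ d) (𝓝[>] 0)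
      (𝓝 (ENNReal.ofReal ρ ^ d)) := by
    refine tendsto_nhdsWithin_of_tendsto_nhds ?_
    have : Continuous fun ε : ℝ => ENNReal.ofReal (ρ + 2 * ε) ^ d :=
      (ENNReal.continuous_pow d).comp (ENNReal.continuous_ofReal.comp (by fun_prop))
    simpa using this.tendsto 0
  have h2 := ENNReal.Tendsto.sub h1 (tendsto_const_nhds (x := ENNReal.ofReal ρ ^ d))
    (Or.inl (by finiteness))
  have h3 := ENNReal.Tendsto.const_mul (a := (A : ℝ≥0∞)) h2 (Or.inr ENNReal.coe_ne_top)
  simpa using h3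

/-- The substantive half of quasiconvexity. The function `w` is modified on finitely many balls into
a competitor `V` whose energy at one small scale `ε` is close to the right-hand side; as `V`
vanishes off the unit cube, `volume_mul_homog_le` bounds `homog f ξ` by that energy. -/
theorem homog_le_lintegral_homog (hd : 1 ≤ d) {f : Vec d → Mat m d → ℝ≥0∞}
    (hper : ∀ (ξ : Mat m d) (x : Vec d) (j : Fin d), f (x + EuclideanSpace.single j 1) ξ = f x ξ)
    {c : ℝ} (hc : 0 < c) (hf : ∀ x ξ, f x ξ ≤ ENNReal.ofReal (c * (1 + ‖ξ‖)))
    (ξ : Mat m d) {w : Vec d → Vec m} {K : ℝ≥0} (hw : LipschitzWith K w)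
    (h0 : ∀ x ∉ cube d 1, w x = 0) :
    homog f ξ ≤ ∫⁻ x in cube d 1, homog f (ξ + grad w x) := by
  set G := growth c (‖ξ‖ + frobConst m d * (3 * K + 1)) with hG
  set Y := cube d 1 with hY
  have hYo : IsOpen Y := isOpen_cube 1
  have hYv : volume Y = 1 := by rw [hY, volume_cube]; simp
  set g : Vec d → ℝ≥0∞ := Y.indicator fun x => homog f (ξ + grad w x) with hg
  have hgm : Measurable g :=
    ((upperSemicontinuous_homog hd hc hf).measurable.comp
      ((measurable_grad w).const_add ξ)).indicator hYo.measurableSet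
  have hgY : ∫⁻ x, g x = ∫⁻ x in Y, homog f (ξ + grad w x) :=
    lintegral_indicator hYo.measurableSet _
  have hfin : ∀ ζ, homog f ζ ≠ ⊤ := fun ζ => ne_top_of_le_ne_top ENNReal.coe_ne_top
    (homog_le_of_le fun x => le_growth hc hf le_rfl x)
  have hint : ∫⁻ x, g x ≠ ⊤ := by
    rw [hgY]
    refine ne_top_of_le_ne_top (b := ∫⁻ _x in Y, (G : ℝ≥0∞)) ?_ (lintegral_mono fun x => ?_)
    · rw [setLIntegral_const, hYv, mul_one]; exact ENNReal.coe_ne_top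
    · refine homog_le_of_le fun y => le_growth hc hf ((norm_add_le _ _).trans ?_) y
      have h1 := norm_grad_le hw x
      have h2 : frobConst m d * K ≤ frobConst m d * (3 * K + 1) :=
        mul_le_mul_of_nonneg_left (by linarith [K.2]) frobConst_nonneg
      linarith
  -- The total error, in units of `δ`: `2 + G` from the replacement on the balls, `1` from Lebesgue
  -- differentiation, `G` from the part of the cube left uncovered, `1` from the enlarged cube.
  refine le_of_forall_pos_le_add_mul (V := 4 + 2 * G) (by finiteness) fun δ hδ => ?_
  have hδ' : (δ : ℝ≥0∞) ≠ 0 := by exact_mod_cast hδ.ne'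
  obtain ⟨τ, hτ0, hτ1, hτ⟩ := exists_volume_ball_shell_le d hδ
  have hgood : ∀ᵐ x, x ∈ Y → ∀ᶠ r in 𝓝[>] (0 : ℝ),
      (∀ y ∈ Metric.closedBall x r, ‖w y - aff (grad w x) x (w x) y‖ ≤ τ * r) ∧
      volume (Metric.closedBall x r) * homog f (ξ + grad w x) ≤
        (∫⁻ y in Metric.closedBall x r, g y) + δ * volume (Metric.closedBall x r) := by
    filter_upwards [hw.ae_differentiableAt (μ := volume),
      (Besicovitch.vitaliFamily (volume : Measure (Vec d))).ae_tendsto_lintegral_div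
        hgm.aemeasurable hint] with x hx1 hx2 hxY
    have hgx : g x = homog f (ξ + grad w x) := Set.indicator_of_mem hxY _
    have h1 := (hx2.comp (Besicovitch.tendsto_filterAt volume x)).add_const (δ : ℝ≥0∞)
    have h2 : g x < g x + δ := ENNReal.lt_add_right (by rw [hgx]; exact hfin _) hδ'
    have h3 := hx1.hasFDerivAt.isLittleO.def (c := (τ : ℝ)) (by exact_mod_cast hτ0)
    obtain ⟨r₀, hr₀, hr₀'⟩ := Metric.eventually_nhds_iff_ball.1 h3
    filter_upwards [h1.eventually (lt_mem_nhds h2), Ioo_mem_nhdsGT hr₀] with r hr hrr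
    constructor
    · intro y hy
      have h4 := hr₀' y (Metric.closedBall_subset_ball hrr.2 hy)
      have h5 : aff (grad w x) x (w x) y = w x + fderiv ℝ w x (y - x) := by
        rw [aff, grad, ContinuousLinearEquiv.symm_apply_apply]
      rw [h5, ← sub_sub]
      refine h4.trans ?_
      gcongr
      rw [← dist_eq_norm]; exact hy
    · have hpos : volume (Metric.closedBall x r) ≠ 0 :=
        (Metric.measure_closedBall_pos volume x hrr.1).ne'
      have hft : volume (Metric.closedBall x r) ≠ ⊤ := measure_closedBall_lt_top.ne
      rw [← hgx]
      calc volume (Metric.closedBall x r) * g x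
          ≤ volume (Metric.closedBall x r) *
            ((∫⁻ y in Metric.closedBall x r, g y) / volume (Metric.closedBall x r) + δ) := by
            gcongr; exact hr.le
        _ = _ := by rw [mul_add, ENNReal.mul_div_cancel hpos hft, mul_comm (δ : ℝ≥0∞)]
  obtain ⟨ι, _, a, ρ, hball, hdisj, hrest⟩ := exists_finite_disjoint_balls hYo
    (by rw [hYv]; exact ENNReal.one_ne_top) hgood hδ'
  have hrep := fun i => exists_ball_replacement hd hper hc hf ξ hw hδ hτ0 hτ1 hτ (hball i).1
    (hball i).2.2.1
  have hsmall : ∀ᶠ ε in 𝓝[>] (0 : ℝ), (growth c ‖ξ‖ : ℝ≥0∞) *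
      (ENNReal.ofReal (1 + 2 * ε) ^ d - ENNReal.ofReal 1 ^ d) < δ :=
    (tendsto_volume_enlarged_cube (growth c ‖ξ‖)).eventually
      (gt_mem_nhds (by exact_mod_cast hδ))
  -- Since the balls are finitely many, one scale `ε` works for all of them.
  obtain ⟨ε, ⟨hε, hεs⟩, hε0⟩ := (((eventually_all.2 hrep).and hsmall).and
    self_mem_nhdsWithin).exists
  choose Kq q hq hq0 hqe using hε
  set V : Vec d → Vec m := fun x => w x + ∑ i, q i x with hV
  have hVl : LipschitzWith (K + ∑ i, Kq i) V :=
    hw.add (lipschitzWith_sum Finset.univ fun i _ => hq i)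
  have hbY : ∀ i, Metric.ball (a i) (ρ i) ⊆ Y := fun i =>
    Metric.ball_subset_closedBall.trans (hball i).2.1
  have hV0 : ∀ x ∉ box (0 : Vec d) 1, V x = 0 := by
    intro x hx
    have hx' : x ∉ Y := by rw [hY, cube_eq_box]; simpa using hx
    simp only [hV, h0 x hx', zero_add]
    exact Finset.sum_eq_zero fun i _ => hq0 i x fun h => hx' (hbY i h)
  set F : Vec d → ℝ≥0∞ := fun x => f (ε⁻¹ • x) (ξ + grad V x) with hF
  have hmain := volume_mul_homog_le hper (ξ := ξ) (A := growth c ‖ξ‖)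
    (fun x => le_growth hc hf le_rfl x) 0 one_pos hε0 hVl hV0
  have hbox : box (0 : Vec d) 1 = Y := by rw [hY, cube_eq_box]; simp
  rw [hbox, ENNReal.ofReal_one, one_pow, one_mul] at hmain
  rw [ENNReal.ofReal_one, one_pow] at hεs
  set U := ⋃ i, Metric.closedBall (a i) (ρ i) with hU
  have hUm : MeasurableSet U := MeasurableSet.iUnion fun i => measurableSet_closedBall
  have hUY : U ⊆ Y := Set.iUnion_subset fun i => (hball i).2.1
  have hdisj' : Pairwise (Function.onFun Disjoint fun i => Metric.closedBall (a i) (ρ i)) := hdisj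
  have hsumv : ∑ i, volume (Metric.closedBall (a i) (ρ i)) ≤ 1 := by
    rw [← tsum_fintype (L := .unconditional ι),
      ← measure_iUnion hdisj' fun i => measurableSet_closedBall, ← hYv]
    exact measure_mono hUY
  have hI1 : ∫⁻ x in U, F x ≤ (∫⁻ x in Y, homog f (ξ + grad w x)) + δ * (3 + G) := by
    rw [hU, lintegral_iUnion (fun i => measurableSet_closedBall) hdisj', tsum_fintype]
    calc ∑ i, ∫⁻ x in Metric.closedBall (a i) (ρ i), F x
        ≤ ∑ i, ((∫⁻ x in Metric.closedBall (a i) (ρ i), g x) +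
            δ * (3 + G) * volume (Metric.closedBall (a i) (ρ i))) := by
          refine Finset.sum_le_sum fun i _ => ?_
          rw [← Measure.restrict_congr_set (ball_ae_eq_closedBall (a i) (hball i).1)]
          have e : ∫⁻ x in Metric.ball (a i) (ρ i), F x = ∫⁻ x in Metric.ball (a i) (ρ i),
              f (ε⁻¹ • x) (ξ + grad (fun z => w z + q i z) x) := by
            refine setLIntegral_congr_fun measurableSet_ball fun x hx => ?_
            simp only [hF]
            rw [grad_congr_of_eqOn Metric.isOpen_ball (w := V)
              (w' := fun z => w z + q i z) (fun y hy => ?_) hx]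
            simp only [hV]
            congr 1
            refine Finset.sum_eq_single_of_mem i (Finset.mem_univ i) fun j _ hij =>
              hq0 j y fun hyj => ?_
            exact Set.disjoint_left.1 (hdisj hij) (Metric.ball_subset_closedBall hyj)
              (Metric.ball_subset_closedBall hy)
          rw [e]
          refine (hqe i).trans ?_
          have h1 := (hball i).2.2.2
          rw [← Measure.restrict_congr_set (ball_ae_eq_closedBall (a i) (hball i).1),
            ← measure_congr (ball_ae_eq_closedBall (a i) (hball i).1)] at h1
          rw [← measure_congr (ball_ae_eq_closedBall (a i) (hball i).1), mul_add]
          refine (add_le_add h1 le_rfl).trans (le_of_eq ?_)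
          ring
      _ = (∑ i, ∫⁻ x in Metric.closedBall (a i) (ρ i), g x) +
            δ * (3 + G) * ∑ i, volume (Metric.closedBall (a i) (ρ i)) := by
          rw [Finset.sum_add_distrib, Finset.mul_sum]
      _ ≤ (∫⁻ x, g x) + δ * (3 + G) * 1 := by
          gcongr
          rw [← tsum_fintype (L := .unconditional ι),
            ← lintegral_iUnion (fun i => measurableSet_closedBall) hdisj']
          exact setLIntegral_le_lintegral _ _
      _ = _ := by rw [hgY, mul_one]
  -- Off the balls `V = w`, with energy density at most `G` on a set of volume at most `δ`.
  have hI2 : ∫⁻ x in Y \ U, F x ≤ G * δ := by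
    calc ∫⁻ x in Y \ U, F x ≤ ∫⁻ _x in Y \ U, (G : ℝ≥0∞) := by
          refine setLIntegral_mono measurable_const fun x hx => ?_
          have hUc : IsClosed U := isClosed_iUnion_of_finite fun i => Metric.isClosed_closedBall
          simp only [hF]
          rw [grad_congr_of_eqOn hUc.isOpen_compl (w := V) (w' := w) (fun y hy => ?_) hx.2]
          · refine le_growth hc hf ((norm_add_le _ _).trans ?_) _
            have h1 := norm_grad_le hw x
            have h2 : frobConst m d * K ≤ frobConst m d * (3 * K + 1) :=
              mul_le_mul_of_nonneg_left (by linarith [K.2]) frobConst_nonneg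
            linarith
          · simp only [hV]
            rw [Finset.sum_eq_zero fun i _ => hq0 i y fun h => hy
              (Set.mem_iUnion.2 ⟨i, Metric.ball_subset_closedBall h⟩), add_zero]
      _ = G * volume (Y \ U) := setLIntegral_const _ _
      _ ≤ G * δ := by gcongr
  rw [← lintegral_inter_add_sdiff F Y hUm, Set.inter_eq_right.2 hUY] at hmain
  refine hmain.trans ((add_le_add (add_le_add hI1 hI2) hεs.le).trans (le_of_eq ?_))
  ring

/-- The homogenized density is quasiconvex. -/
theorem isQuasiconvex_homog (hd : 1 ≤ d) {f : Vec d → Mat m d → ℝ≥0∞}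
    (hper : ∀ (ξ : Mat m d) (x : Vec d) (j : Fin d), f (x + EuclideanSpace.single j 1) ξ = f x ξ)
    {c : ℝ} (hc : 0 < c) (hf : ∀ x ξ, f x ξ ≤ ENNReal.ofReal (c * (1 + ‖ξ‖))) :
    IsQuasiconvex (homog f) := by
  refine ⟨fun ζ => ne_top_of_le_ne_top ENNReal.coe_ne_top
    (homog_le_of_le fun x => le_growth hc hf le_rfl x),
    (upperSemicontinuous_homog hd hc hf).measurable, fun ξ => le_antisymm ?_ ?_⟩
  · refine le_iInf₂ fun φ hφ => ?_
    obtain ⟨K, w, hw, hw0, hgw⟩ := hφ.exists_extension (isOpen_cube 1) (convex_cube 1)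
    refine (homog_le_lintegral_homog hd hper hc hf ξ hw hw0).trans (le_of_eq ?_)
    refine lintegral_congr_ae ?_
    filter_upwards [hgw] with x hx
    rw [hx]
  · have h0 : LipschitzWith 0 (fun _ : Vec d => (0 : Vec m)) := LipschitzWith.const 0
    refine iInf₂_le_of_le
      (W1inf.ofLipschitz h0 (isOpen_cube 1).measurableSet (isBounded_cube 1))
      (W1inf.isZeroOnBoundary_ofLipschitz h0 (isOpen_cube 1) (isBounded_cube 1)
        fun _ _ => rfl) ?_
    have : (W1inf.ofLipschitz h0 (isOpen_cube 1).measurableSet (isBounded_cube (d := d) 1)).grad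
        = fun _ => 0 := funext fun x => grad_const 0 x
    rw [this]
    simp [volume_cube]

/-! ### From weak* convergence to locally uniform convergence -/

/-- Uniform boundedness in `L^∞`, the dual of `L¹`. -/
lemma exists_ae_bound_of_integral_bounded {α : Type*} [MeasurableSpace α] {μ : Measure α}
    [IsFiniteMeasure μ] {g : ℕ → α → ℝ} (hg : ∀ n, MemLp (g n) ⊤ μ)
    (hb : ∀ h : α → ℝ, Integrable h μ → ∃ C, ∀ n, |∫ x, g n x * h x ∂μ| ≤ C) :
    ∃ C : ℝ, ∀ n, ∀ᵐ x ∂μ, |g n x| ≤ C := by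
  have hgb : ∀ n, ∃ R : ℝ, ∀ᵐ x ∂μ, ‖g n x‖ ≤ R := fun n => by
    refine ⟨(eLpNorm (g n) ⊤ μ).toReal, ?_⟩
    have h1 : ∀ᵐ x ∂μ, ‖g n x‖ₑ ≤ eLpNorm (g n) ⊤ μ := by
      rw [eLpNorm_exponent_top]; exact ae_le_eLpNormEssSup
    filter_upwards [h1] with x hx
    rw [← toReal_enorm]
    exact ENNReal.toReal_mono (hg n).2.ne hx
  choose R hR using hgb
  -- The `g n` act as functionals on `L¹`; Banach–Steinhaus bounds their operator norms, and testing
  -- with indicators turns that bound into an a.e. bound.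
  let T : ℕ → (Lp ℝ 1 μ →L[ℝ] ℝ) := fun n => LinearMap.mkContinuous
    { toFun := fun h => ∫ x, g n x * h x ∂μ
      map_add' := fun h k => by
        rw [← integral_add ((L1.integrable_coeFn h).memLp_top_mul (hg n))
          ((L1.integrable_coeFn k).memLp_top_mul (hg n))]
        refine integral_congr_ae ?_
        filter_upwards [Lp.coeFn_add h k] with x hx
        rw [hx, Pi.add_apply, mul_add]
      map_smul' := fun c h => by
        rw [RingHom.id_apply, smul_eq_mul, ← integral_const_mul]
        refine integral_congr_ae ?_
        filter_upwards [Lp.coeFn_smul c h] with x hx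
        rw [hx, Pi.smul_apply, smul_eq_mul]
        ring } (R n) fun h => by
      rw [L1.norm_eq_integral_norm, ← integral_const_mul]
      refine norm_integral_le_of_norm_le ((L1.integrable_coeFn h).norm.const_mul _) ?_
      filter_upwards [hR n] with x hx
      rw [norm_mul]
      gcongr
  have hT : ∀ n (h : Lp ℝ 1 μ), T n h = ∫ x, g n x * h x ∂μ := fun n h => rfl
  obtain ⟨C, hC⟩ := banach_steinhaus (g := T) fun h => hb h (L1.integrable_coeFn h)
  refine ⟨C, fun n => ?_⟩
  have hgi : Integrable (g n) μ := (hg n).integrable le_top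
  have key : ∀ s, MeasurableSet s → |∫ x in s, g n x ∂μ| ≤ ∫ _x in s, C ∂μ := by
    intro s hs
    have hsi : Integrable (s.indicator fun _ => (1 : ℝ)) μ := (integrable_const 1).indicator hs
    have h1 : T n (hsi.toL1 _) = ∫ x in s, g n x ∂μ := by
      rw [hT, ← integral_indicator hs]
      refine integral_congr_ae ?_
      filter_upwards [hsi.coeFn_toL1] with x hx
      rw [hx]
      by_cases hxs : x ∈ s <;> simp [hxs]
    have h2 : ‖hsi.toL1 _‖ = μ.real s := by
      rw [L1.norm_of_fun_eq_integral_norm]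
      have : ∀ x, ‖s.indicator (fun _ => (1 : ℝ)) x‖ = s.indicator (fun _ => (1 : ℝ)) x := by
        intro x
        by_cases hxs : x ∈ s <;> simp [hxs]
      simp only [this]
      rw [integral_indicator hs]
      simp
    rw [← h1, ← Real.norm_eq_abs]
    refine ((T n).le_opNorm _).trans ?_
    rw [h2]
    simp only [integral_const, smul_eq_mul, MeasurableSet.univ, measureReal_restrict_apply,
      Set.univ_inter]
    rw [mul_comm]
    exact mul_le_mul_of_nonneg_left (hC n) measureReal_nonneg
  have h1 := ae_le_of_forall_setIntegral_le hgi (integrable_const C) fun s hs _ =>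
    (le_abs_self _).trans (key s hs)
  have h2 := ae_le_of_forall_setIntegral_le hgi.neg (integrable_const C) fun s hs _ => by
    have e : ∫ x in s, (-g n) x ∂μ = -∫ x in s, g n x ∂μ := by
      simp only [Pi.neg_apply, integral_neg]
    rw [e]
    exact (neg_le_abs _).trans (key s hs)
  filter_upwards [h1, h2] with x hx1 hx2
  rw [abs_le]
  simp only [Pi.neg_apply] at hx2
  constructor <;> linarith

lemma norm_le_card_mul {ι : Type*} [Fintype ι] (x : EuclideanSpace ℝ ι) {C : ℝ}
    (h : ∀ i, |x i| ≤ C) : ‖x‖ ≤ Fintype.card ι * C := by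
  classical
  have hx : x = ∑ i, x i • EuclideanSpace.single i (1 : ℝ) := by
    ext k; simp [Pi.single_apply]
  calc ‖x‖ = ‖∑ i, x i • EuclideanSpace.single i (1 : ℝ)‖ := by rw [← hx]
    _ ≤ ∑ i, ‖x i • EuclideanSpace.single i (1 : ℝ)‖ := norm_sum_le _ _
    _ ≤ ∑ _i : ι, C := Finset.sum_le_sum fun i _ => by
        rw [norm_smul, PiLp.norm_single, norm_one, mul_one]; exact h i
    _ = Fintype.card ι * C := by simp

/-- Weakly* convergent sequences have bounded gradients. -/
lemma exists_grad_bound_of_weakStar {Ω : Set (Vec d)} (hΩv : volume Ω ≠ ⊤) {v : ℕ → W1inf Ω m}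
    {u : W1inf Ω m}
    (hv : ∀ h : Vec d → ℝ, Integrable h (volume.restrict Ω) → ∀ (i : Fin m) (j : Fin d),
      Tendsto (fun n => ∫ x in Ω, (v n).grad x (i, j) * h x) atTop
        (𝓝 (∫ x in Ω, u.grad x (i, j) * h x))) :
    ∃ C : ℝ≥0, ∀ n, ∀ᵐ x ∂(volume.restrict Ω), ‖(v n).grad x‖ ≤ C := by
  have : IsFiniteMeasure (volume.restrict Ω) := ⟨by simpa using hΩv.lt_top⟩
  have key : ∀ p : Fin m × Fin d, ∃ C : ℝ, ∀ n, ∀ᵐ x ∂(volume.restrict Ω),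
      |(v n).grad x p| ≤ C := by
    intro p
    refine exists_ae_bound_of_integral_bounded (fun n => memLp_coord (v n).memLp_grad p)
      fun h hh => ?_
    obtain ⟨C, hC⟩ := (hv h hh p.1 p.2).norm.bddAbove_range
    exact ⟨C, fun n => hC ⟨n, rfl⟩⟩
  choose C hC using key
  refine ⟨Fintype.card (Fin m × Fin d) * ∑ p, Real.toNNReal (C p), fun n => ?_⟩
  filter_upwards [ae_all_iff.2 fun p => hC p n] with x hx
  have := norm_le_card_mul ((v n).grad x) (C := ∑ p, (Real.toNNReal (C p) : ℝ)) fun p =>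
    (hx p).trans ((Real.le_coe_toNNReal _).trans
      (Finset.single_le_sum (f := fun p => (Real.toNNReal (C p) : ℝ)) (fun _ _ => NNReal.coe_nonneg _)
        (Finset.mem_univ p)))
  push_cast
  exact this

/-- Equi-Lipschitz functions converging weakly converge pointwise. -/
lemma tendsto_coord_of_weak {B : Set (Vec d)} (hB : IsOpen B) {w : ℕ → Vec d → Vec m}
    {w₀ : Vec d → Vec m} {K : ℝ≥0} (hw : ∀ n, LipschitzWith K (w n)) (hw₀ : LipschitzWith K w₀)
    (i : Fin m)
    (hconv : ∀ s ⊆ B, MeasurableSet s → volume s ≠ ⊤ →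
      Tendsto (fun n => ∫ x in s, w n x i) atTop (𝓝 (∫ x in s, w₀ x i)))
    {x : Vec d} (hx : x ∈ B) : Tendsto (fun n => w n x i) atTop (𝓝 (w₀ x i)) := by
  rw [Metric.tendsto_nhds]
  intro η hη
  obtain ⟨r₀, hr₀, hrB⟩ := Metric.isOpen_iff.1 hB x hx
  -- On a ball of this radius an admissible function oscillates by at most `η / 4` about its central
  -- value. The two oscillations and the convergence of the integrals add up to `3η / 4 < η`.
  set r := min r₀ (η / (4 * (K + 1))) with hr
  have hr0 : 0 < r := by positivity
  have hKr : K * r ≤ η / 4 := by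
    have h1 : r ≤ η / (4 * (K + 1)) := min_le_right _ _
    calc (K : ℝ) * r ≤ (K + 1) * (η / (4 * (K + 1))) := by gcongr; linarith
      _ = η / 4 := by field_simp
  set s := Metric.ball x r with hs
  have hsB : s ⊆ B := (Metric.ball_subset_ball (min_le_left _ _)).trans hrB
  set V := volume.real s with hV
  have hV0 : 0 < V := ENNReal.toReal_pos (Metric.measure_ball_pos volume x hr0).ne'
    measure_ball_lt_top.ne
  have hav : ∀ {g : Vec d → Vec m}, LipschitzWith K g →
      |(∫ y in s, g y i) - V * g x i| ≤ η / 4 * V := by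
    intro g hg
    have hgi : IntegrableOn (fun y => g y i) s :=
      ((lipschitzWith_coord hg i).continuous.continuousOn.integrableOn_compact
        (isCompact_closedBall x r)).mono_set Metric.ball_subset_closedBall
    have e : (∫ y in s, g y i) - V * g x i = ∫ y in s, (g y i - g x i) := by
      rw [integral_sub hgi (integrableOn_const measure_ball_lt_top.ne)]
      simp [hV]
    rw [e, ← Real.norm_eq_abs]
    refine norm_setIntegral_le_of_norm_le_const measure_ball_lt_top fun y hy => ?_
    refine ((lipschitzWith_coord hg i).dist_le_mul y x).trans (le_trans ?_ hKr)
    gcongr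
    exact (Metric.mem_ball.1 hy).le
  have hc := hconv s hsB measurableSet_ball measure_ball_lt_top.ne
  rw [Metric.tendsto_nhds] at hc
  filter_upwards [hc (η / 4 * V) (by positivity)] with n hn
  rw [Real.dist_eq] at hn ⊢
  have h1 := hav (hw n)
  have h2 := hav hw₀
  have h3 : V * |w n x i - w₀ x i| < V * η := by
    rw [← abs_of_pos hV0, ← abs_mul, abs_of_pos hV0]
    rw [abs_lt] at hn ⊢
    rw [abs_le] at h1 h2
    constructor <;> nlinarith
  exact lt_of_mul_lt_mul_left h3 hV0.le

/-- Pointwise convergence of equi-Lipschitz functions is uniform on bounded sets. -/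
lemma eventually_forall_norm_sub_le {S : Set (Vec d)} (hS : Bornology.IsBounded S)
    {w : ℕ → Vec d → Vec m} {w₀ : Vec d → Vec m} {K : ℝ≥0} (hw : ∀ n, LipschitzWith K (w n))
    (hw₀ : LipschitzWith K w₀)
    (hconv : ∀ x ∈ S, ∀ i, Tendsto (fun n => w n x i) atTop (𝓝 (w₀ x i))) {η : ℝ} (hη : 0 < η) :
    ∀ᶠ n in atTop, ∀ x ∈ S, ‖w n x - w₀ x‖ ≤ η := by
  have htb : TotallyBounded S :=
    (Metric.isCompact_of_isClosed_isBounded isClosed_closure hS.closure).totallyBounded.subset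
      subset_closure
  -- The error over a finite `κ`-net is `m * κ` at the net and `K * κ` twice for moving to it. The
  -- summand 1 keeps the denominator positive.
  set κ : ℝ := η / (2 * K + (m + 1)) with hκ
  have hκ0 : 0 < κ := by positivity
  obtain ⟨t, htS, htf, ht⟩ := Metric.finite_approx_of_totallyBounded htb κ hκ0
  have hev : ∀ᶠ n in atTop, ∀ y ∈ t, ∀ i, |w n y i - w₀ y i| ≤ κ := by
    rw [htf.eventually_all]
    intro y hy
    rw [eventually_all]
    intro i
    filter_upwards [Metric.tendsto_nhds.1 (hconv y (htS hy) i) κ hκ0] with n hn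
    exact hn.le
  filter_upwards [hev] with n hn x hx
  obtain ⟨y, hy, hxy⟩ := Set.mem_iUnion₂.1 (ht hx)
  have h1 : ‖w n y - w₀ y‖ ≤ m * κ := norm_sub_le_of_mem_box hκ0.le (hn y hy)
  have h2 : ‖w n x - w n y‖ ≤ K * κ := by
    rw [← dist_eq_norm]
    refine ((hw n).dist_le_mul x y).trans ?_
    gcongr
    exact (Metric.mem_ball.1 hxy).le
  have h3 : ‖w₀ y - w₀ x‖ ≤ K * κ := by
    rw [← dist_eq_norm]
    refine (hw₀.dist_le_mul y x).trans ?_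
    rw [dist_comm]
    gcongr
    exact (Metric.mem_ball.1 hxy).le
  calc ‖w n x - w₀ x‖ = ‖(w n x - w n y) + (w n y - w₀ y) + (w₀ y - w₀ x)‖ := by congr 1; abel
    _ ≤ K * κ + m * κ + K * κ := norm_add₃_le.trans (by gcongr)
    _ ≤ (2 * K + (m + 1)) * κ := by nlinarith
    _ = η := by rw [hκ]; field_simp

/-! ### Lower bound at a point of differentiability -/

lemma exists_volume_box_shell_le (d : ℕ) {δ : ℝ≥0} (hδ : 0 < δ) :
    ∃ τ : ℝ≥0, 0 < τ ∧ ∀ (a : Vec d) (ρ : ℝ), 0 < ρ →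
      volume (box a ρ ∩ Metric.cthickening (τ * ρ) (box a ρ)ᶜ) ≤ δ * ENNReal.ofReal ρ ^ d := by
  have hlim : Tendsto (fun τ : ℝ => 1 - (1 - 4 * τ) ^ d) (𝓝[>] 0) (𝓝 (1 - (1 - 4 * 0) ^ d)) := by
    refine tendsto_nhdsWithin_of_tendsto_nhds (Continuous.tendsto ?_ 0)
    fun_prop
  have hlt : (1 : ℝ) - (1 - 4 * 0) ^ d < δ := by simpa using hδ
  obtain ⟨τ, h1, h2⟩ := ((hlim.eventually (gt_mem_nhds hlt)).and
    (Ioo_mem_nhdsGT (by norm_num : (0 : ℝ) < 1 / 4))).exists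
  refine ⟨⟨τ, h2.1.le⟩, h2.1, fun a ρ hρ => ?_⟩
  change volume (box a ρ ∩ Metric.cthickening (τ * ρ) (box a ρ)ᶜ) ≤ _
  have hτρ : 0 < τ * ρ := mul_pos h2.1 hρ
  have h3 : 0 < 1 - 4 * τ := by linarith [h2.2]
  -- The inner box keeps a margin `2τρ`, twice the width of the layer, so that the closed
  -- neighbourhood of width `τρ` is strictly avoided.
  set a' : Vec d := WithLp.toLp 2 fun j => a j + 2 * (τ * ρ) with ha'
  set I := box a' ((1 - 4 * τ) * ρ) with hI
  have hcl : ∀ x ∈ I, Metric.closedBall x (2 * (τ * ρ)) ⊆ box a ρ := by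
    intro x hx
    refine closedBall_subset_box fun j => ?_
    have h4 := hx j
    simp only [ha'] at h4
    constructor <;> linarith [h4.1, h4.2]
  have hIb : I ⊆ box a ρ := fun x hx => hcl x hx (Metric.mem_closedBall_self (by positivity))
  have hsub : box a ρ ∩ Metric.cthickening (τ * ρ) (box a ρ)ᶜ ⊆ box a ρ \ I := by
    rintro x ⟨hx, hxc⟩
    refine ⟨hx, fun hxI => ?_⟩
    have h5 := Metric.cthickening_subset_thickening' (δ₂ := 2 * (τ * ρ)) (by positivity)
      (by linarith) (box a ρ)ᶜ hxc
    obtain ⟨y, hy, hxy⟩ := Metric.mem_thickening_iff.1 h5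
    refine hy (hcl x hxI ?_)
    rw [Metric.mem_closedBall, dist_comm]
    exact hxy.le
  refine (measure_mono hsub).trans ?_
  rw [measure_sdiff hIb (measurableSet_box _ _).nullMeasurableSet (by rw [volume_box]; finiteness),
    volume_box, volume_box, tsub_le_iff_right, ENNReal.ofReal_mul h3.le, mul_pow, ← add_mul]
  refine le_mul_of_one_le_left zero_le ?_
  rw [← ENNReal.ofReal_coe_nnreal, ← ENNReal.ofReal_pow h3.le,
    ← ENNReal.ofReal_add (by positivity) (by positivity), ENNReal.one_le_ofReal]
  linarith

/-- Lower bound at a point of differentiability of the limit. -/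
lemma eventually_homog_le_average (hd : 1 ≤ d) {f : Vec d → Mat m d → ℝ≥0∞}
    (hper : ∀ (ξ : Mat m d) (x : Vec d) (j : Fin d), f (x + EuclideanSpace.single j 1) ξ = f x ξ)
    {c : ℝ} (hc : 0 < c) (hf : ∀ x ξ, f x ξ ≤ ENNReal.ofReal (c * (1 + ‖ξ‖)))
    {B : Set (Vec d)} (hB : IsOpen B) {ε : ℕ → ℝ} (hε : Tendsto ε atTop (𝓝[>] 0))
    (hε0 : ∀ n, 0 < ε n) {w : ℕ → Vec d → Vec m} {w₀ : Vec d → Vec m} {K : ℝ≥0}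
    (hw : ∀ n, LipschitzWith K (w n)) (hw₀ : LipschitzWith K w₀)
    (hconv : ∀ x ∈ B, ∀ i, Tendsto (fun n => w n x i) atTop (𝓝 (w₀ x i)))
    {x₀ : Vec d} (hx₀ : x₀ ∈ B) (hdiff : DifferentiableAt ℝ w₀ x₀) {δ : ℝ≥0} (hδ : 0 < δ) :
    ∀ᶠ ρ in 𝓝[>] (0 : ℝ), box x₀ ρ ⊆ B ∧ ∀ᶠ n in atTop, homog f (grad w₀ x₀) ≤
      (ENNReal.ofReal ρ ^ d)⁻¹ * (∫⁻ x in box x₀ ρ, f ((ε n)⁻¹ • x) (grad (w n) x)) +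
        δ * (1 + growth c (‖grad w₀ x₀‖ + frobConst m d * (2 * K + 1))) := by
  set ξ := grad w₀ x₀ with hξ
  set G := growth c (‖ξ‖ + frobConst m d * (2 * K + 1)) with hG
  set l : Vec d → Vec m := aff ξ x₀ (w₀ x₀) with hl
  have hlK : LipschitzWith K l := by
    refine (lipschitzWith_aff ξ x₀ (w₀ x₀)).weaken ?_
    rw [hξ, grad, ContinuousLinearEquiv.symm_apply_apply]
    exact norm_fderiv_le_of_lipschitz ℝ hw₀
  obtain ⟨τ, hτ0, hτ⟩ := exists_volume_box_shell_le d hδ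
  have hd0 : (0 : ℝ) < d := by exact_mod_cast hd
  have hτ0' : (0 : ℝ) < τ := hτ0
  -- Points of the box are within `d * ρ` of its corner, so this constant makes the affine error at
  -- most `τρ / 2`. Uniform convergence supplies the other half.
  have h3 := hdiff.hasFDerivAt.isLittleO.def (c := (τ : ℝ) / (2 * d)) (by positivity)
  obtain ⟨r₀, hr₀, hr₀'⟩ := Metric.eventually_nhds_iff_ball.1 h3
  obtain ⟨r₁, hr₁, hr₁'⟩ := Metric.isOpen_iff.1 hB x₀ hx₀
  have hpos : 0 < min r₀ r₁ / d := by positivity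
  filter_upwards [Ioo_mem_nhdsGT hpos] with ρ hρ
  have hρ0 : 0 < ρ := hρ.1
  have hdρ : d * ρ < min r₀ r₁ := by
    have := hρ.2
    rw [lt_div_iff₀ hd0] at this
    linarith
  have hcl := box_subset_closedBall x₀ hρ0.le
  have hQB : box x₀ ρ ⊆ B := hcl.trans ((Metric.closedBall_subset_ball
    (hdρ.trans_le (min_le_right _ _))).trans hr₁')
  refine ⟨hQB, ?_⟩
  have hQl : ∀ y ∈ box x₀ ρ, ‖w₀ y - l y‖ ≤ τ * ρ / 2 := by
    intro y hy
    have h4 := hr₀' y (Metric.closedBall_subset_ball (hdρ.trans_le (min_le_left _ _)) (hcl hy))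
    have h5 : l y = w₀ x₀ + fderiv ℝ w₀ x₀ (y - x₀) := by
      rw [hl, aff, hξ, grad, ContinuousLinearEquiv.symm_apply_apply]
    rw [h5, ← sub_sub]
    refine h4.trans ?_
    have h6 : ‖y - x₀‖ ≤ d * ρ := by rw [← dist_eq_norm]; exact hcl hy
    calc (τ : ℝ) / (2 * d) * ‖y - x₀‖ ≤ τ / (2 * d) * (d * ρ) := by gcongr
      _ = τ * ρ / 2 := by field_simp
  have hunif := eventually_forall_norm_sub_le (isBounded_box x₀ hρ0.le) hw hw₀
    (fun x hx => hconv x (hQB hx)) (η := τ * ρ / 2) (by positivity)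
  have hρd : ENNReal.ofReal ρ ^ d ≠ 0 := pow_ne_zero _ (by simpa using hρ0)
  have hρd' : ENNReal.ofReal ρ ^ d ≠ ⊤ := by finiteness
  have hsmall : ∀ᶠ n in atTop, (growth c ‖ξ‖ : ℝ≥0∞) *
      (ENNReal.ofReal (ρ + 2 * ε n) ^ d - ENNReal.ofReal ρ ^ d) < δ * ENNReal.ofReal ρ ^ d :=
    ((tendsto_volume_enlarged_cube (growth c ‖ξ‖)).comp hε).eventually
      (gt_mem_nhds (ENNReal.mul_pos (by exact_mod_cast hδ.ne') hρd))
  filter_upwards [hunif, hsmall] with n hn hns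
  have hs : 0 < τ * Real.toNNReal ρ := by positivity
  have hse : ((τ * Real.toNNReal ρ : ℝ≥0) : ℝ) = τ * ρ := by
    rw [NNReal.coe_mul, Real.coe_toNNReal _ hρ0.le]
  -- The function cut off is `w n - l`, again with layer width equal to its bound, so that `ξ + ∇p`
  -- equals `∇(w n)` off the layer.
  obtain ⟨p, hp, hp0, hpe⟩ := exists_cutoff
    (compl_nonempty_of_isBounded hd (isBounded_box x₀ hρ0.le)) ((hw n).sub hlK)
    (M := τ * Real.toNNReal ρ) hs (fun y hy => by
      rw [hse]
      calc ‖w n y - l y‖ = ‖(w n y - w₀ y) + (w₀ y - l y)‖ := by congr 1; abel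
        _ ≤ τ * ρ / 2 + τ * ρ / 2 := (norm_add_le _ _).trans (add_le_add (hn y hy) (hQl y hy))
        _ = τ * ρ := by ring)
  rw [div_self hs.ne'] at hp
  rw [hse] at hpe
  have hmain := volume_mul_homog_le hper (ξ := ξ) (A := growth c ‖ξ‖)
    (fun x => le_growth hc hf le_rfl x) x₀ hρ0 (hε0 n) hp hp0
  have hlayer : ∫⁻ x in box x₀ ρ, f ((ε n)⁻¹ • x) (ξ + grad p x) ≤
      (∫⁻ x in box x₀ ρ, f ((ε n)⁻¹ • x) (grad (w n) x)) +
        G * volume (box x₀ ρ ∩ Metric.cthickening (τ * ρ) (box x₀ ρ)ᶜ) := by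
    refine lintegral_le_add_layer (measurableSet_box _ _)
      Metric.isClosed_cthickening.measurableSet ?_ ?_
    · filter_upwards [(hw n).ae_differentiableAt (μ := volume)] with x hx _ hxL
      have e : grad p x = grad (w n) x - ξ := by
        rw [grad_congr_of_eqOn Metric.isClosed_cthickening.isOpen_compl
          (w := p) (fun y hy => hpe y hy) hxL,
          grad_eq_of_hasFDerivAt (hx.hasFDerivAt.fun_sub (hasFDerivAt_aff ξ x₀ (w₀ x₀) x)), map_sub,
          ContinuousLinearEquiv.apply_symm_apply, grad]
      rw [e, add_sub_cancel]
    · refine Eventually.of_forall fun x _ => le_growth hc hf ((norm_add_le _ _).trans ?_) _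
      have := norm_grad_le hp x
      push_cast at this
      have e : (K : ℝ) + K + 1 = 2 * K + 1 := by ring
      rw [e] at this
      linarith
  have htot : ENNReal.ofReal ρ ^ d * homog f ξ ≤
      (∫⁻ x in box x₀ ρ, f ((ε n)⁻¹ • x) (grad (w n) x)) +
        ENNReal.ofReal ρ ^ d * (δ * (1 + G)) := by
    refine hmain.trans ((add_le_add (hlayer.trans (add_le_add le_rfl
      (mul_le_mul' le_rfl (hτ x₀ ρ hρ0)))) hns.le).trans (le_of_eq ?_))
    ring
  calc homog f ξ = (ENNReal.ofReal ρ ^ d)⁻¹ * (ENNReal.ofReal ρ ^ d * homog f ξ) := by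
        rw [← mul_assoc, ENNReal.inv_mul_cancel hρd hρd', one_mul]
    _ ≤ (ENNReal.ofReal ρ ^ d)⁻¹ * ((∫⁻ x in box x₀ ρ, f ((ε n)⁻¹ • x) (grad (w n) x)) +
        ENNReal.ofReal ρ ^ d * (δ * (1 + G))) := by gcongr
    _ = _ := by
        rw [mul_add, ← mul_assoc (ENNReal.ofReal ρ ^ d)⁻¹ (ENNReal.ofReal ρ ^ d),
          ENNReal.inv_mul_cancel hρd hρd', one_mul]

/-! ### Averages over boxes and the lower bound -/

lemma mem_box_iff_sub {a x : Vec d} {s : ℝ} : x ∈ box a s ↔ x - a ∈ box (0 : Vec d) s := by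
  simp only [box, Set.mem_ofPred_eq, PiLp.sub_apply, PiLp.zero_apply, zero_add]
  refine forall_congr' fun j => ?_
  constructor <;> rintro ⟨h1, h2⟩ <;> constructor <;> linarith

lemma measurableSet_prod_box (ρ : ℝ) : MeasurableSet {p : Vec d × Vec d | p.2 ∈ box p.1 ρ} := by
  have : {p : Vec d × Vec d | p.2 ∈ box p.1 ρ} = (fun p => p.2 - p.1) ⁻¹' box (0 : Vec d) ρ := by
    ext p; exact mem_box_iff_sub
  rw [this]
  exact (measurableSet_box _ _).preimage (measurable_snd.sub measurable_fst)

lemma setLIntegral_box_eq (F : Vec d → ℝ≥0∞) (a : Vec d) (ρ : ℝ) :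
    ∫⁻ x in box a ρ, F x =
      ∫⁻ x, {p : Vec d × Vec d | p.2 ∈ box p.1 ρ}.indicator (fun p => F p.2) (a, x) := by
  rw [← lintegral_indicator (measurableSet_box a ρ)]
  rfl

lemma measurable_setLIntegral_box {F : Vec d → ℝ≥0∞} (hF : Measurable F) (ρ : ℝ) :
    Measurable fun a => ∫⁻ x in box a ρ, F x := by
  simp only [setLIntegral_box_eq]
  exact ((hF.comp measurable_snd).indicator (measurableSet_prod_box ρ)).lintegral_prod_right'

/-- Averaging over cubes preserves the integral. -/
lemma lintegral_setLIntegral_box {F : Vec d → ℝ≥0∞} (hF : Measurable F) (ρ : ℝ) :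
    ∫⁻ a, ∫⁻ x in box a ρ, F x = ENNReal.ofReal ρ ^ d * ∫⁻ x, F x := by
  simp only [setLIntegral_box_eq]
  rw [lintegral_lintegral_swap (f := fun a x =>
      {p : Vec d × Vec d | p.2 ∈ box p.1 ρ}.indicator (fun p => F p.2) (a, x))
    (by exact ((hF.comp measurable_snd).indicator (measurableSet_prod_box ρ)).aemeasurable),
    ← lintegral_const_mul _ hF]
  refine lintegral_congr fun x => ?_
  have h1 : MeasurableSet ((fun a => x - a) ⁻¹' box (0 : Vec d) ρ) :=
    (measurableSet_box _ _).preimage (measurable_const.sub measurable_id)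
  have h2 : ∀ a, {p : Vec d × Vec d | p.2 ∈ box p.1 ρ}.indicator (fun p => F p.2) (a, x) =
      ((fun a => x - a) ⁻¹' box (0 : Vec d) ρ).indicator (fun _ => F x) a := by
    intro a
    by_cases h : x ∈ box a ρ
    · rw [Set.indicator_of_mem (show (a, x) ∈ {p : Vec d × Vec d | p.2 ∈ box p.1 ρ} from h),
        Set.indicator_of_mem (show a ∈ (fun a => x - a) ⁻¹' box (0 : Vec d) ρ from
          mem_box_iff_sub.1 h)]
    · rw [Set.indicator_of_notMem (show (a, x) ∉ {p : Vec d × Vec d | p.2 ∈ box p.1 ρ} from h),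
        Set.indicator_of_notMem (show a ∉ (fun a => x - a) ⁻¹' box (0 : Vec d) ρ from
          fun h' => h (mem_box_iff_sub.2 h'))]
  simp only [h2]
  rw [lintegral_indicator h1, setLIntegral_const,
    (Measure.measurePreserving_sub_left volume x).measure_preimage
      (measurableSet_box _ _).nullMeasurableSet, volume_box, mul_comm]

/-- Lower bound along a sequence. -/
theorem lintegral_homog_le_of_seq (hd : 1 ≤ d) {Ω : Set (Vec d)} (hΩ : IsOpen Ω)
    (hΩb : Bornology.IsBounded Ω) {f : Vec d → Mat m d → ℝ≥0∞}
    (hfm : Measurable (Function.uncurry f))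
    (hper : ∀ (ξ : Mat m d) (x : Vec d) (j : Fin d), f (x + EuclideanSpace.single j 1) ξ = f x ξ)
    {c : ℝ} (hc : 0 < c) (hf : ∀ x ξ, f x ξ ≤ ENNReal.ofReal (c * (1 + ‖ξ‖)))
    {ε : ℕ → ℝ} (hε : Tendsto ε atTop (𝓝[>] 0)) (hε0 : ∀ n, 0 < ε n)
    {v : ℕ → W1inf Ω m} {u : W1inf Ω m}
    (hv₀ : ∀ h : Vec d → ℝ, Integrable h (volume.restrict Ω) → ∀ i : Fin m,
      Tendsto (fun n => ∫ x in Ω, (v n).toFun x i * h x) atTop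
        (𝓝 (∫ x in Ω, u.toFun x i * h x)))
    (hv₁ : ∀ h : Vec d → ℝ, Integrable h (volume.restrict Ω) → ∀ (i : Fin m) (j : Fin d),
      Tendsto (fun n => ∫ x in Ω, (v n).grad x (i, j) * h x) atTop
        (𝓝 (∫ x in Ω, u.grad x (i, j) * h x)))
    {a : ℝ≥0∞} (ha : ∀ n, energy f (ε n) (v n) ≤ a) :
    ∫⁻ x in Ω, homog f (u.grad x) ≤ a := by
  have hΩv : volume Ω ≠ ⊤ := hΩb.measure_lt_top.ne
  obtain ⟨C₁, hC₁⟩ := exists_grad_bound_of_weakStar hΩv hv₁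
  obtain ⟨C₂, hC₂⟩ := u.exists_ae_norm_grad_le
  -- One Lipschitz constant for the limit, for all `n` and for all balls in `Ω`.
  obtain ⟨K, hK⟩ := exists_lipschitz_representative m d (max C₁ C₂)
  have hFm : ∀ n, AEMeasurable (Ω.indicator fun x => f ((ε n)⁻¹ • x) ((v n).grad x)) volume := by
    intro n
    rw [aemeasurable_indicator_iff hΩ.measurableSet]
    refine hfm.comp_aemeasurable (f := fun x => ((ε n)⁻¹ • x, (v n).grad x)) ?_
    exact (measurable_const_smul _).aemeasurable.prodMk (v n).memLp_grad.1.aemeasurable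
  -- The gradients are only a.e. measurable; Tonelli's theorem is applied to Borel representatives
  -- of the energy densities extended by zero.
  set F : ℕ → Vec d → ℝ≥0∞ := fun n => (hFm n).mk _ with hF
  have hFmeas : ∀ n, Measurable (F n) := fun n => (hFm n).measurable_mk
  have hFe : ∀ n, ∫⁻ x, F n x ≤ a := by
    intro n
    rw [← lintegral_congr_ae (hFm n).ae_eq_mk, lintegral_indicator hΩ.measurableSet]
    exact ha n
  set ρ : ℕ → ℝ := fun k => 1 / ((k : ℝ) + 1) with hρ
  have hρ0 : ∀ k, 0 < ρ k := fun k => by positivity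
  have hρlim : Tendsto ρ atTop (𝓝[>] 0) :=
    tendsto_nhdsWithin_iff.2 ⟨tendsto_one_div_add_atTop_nhds_zero_nat,
      Eventually.of_forall hρ0⟩
  set A : ℕ → ℕ → Vec d → ℝ≥0∞ := fun k n x =>
    (ENNReal.ofReal (ρ k) ^ d)⁻¹ * ∫⁻ y in box x (ρ k), F n y with hA
  have hAm : ∀ k n, Measurable (A k n) := fun k n =>
    (measurable_setLIntegral_box (hFmeas n) (ρ k)).const_mul _
  have hAi : ∀ k n, ∫⁻ x, A k n x ≤ a := by
    intro k n
    simp only [hA]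
    rw [lintegral_const_mul _ (measurable_setLIntegral_box (hFmeas n) (ρ k)),
      lintegral_setLIntegral_box (hFmeas n), ← mul_assoc, ENNReal.inv_mul_cancel
        (pow_ne_zero _ (by simpa using hρ0 k)) (by finiteness), one_mul]
    exact hFe n
  -- `Ω` need not be convex, so Lipschitz representatives are taken on balls, and null exceptional
  -- sets on balls are then glued by local nullity.
  have hlocal : ∀ x₁ ∈ Ω, ∃ r > 0, ∀ᵐ x, x ∈ Metric.ball x₁ r →
      homog f (u.grad x) ≤ liminf (fun k => liminf (fun n => A k n x) atTop) atTop := by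
    intro x₁ hx₁
    obtain ⟨r, hr, hrΩ⟩ := Metric.isOpen_iff.1 hΩ x₁ hx₁
    refine ⟨r, hr, ?_⟩
    set B := Metric.ball x₁ r with hB
    have hBo : IsOpen B := Metric.isOpen_ball
    have hle : volume.restrict B ≤ volume.restrict Ω := Measure.restrict_mono hrΩ le_rfl
    obtain ⟨w₀, hw₀, hw₀e, hw₀g⟩ := hK B hBo (convex_ball x₁ r) (u.restrict hrΩ)
      (by
        filter_upwards [ae_mono hle hC₂] with x hx
        exact hx.trans (by exact_mod_cast le_max_right _ _))
    have hrep := fun n => hK B hBo (convex_ball x₁ r) ((v n).restrict hrΩ)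
      (by
        filter_upwards [ae_mono hle (hC₁ n)] with x hx
        exact hx.trans (by exact_mod_cast le_max_left _ _))
    choose w hw hwe hwg using hrep
    have hset : ∀ {g : Vec d → Vec m} (i : Fin m) {s : Set (Vec d)}, s ⊆ B → MeasurableSet s →
        ∀ {q : Vec d → Vec m}, g =ᵐ[volume.restrict B] q →
        ∫ x in Ω, g x i * s.indicator (fun _ => (1 : ℝ)) x = ∫ x in s, q x i := by
      intro g i s hsB hs q hgq
      have e : ∀ x, g x i * s.indicator (fun _ => (1 : ℝ)) x = s.indicator (fun x => g x i) x := by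
        intro x
        by_cases hx : x ∈ s <;> simp [hx]
      simp only [e]
      rw [setIntegral_indicator hs, Set.inter_eq_right.2 (hsB.trans hrΩ)]
      refine integral_congr_ae ?_
      filter_upwards [ae_mono (Measure.restrict_mono hsB le_rfl) hgq] with x hx
      rw [hx]
    have hconv : ∀ x ∈ B, ∀ i, Tendsto (fun n => w n x i) atTop (𝓝 (w₀ x i)) := by
      intro x hx i
      refine tendsto_coord_of_weak hBo hw hw₀ i (fun s hsB hs hsv => ?_) hx
      have hsi : Integrable (s.indicator fun _ => (1 : ℝ)) (volume.restrict Ω) :=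
        ((integrable_indicator_iff hs).2 (integrableOn_const hsv)).restrict
      have := hv₀ _ hsi i
      have hw₀e' : u.toFun =ᵐ[volume.restrict B] w₀ := hw₀e
      rw [hset i hsB hs hw₀e'] at this
      refine this.congr fun n => ?_
      exact hset (g := (v n).toFun) i hsB hs (hwe n)
    have hw₀g' := (ae_restrict_iff' hBo.measurableSet).1 hw₀g
    filter_upwards [hw₀g', hw₀.ae_differentiableAt (μ := volume)] with x hxg hxd hxB
    have hux : u.grad x = grad w₀ x := hxg hxB
    rw [hux]
    refine le_of_forall_pos_le_add_mul
      (V := 1 + growth c (‖grad w₀ x‖ + frobConst m d * (2 * K + 1))) (by finiteness) fun δ hδ => ?_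
    -- With the error moved to the left, an eventual bound suffices for each of the two lower
    -- limits.
    rw [← tsub_le_iff_right]
    refine le_liminf_of_le (by isBoundedDefault) ?_
    filter_upwards [hρlim.eventually (eventually_homog_le_average hd hper hc hf hBo hε hε0 hw hw₀
      hconv hxB hxd hδ)] with k ⟨hkB, hk⟩
    refine le_liminf_of_le (by isBoundedDefault) ?_
    filter_upwards [hk] with n hn
    rw [tsub_le_iff_right]
    have e : ∫⁻ y in box x (ρ k), F n y =
        ∫⁻ y in box x (ρ k), f ((ε n)⁻¹ • y) (grad (w n) y) := by
      refine lintegral_congr_ae ?_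
      filter_upwards [ae_restrict_of_ae (hFm n).ae_eq_mk,
        ae_mono (Measure.restrict_mono hkB le_rfl) (hwg n),
        ae_restrict_mem (measurableSet_box x (ρ k))] with y h1 h2 h3
      have h2' : (v n).grad y = grad (w n) y := h2
      simp only [hF]
      rw [← h1, Set.indicator_of_mem (hrΩ (hkB h3)), h2']
    simp only [hA]
    rw [e]
    exact hn
  have hae : ∀ᵐ x ∂(volume.restrict Ω), homog f (u.grad x) ≤
      liminf (fun k => liminf (fun n => A k n x) atTop) atTop := by
    rw [ae_restrict_iff' hΩ.measurableSet, ae_iff]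
    refine measure_null_of_locally_null _ fun x hx => ?_
    simp only [Set.mem_ofPred_eq, Classical.not_imp] at hx
    obtain ⟨r, hr, hrx⟩ := hlocal x hx.1
    refine ⟨_, inter_mem_nhdsWithin _ (Metric.ball_mem_nhds x hr), ?_⟩
    refine measure_mono_null (fun y hy => ?_) (ae_iff.1 hrx)
    obtain ⟨hy1, hy2⟩ := hy
    simp only [Set.mem_ofPred_eq, Classical.not_imp] at hy1 ⊢
    exact ⟨hy2, hy1.2⟩
  -- Fatou's lemma is used twice, for the shrinking boxes and for the sequence, together with the
  -- bound of every averaged energy by `a`.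
  calc ∫⁻ x in Ω, homog f (u.grad x)
      ≤ ∫⁻ x in Ω, liminf (fun k => liminf (fun n => A k n x) atTop) atTop := lintegral_mono_ae hae
    _ ≤ ∫⁻ x, liminf (fun k => liminf (fun n => A k n x) atTop) atTop :=
        setLIntegral_le_lintegral _ _
    _ ≤ liminf (fun k => ∫⁻ x, liminf (fun n => A k n x) atTop) atTop :=
        lintegral_liminf_le fun k => Measurable.liminf (hAm k)
    _ ≤ a := by
        refine liminf_le_of_frequently_le' (Frequently.of_forall fun k => ?_)
        refine (lintegral_liminf_le (hAm k)).trans ?_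
        exact liminf_le_of_frequently_le' (Frequently.of_forall fun n => hAi k n)

/-- The lower bound. -/
theorem lintegral_homog_le_G (hd : 1 ≤ d) {Ω : Set (Vec d)} (hΩ : IsOpen Ω)
    (hΩb : Bornology.IsBounded Ω) {f : Vec d → Mat m d → ℝ≥0∞}
    (hfm : Measurable (Function.uncurry f))
    (hper : ∀ (ξ : Mat m d) (x : Vec d) (j : Fin d), f (x + EuclideanSpace.single j 1) ξ = f x ξ)
    {c : ℝ} (hc : 0 < c) (hf : ∀ x ξ, f x ξ ≤ ENNReal.ofReal (c * (1 + ‖ξ‖)))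
    (u : W1inf Ω m) (r : ℝ≥0∞) : ∫⁻ x in Ω, homog f (u.grad x) ≤ G f r u := by
  refine le_iInf fun v => le_iInf₂ fun hv _ => ?_
  by_contra! hlt
  obtain ⟨a, ha1, ha2⟩ := exists_between hlt
  have hfreq := (frequently_lt_of_liminf_lt (by isBoundedDefault) ha1).and_eventually
    (self_mem_nhdsWithin : Set.Ioi (0 : ℝ) ∈ 𝓝[>] 0)
  -- Along a sequence weak* convergence alone bounds the gradients, so the case `r = ⊤` needs no
  -- separate treatment.
  obtain ⟨ε, hε, hεp⟩ := exists_seq_forall_of_frequently hfreq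
  refine absurd ha2 (not_lt.2 ?_)
  exact lintegral_homog_le_of_seq hd hΩ hΩb hfm hper hc hf hε (fun n => (hεp n).2)
    (v := fun n => v (ε n)) (fun h hh i => ((hv h hh).1 i).comp hε)
    (fun h hh i j => ((hv h hh).2 i j).comp hε) fun n => (hεp n).1.le

end SemiHom

end

theorem theorem3p1 {m d : ℕ} (hm : 1 ≤ m) (hd : 1 ≤ d)
    (Ω : Set (SemiHom.Vec d)) (hΩ : IsOpen Ω) (hΩb : Bornology.IsBounded Ω)
    (f : SemiHom.Vec d → SemiHom.Mat m d → ℝ≥0∞)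
    (hf : Measurable (Function.uncurry f))
    (hper : ∀ (ξ : SemiHom.Mat m d) (x : SemiHom.Vec d) (j : Fin d),
      f (x + EuclideanSpace.single j 1) ξ = f x ξ)
    (hgrowth : ∃ c : ℝ, 0 < c ∧ ∀ (x : SemiHom.Vec d) (ξ : SemiHom.Mat m d),
      f x ξ ≤ ENNReal.ofReal (c * (1 + ‖ξ‖))) :
    (∀ (u : SemiHom.W1inf Ω m) (r : ℝ≥0∞),
      ∫⁻ x in Ω, SemiHom.homog f (u.grad x) ≤ SemiHom.G f r u) ∧
    (∀ u : SemiHom.W1inf Ω m, u.IsPiecewiseAffine → ∀ r : ℝ≥0,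
      SemiHom.H f (r + u.gradNorm) u ≤ ∫⁻ x in Ω, SemiHom.homogBdd r f (u.grad x)) ∧
    SemiHom.IsQuasiconvex (SemiHom.homog f) := by
  obtain ⟨c, hc, hfc⟩ := hgrowth
  exact ⟨fun u r => SemiHom.lintegral_homog_le_G hd hΩ hΩb hf hper hc hfc u r,
    fun u hu r => SemiHom.H_le_of_isPiecewiseAffine hΩ hΩb hper
      (A := fun ξ => SemiHom.growth c ‖ξ‖) (fun x ξ => SemiHom.le_growth hc hfc le_rfl x) u hu r,
    SemiHom.isQuasiconvex_homog hd hper hc hfc⟩
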